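/- Sharpness of the phase transitions of the Ashkin–Teller model. For a finite set $\Omega\subset\mathbb Z^2$, let $E_\Omega$ be the set of nearest-neighbour edges with both endpoints in $\Omega$, and let $\partial\Omega$ be the set of vertices of $\Omega$ that are adjacent to a vertex of $\mathbb Z^2\setminus\Omega$. For $J,U>0$, the Ashkin–Teller measure on pairs $(\tau,\tau')\in\{\pm1\}^\Omega\times\{\pm1\}^\Omega$ is $$\mathsf{AT}_{\Omega,J,U}(\tau,\tau')=\frac1Z\exp\Big[\sum_{uv\in E_\Omega}J\tau_u\tau_v+J\tau'_u\tau'_v+U\tau_u\tau'_u\tau_v\tau'_v\Big],$$ and $\mathsf{AT}^{+,+}_{\Omega,J,U}$ is this measure conditioned on $\tau=\tau'=1$ on $\partial\Omega$. Let $J,U>0$. Then for every $\beta>0$ the weak limit $\mathsf{AT}^{+,+}_{\beta J,\beta U}=\lim_{\Omega\nearrow\mathbb Z^2}\mathsf{AT}^{+,+}_{\Omega,\beta J,\beta U}$ exists and does not depend on the sequence of sets $\Omega$ increasing to $\mathbb Z^2$; denote its expectation by $\langle\cdot\rangle^{+,+}_{\beta J,\beta U}$. Moreover, there are $\beta_c^{\tau},\beta_c^{\tau\tau'}\in(0,\infty)$,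 depending only on $J,U$, such that for every $\beta>0$: - if $\beta<\beta_c^{\tau}$, there is $c=c(\beta,J,U)>0$ with $\langle\tau_0\tau_x\rangle^{+,+}_{\beta J,\beta U}\le e^{-c\|x\|}$ for all $x\in\mathbb Z^2$; - if $\beta>\beta_c^{\tau}$, there is $C=C(\beta,J,U)>0$ with $\langle\tau_0\tau_x\rangle^{+,+}_{\beta J,\beta U}\ge C$ for all $x\in\mathbb Z^2$; - if $\beta<\beta_c^{\tau\tau'}$, there is $c=c(\beta,J,U)>0$ with $\langle\tau_0\tau'_0\tau_x\tau'_x\rangle^{+,+}_{\beta J,\beta U}\le e^{-c\|x\|}$ for all $x\in\mathbb Z^2$; - if $\beta>\beta_c^{\tau\tau'}$, there is $C=C(\beta,J,U)>0$ with $\langle\tau_0\tau'_0\tau_x\tau'_x\rangle^{+,+}_{\beta J,\beta U}\ge C$ for all $x\in\mathbb Z^2$. Here $\|\cdot\|$ is the supremum norm (the choice of norm is immaterial). -/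

import Mathlib

open MeasureTheory ProbabilityTheory Filter Topology

noncomputable section

namespace AshkinTeller

/-- The `±1` value of a spin; `true` encodes `+1` and `false` encodes `-1`. -/
def sgn (b : Bool) : ℝ := if b then 1 else -1

/-- Pairs `(τ, τ')` of spin configurations on a vertex set `V`. -/
abbrev Config (V : Type*) : Type _ := (V → Bool) × (V → Bool)

/-- The spin `τ_v` as a real number. -/
def tau {V : Type*} (σ : Config V) (v : V) : ℝ := sgn (σ.1 v)

/-- The spin `τ'_v` as a real number. -/
def tau' {V : Type*} (σ : Config V) (v : V) : ℝ := sgn (σ.2 v)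

/-- The contribution of an edge `uv` to the exponent:
`J τ_u τ_v + J τ'_u τ'_v + U τ_u τ'_u τ_v τ'_v`. -/
def edgeTerm {V : Type*} (J U : ℝ) (σ : Config V) : Sym2 V → ℝ :=
  Sym2.lift ⟨fun u v => J * (tau σ u * tau σ v) + J * (tau' σ u * tau' σ v)
      + U * (tau σ u * tau' σ u * tau σ v * tau' σ v), by intro u v; ring⟩

open scoped Classical in
/-- The unnormalised Boltzmann weight of a configuration on a finite graph. -/
def weight {V : Type*} [Fintype V] (G : SimpleGraph V) (J U : ℝ) (σ : Config V) : ℝ :=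
  Real.exp (∑ e ∈ G.edgeFinset, edgeTerm J U σ e)

open scoped Classical in
/-- The partition function. -/
def partitionFunction {V : Type*} [Fintype V] (G : SimpleGraph V) (J U : ℝ) : ℝ :=
  ∑ σ : Config V, weight G J U σ

open scoped Classical in
/-- The (free) symmetric Ashkin–Teller measure on a finite graph. -/
def finiteMeasure {V : Type*} [Fintype V] (G : SimpleGraph V) (J U : ℝ) :
    Measure (Config V) :=
  ∑ σ : Config V, ENNReal.ofReal (weight G J U σ / partitionFunction G J U) • Measure.dirac σ

/-- Vertices of the square lattice `ℤ²`. -/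
abbrev Site : Type := ℤ × ℤ

/-- The nearest-neighbour graph on `ℤ²`. -/
def squareLattice : SimpleGraph Site where
  Adj u v := |u.1 - v.1| + |u.2 - v.2| = 1
  symm := ⟨by
    intro u v h
    rw [abs_sub_comm v.1, abs_sub_comm v.2]
    exact h⟩
  loopless := ⟨by
    intro u h
    simp at h⟩

/-- The subgraph of `ℤ²` induced by a finite set `Ω` of vertices. -/
def inducedGraph (Ω : Finset Site) : SimpleGraph Ω :=
  squareLattice.comap (fun v : Ω => (v : Site))

/-- Boundary vertices of `Ω`: those adjacent to some vertex of `ℤ²` outside `Ω`. -/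
def boundary (Ω : Finset Site) : Set Ω :=
  {v | ∃ w : Site, w ∉ Ω ∧ squareLattice.Adj v w}

/-- The event that `τ = τ' = +1` on the boundary of `Ω`. -/
def plusOnBoundary (Ω : Finset Site) : Set (Config Ω) :=
  {σ | ∀ v ∈ boundary Ω, tau σ v = 1 ∧ tau' σ v = 1}

/-- The Ashkin–Teller measure on `Ω` with plus boundary conditions: the free measure
conditioned on both spins being plus on the boundary. -/
def plusMeasure (Ω : Finset Site) (J U : ℝ) : Measure (Config Ω) :=
  ProbabilityTheory.cond (finiteMeasure (inducedGraph Ω) J U) (plusOnBoundary Ω)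

open scoped Classical in
/-- A configuration on `Ω` seen as a configuration on `ℤ²`, equal to plus outside `Ω`. -/
def extendPlus (Ω : Finset Site) (σ : Config Ω) : Config Site :=
  (fun v => if h : v ∈ Ω then σ.1 ⟨v, h⟩ else true,
   fun v => if h : v ∈ Ω then σ.2 ⟨v, h⟩ else true)

theorem weight_pos {V : Type*} [Fintype V] (G : SimpleGraph V) (J U : ℝ) (σ : Config V) :
    0 < weight G J U σ := Real.exp_pos _

theorem partitionFunction_pos {V : Type*} [Fintype V] (G : SimpleGraph V) (J U : ℝ) :
    0 < partitionFunction G J U := by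
  classical
  exact Finset.sum_pos (fun σ _ => weight_pos G J U σ) Finset.univ_nonempty

instance {V : Type*} [Fintype V] (G : SimpleGraph V) (J U : ℝ) :
    IsProbabilityMeasure (finiteMeasure G J U) := by
  classical
  constructor
  have hZ := partitionFunction_pos G J U
  simp only [finiteMeasure, Measure.coe_finsetSum, Finset.sum_apply, Measure.smul_apply,
    measure_univ, smul_eq_mul, mul_one]
  rw [← ENNReal.ofReal_sum_of_nonneg
    (fun σ _ => div_nonneg (weight_pos G J U σ).le hZ.le), ← Finset.sum_div]
  have : ∑ σ : Config V, weight G J U σ = partitionFunction G J U := by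
    unfold partitionFunction
    congr!
  rw [this, div_self hZ.ne', ENNReal.ofReal_one]

theorem finiteMeasure_plusOnBoundary_ne_zero (Ω : Finset Site) (J U : ℝ) :
    finiteMeasure (inducedGraph Ω) J U (plusOnBoundary Ω) ≠ 0 := by
  classical
  have hZ := partitionFunction_pos (inducedGraph Ω) J U
  let σ₀ : Config Ω := (fun _ => true, fun _ => true)
  have hmem : σ₀ ∈ plusOnBoundary Ω := fun v _ => by simp [tau, tau', sgn, σ₀]
  simp only [finiteMeasure, Measure.coe_finsetSum, Finset.sum_apply, Measure.smul_apply,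
    smul_eq_mul]
  intro h
  have h1 := (Finset.sum_eq_zero_iff.mp h) σ₀ (by convert Finset.mem_univ σ₀)
  rw [Measure.dirac_apply_of_mem hmem, mul_one, ENNReal.ofReal_eq_zero] at h1
  exact absurd (div_pos (weight_pos (inducedGraph Ω) J U σ₀) hZ) (not_lt.mpr h1)

instance (Ω : Finset Site) (J U : ℝ) : IsProbabilityMeasure (plusMeasure Ω J U) :=
  ProbabilityTheory.cond_isProbabilityMeasure (finiteMeasure_plusOnBoundary_ne_zero Ω J U)

theorem measurable_extendPlus (Ω : Finset Site) : Measurable (extendPlus Ω) :=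
  measurable_of_finite _

/-- The plus measure on `Ω` as a probability measure on configurations on `ℤ²`. -/
def plusMeasureOnLattice (Ω : Finset Site) (J U : ℝ) : ProbabilityMeasure (Config Site) :=
  ⟨(plusMeasure Ω J U).map (extendPlus Ω),
    Measure.isProbabilityMeasure_map (measurable_extendPlus Ω).aemeasurable⟩

/-- `μ` is the infinite-volume plus measure with parameters `J, U`: the weak limit of the
finite-volume plus measures as `Ω ↗ ℤ²`, for the product topology on configurations. The filter
`atTop` on finite sets of vertices makes the limit the same along all sequences `Ω_n ↗ ℤ²`. -/
def IsPlusLimit (J U : ℝ) (μ : ProbabilityMeasure (Config Site)) : Prop :=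
  Tendsto (fun Ω : Finset Site => plusMeasureOnLattice Ω J U) atTop (𝓝 μ)

/-- The correlation `⟨τ_0 τ_x⟩` under `μ`. -/
def corrTau (μ : ProbabilityMeasure (Config Site)) (x : Site) : ℝ :=
  ∫ σ, tau σ 0 * tau σ x ∂(μ : Measure (Config Site))

/-- The correlation `⟨τ_0 τ'_0 τ_x τ'_x⟩` under `μ`. -/
def corrProd (μ : ProbabilityMeasure (Config Site)) (x : Site) : ℝ :=
  ∫ σ, tau σ 0 * tau' σ 0 * tau σ x * tau' σ x ∂(μ : Measure (Config Site))

end AshkinTeller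

end

/-! Consider two Ising layers with couplings `(k₁, k₂, k₃)`, where `k₃` couples the products of the
layers; the pair `(τ, τ')` has couplings `(J, J, U)`. Replacing one layer by the product of the two
permutes the couplings, so `k₃` can be made the smallest one (`Coupling.Admissible`). For such
couplings the Edwards–Sokal expansion of the Boltzmann weight has nonnegative coefficients
satisfying Holley's condition. The first marginal `fkWeight` of the resulting two-layer
random-cluster measure is then monotonic, and the mean spin of the first layer at `x` is the
probability that `x` is connected to the plus boundary (`gibbs_spin_eq`).

In these variables `τ` is always the first layer, and so is `ττ'` when `U ≥ J`. When `U ≤ J` the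
product is not a layer, but its magnetisation lies below that of `τ` by the random-cluster
representation, and its two-point function is at least a product of two-point functions of `τ` and
`τ'` by Griffiths. Hence it has the transition of `τ`.

Sharpness follows the method of Duminil-Copin, Raoufi and Tassion. The OSSS inequality for monotonic
measures (`osss`) bounds the variance of the event "the origin is connected to the boundary of the
box" by a sum of covariances with edges, weighted by the probabilities that an exploration reveals
them. Exploring from the sphere of radius `k` and averaging over `1 ≤ k ≤ n` makes these
probabilities of order `(1/n) ∑ m(d)`, with `m(d)` the magnetisation at the centre of a box of size
`d`. The sum of covariances is the derivative in a field `h` favouring open edges of the first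
layer, and such a field is dominated by an increase of the inverse temperature (`localHolley_tilt`).
Integration in `h` gives, whenever `m_{b'}(n) ≤ 1/2`, the bound `m_b(2n) ≤ m_{b'}(n) exp(-c (b'-b) n
/ ∑_{d≤n} m_{b'}(d))`, and iteration over dyadic scales turns `m_{b'} → 0` into exponential decay at
every `b < b'`.

The critical point is the supremum of the inverse temperatures at which the magnetisation tends to
zero. It is positive by a finite-energy path expansion and finite by a Peierls argument. Above it
the magnetisation has a positive limit, and the second Griffiths inequality bounds correlations
below by powers of this limit. Below it, correlations are at most their values in the box whose
boundary passes through `x`; the spin at `x` is plus there, and a magnetisation remains.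

The Griffiths inequalities also give the infinite-volume limit: expectations of products of spins
decrease with the volume, differences of such positive observables form an algebra separating
points, and the configuration space is compact. -/

noncomputable section
set_option linter.unusedSectionVars false
namespace AshkinTeller

/-! ### FKG and Holley inequalities and conditional expectations for weights on edge configurations.
-/

section Monotonic

open scoped Classical in
/-- Four functions theorem in the form of a comparison of two measures. -/
theorem holley_compare {α : Type*} [Fintype α] [DistribLattice α] {μ ν f : α → ℝ}
    (hμ : 0 ≤ μ) (hν : 0 ≤ ν) (hf : Monotone f)
    (h : ∀ a b, μ a * ν b ≤ μ (a ⊓ b) * ν (a ⊔ b)) :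
    (∑ a, μ a * f a) * ∑ a, ν a ≤ (∑ a, μ a) * ∑ a, ν a * f a := by
  -- Adding a constant to `f` changes both sides by the same amount, so the nonnegativity demanded
  -- by the four functions theorem is free.
  obtain ⟨c, hc⟩ : ∃ c : ℝ, ∀ a, 0 ≤ f a + c := by
    refine ⟨∑ a, |f a|, fun a => ?_⟩
    have := Finset.single_le_sum (f := fun a => |f a|) (fun i _ => abs_nonneg (f i))
      (Finset.mem_univ a)
    have h2 := neg_abs_le (f a)
    linarith
  have key := four_functions_theorem_univ (fun a => μ a * (f a + c)) ν μ (fun a => ν a * (f a + c))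
    (fun a => mul_nonneg (hμ a) (hc a)) hν hμ (fun a => mul_nonneg (hν a) (hc a)) (fun a b => by
      have h1 : f a + c ≤ f (a ⊔ b) + c := by linarith [hf (le_sup_left : a ≤ a ⊔ b)]
      calc μ a * (f a + c) * ν b = μ a * ν b * (f a + c) := by ring
        _ ≤ μ (a ⊓ b) * ν (a ⊔ b) * (f (a ⊔ b) + c) :=
          mul_le_mul (h a b) h1 (hc a) (mul_nonneg (hμ _) (hν _))
        _ = _ := by ring)
  simp only [mul_add, Finset.sum_add_distrib, ← Finset.sum_mul] at key
  nlinarith [key]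

open scoped Classical in
/-- The FKG inequality without sign assumptions. -/
theorem fkg_sums {α : Type*} [Fintype α] [DistribLattice α] {μ f g : α → ℝ}
    (hμ : 0 ≤ μ) (hf : Monotone f) (hg : Monotone g)
    (h : ∀ a b, μ a * μ b ≤ μ (a ⊓ b) * μ (a ⊔ b)) :
    (∑ a, μ a * f a) * ∑ a, μ a * g a ≤ (∑ a, μ a) * ∑ a, μ a * (f a * g a) := by
  have hb : ∀ f : α → ℝ, ∃ c : ℝ, ∀ a, 0 ≤ f a + c := fun f => by
    refine ⟨∑ a, |f a|, fun a => ?_⟩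
    have := Finset.single_le_sum (f := fun a => |f a|) (fun i _ => abs_nonneg (f i))
      (Finset.mem_univ a)
    have h2 := neg_abs_le (f a)
    linarith
  obtain ⟨c, hc⟩ := hb f
  obtain ⟨d, hd⟩ := hb g
  have key := fkg (fun a => f a + c) (fun a => g a + d) μ hμ hc hd
    (fun a b hab => by simpa using hf hab) (fun a b hab => by simpa using hg hab) h
  have e1 : ∑ a, μ a * (f a + c) = ∑ a, μ a * f a + c * ∑ a, μ a := by
    rw [Finset.mul_sum, ← Finset.sum_add_distrib]; exact Finset.sum_congr rfl fun _ _ => by ring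
  have e2 : ∑ a, μ a * (g a + d) = ∑ a, μ a * g a + d * ∑ a, μ a := by
    rw [Finset.mul_sum, ← Finset.sum_add_distrib]; exact Finset.sum_congr rfl fun _ _ => by ring
  have e3 : ∑ a, μ a * ((f a + c) * (g a + d)) = ∑ a, μ a * (f a * g a) + d * ∑ a, μ a * f a
      + c * ∑ a, μ a * g a + c * d * ∑ a, μ a := by
    rw [Finset.mul_sum, Finset.mul_sum, Finset.mul_sum, ← Finset.sum_add_distrib,
      ← Finset.sum_add_distrib, ← Finset.sum_add_distrib]
    exact Finset.sum_congr rfl fun _ _ => by ring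
  rw [e1, e2, e3] at key
  nlinarith [key]

variable {E : Type*} [Fintype E] [DecidableEq E]

open scoped Classical in
/-- The restriction of the weight `ν` to the cylinder of configurations agreeing with `ξ` on `R`. -/
def cylWeight (ν : (E → Bool) → ℝ) (R : Finset E) (ξ ω : E → Bool) : ℝ :=
  if ∀ e ∈ R, ω e = ξ e then ν ω else 0

/-- Conditional expectation of `h` given that the configuration agrees with `ξ` on `R`. -/
def condMean (ν : (E → Bool) → ℝ) (R : Finset E) (ξ : E → Bool) (h : (E → Bool) → ℝ) : ℝ :=
  (∑ ω, cylWeight ν R ξ ω * h ω) / ∑ ω, cylWeight ν R ξ ω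

/-- Expectation of `h` under the normalisation of the weight `ν`. -/
def mean {α : Type*} [Fintype α] (ν : α → ℝ) (h : α → ℝ) : ℝ := (∑ ω, ν ω * h ω) / ∑ ω, ν ω

/-- The state of an edge as a real number. -/
def openInd (e : E) (ω : E → Bool) : ℝ := if ω e then 1 else 0

/-- The covariance of `f` with the state of the edge `e`. -/
def covEdge (ν : (E → Bool) → ℝ) (f : (E → Bool) → ℝ) (e : E) : ℝ :=
  mean ν (fun ω => f ω * openInd e ω) - mean ν f * mean ν (openInd e)

/-- A strictly positive weight satisfying the FKG lattice condition. -/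
structure IsLatticeWeight (ν : (E → Bool) → ℝ) : Prop where
  pos : ∀ ω, 0 < ν ω
  lattice : ∀ a b, ν a * ν b ≤ ν (a ⊓ b) * ν (a ⊔ b)

variable {ν : (E → Bool) → ℝ}

theorem cylWeight_nonneg (hν : ∀ ω, 0 < ν ω) (R : Finset E) (ξ ω : E → Bool) :
    0 ≤ cylWeight ν R ξ ω := by
  unfold cylWeight; split_ifs
  · exact (hν ω).le
  · exact le_rfl

theorem cylWeight_sum_pos (hν : ∀ ω, 0 < ν ω) (R : Finset E) (ξ : E → Bool) :
    0 < ∑ ω, cylWeight ν R ξ ω := by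
  refine Finset.sum_pos' (fun ω _ => cylWeight_nonneg hν R ξ ω) ⟨ξ, Finset.mem_univ _, ?_⟩
  simp [cylWeight, hν]

theorem cylWeight_congr {R : Finset E} {ξ η : E → Bool} (h : ∀ e ∈ R, ξ e = η e) (ω : E → Bool) :
    cylWeight ν R ξ ω = cylWeight ν R η ω := by
  unfold cylWeight
  congr 1
  exact propext (forall₂_congr fun e he => by rw [h e he])

theorem condMean_congr {R : Finset E} {ξ η : E → Bool} (h : ∀ e ∈ R, ξ e = η e)
    (f : (E → Bool) → ℝ) : condMean ν R ξ f = condMean ν R η f := by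
  simp only [condMean, cylWeight_congr h]

theorem condMean_congr_on {R : Finset E} {ξ : E → Bool} {f g : (E → Bool) → ℝ}
    (h : ∀ ω, (∀ e ∈ R, ω e = ξ e) → f ω = g ω) : condMean ν R ξ f = condMean ν R ξ g := by
  unfold condMean
  congr 1
  refine Finset.sum_congr rfl fun ω _ => ?_
  unfold cylWeight
  split_ifs with h1
  · rw [h ω h1]
  · simp

theorem condMean_empty (ξ : E → Bool) (f : (E → Bool) → ℝ) : condMean ν ∅ ξ f = mean ν f := by
  simp [condMean, mean, cylWeight]

theorem condMean_const (hν : ∀ ω, 0 < ν ω) (R : Finset E) (ξ : E → Bool) (c : ℝ) :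
    condMean ν R ξ (fun _ => c) = c := by
  unfold condMean
  rw [← Finset.sum_mul, mul_div_assoc, mul_div_cancel₀]
  exact (cylWeight_sum_pos hν R ξ).ne'

theorem condMean_eq_of_forall (hν : ∀ ω, 0 < ν ω) {R : Finset E} {ξ : E → Bool}
    {f : (E → Bool) → ℝ} {c : ℝ} (h : ∀ ω, (∀ e ∈ R, ω e = ξ e) → f ω = c) :
    condMean ν R ξ f = c := by
  rw [condMean_congr_on h, condMean_const hν]

theorem condMean_add (R : Finset E) (ξ : E → Bool) (f g : (E → Bool) → ℝ) :
    condMean ν R ξ (fun ω => f ω + g ω) = condMean ν R ξ f + condMean ν R ξ g := by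
  unfold condMean
  rw [← add_div, ← Finset.sum_add_distrib]
  simp only [mul_add]

theorem condMean_const_mul (R : Finset E) (ξ : E → Bool) (c : ℝ) (f : (E → Bool) → ℝ) :
    condMean ν R ξ (fun ω => c * f ω) = c * condMean ν R ξ f := by
  unfold condMean
  rw [← mul_div_assoc, Finset.mul_sum]
  congr 1
  exact Finset.sum_congr rfl fun _ _ => by ring

theorem condMean_mono (hν : ∀ ω, 0 < ν ω) (R : Finset E) (ξ : E → Bool) {f g : (E → Bool) → ℝ}
    (h : ∀ ω, f ω ≤ g ω) : condMean ν R ξ f ≤ condMean ν R ξ g := by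
  unfold condMean
  refine div_le_div_of_nonneg_right (Finset.sum_le_sum fun ω _ => ?_)
    (cylWeight_sum_pos hν R ξ).le
  exact mul_le_mul_of_nonneg_left (h ω) (cylWeight_nonneg hν R ξ ω)

/-- Holley's condition survives conditioning: the meet of a configuration equal to `ξ` on `R` with
one equal to `η ≥ ξ` on `R` again equals `ξ` there, and the join equals `η`. This is the only form
of monotonicity used by the coupling below. -/
theorem condMean_monotone (hν : IsLatticeWeight ν) {f : (E → Bool) → ℝ} (hf : Monotone f)
    (R : Finset E) {ξ η : E → Bool} (h : ∀ e ∈ R, ξ e ≤ η e) :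
    condMean ν R ξ f ≤ condMean ν R η f := by
  unfold condMean
  rw [div_le_div_iff₀ (cylWeight_sum_pos hν.pos R ξ) (cylWeight_sum_pos hν.pos R η),
    mul_comm (∑ ω, cylWeight ν R η ω * f ω)]
  refine holley_compare (fun ω => cylWeight_nonneg hν.pos R ξ ω)
    (fun ω => cylWeight_nonneg hν.pos R η ω) hf fun a b => ?_
  by_cases ha : ∀ e ∈ R, a e = ξ e
  · by_cases hb : ∀ e ∈ R, b e = η e
    · have h1 : ∀ e ∈ R, (a ⊓ b) e = ξ e := fun e he => by
        rw [Pi.inf_apply, ha e he, hb e he, inf_eq_left.2 (h e he)]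
      have h2 : ∀ e ∈ R, (a ⊔ b) e = η e := fun e he => by
        rw [Pi.sup_apply, ha e he, hb e he, sup_eq_right.2 (h e he)]
      simp only [cylWeight]
      rw [if_pos ha, if_pos hb, if_pos h1, if_pos h2]
      exact hν.lattice a b
    · have : cylWeight ν R η b = 0 := by simp only [cylWeight]; rw [if_neg hb]
      rw [this, mul_zero]
      exact mul_nonneg (cylWeight_nonneg hν.pos _ _ _) (cylWeight_nonneg hν.pos _ _ _)
  · have : cylWeight ν R ξ a = 0 := by simp only [cylWeight]; rw [if_neg ha]
    rw [this, zero_mul]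
    exact mul_nonneg (cylWeight_nonneg hν.pos _ _ _) (cylWeight_nonneg hν.pos _ _ _)

theorem mean_fkg (hν : IsLatticeWeight ν) {f g : (E → Bool) → ℝ} (hf : Monotone f)
    (hg : Monotone g) : mean ν f * mean ν g ≤ mean ν (fun ω => f ω * g ω) := by
  have hZ : 0 < ∑ ω, ν ω := Finset.sum_pos (fun ω _ => hν.pos ω) Finset.univ_nonempty
  have := fkg_sums (fun ω => (hν.pos ω).le) hf hg hν.lattice
  unfold mean
  rw [div_mul_div_comm, div_le_div_iff₀ (mul_pos hZ hZ) hZ]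
  calc _ ≤ ((∑ ω, ν ω) * ∑ ω, ν ω * (f ω * g ω)) * ∑ ω, ν ω :=
        mul_le_mul_of_nonneg_right this hZ.le
    _ = _ := by ring

theorem openInd_monotone (e : E) : Monotone (openInd e) := by
  intro a b hab
  unfold openInd
  have := hab e
  cases ha : a e <;> cases hb : b e <;> rw [ha, hb] at this <;> simp
  cases this rfl

theorem covEdge_nonneg (hν : IsLatticeWeight ν) {f : (E → Bool) → ℝ} (hf : Monotone f) (e : E) :
    0 ≤ covEdge ν f e :=
  sub_nonneg.2 (mean_fkg hν hf (openInd_monotone e))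

theorem condMean_openInd_mem (hν : ∀ ω, 0 < ν ω) (R : Finset E) (ξ : E → Bool) (e : E) :
    0 ≤ condMean ν R ξ (openInd e) ∧ condMean ν R ξ (openInd e) ≤ 1 := by
  constructor
  · have := condMean_mono hν R ξ (f := fun _ => 0) (g := openInd e) (fun ω => by
      unfold openInd; split_ifs <;> norm_num)
    rwa [condMean_const hν] at this
  · have := condMean_mono hν R ξ (g := fun _ => 1) (f := openInd e) (fun ω => by
      unfold openInd; split_ifs <;> norm_num)
    rwa [condMean_const hν] at this

theorem cylWeight_insert {R : Finset E} {e : E} (he : e ∉ R) (ξ ω : E → Bool) (b : Bool) :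
    cylWeight ν (insert e R) (Function.update ξ e b) ω =
      if ω e = b then cylWeight ν R ξ ω else 0 := by
  have h : (∀ e' ∈ insert e R, ω e' = Function.update ξ e b e') ↔
      ω e = b ∧ ∀ e' ∈ R, ω e' = ξ e' := by
    simp only [Finset.forall_mem_insert, Function.update_self]
    refine and_congr_right fun _ => forall₂_congr fun e' he' => ?_
    rw [Function.update_of_ne (ne_of_mem_of_not_mem he' he)]
  unfold cylWeight
  by_cases h1 : ω e = b
  · simp only [h, h1, true_and, if_true]
  · rw [if_neg (fun hh => h1 (h.1 hh).1), if_neg h1]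

/-- Splitting a conditional expectation according to the state of one further edge. -/
theorem condMean_split (hν : ∀ ω, 0 < ν ω) {R : Finset E} {e : E} (he : e ∉ R) (ξ : E → Bool)
    (f : (E → Bool) → ℝ) :
    condMean ν R ξ f = condMean ν R ξ (openInd e) *
        condMean ν (insert e R) (Function.update ξ e true) f +
      (1 - condMean ν R ξ (openInd e)) *
        condMean ν (insert e R) (Function.update ξ e false) f := by
  have key : ∀ g : (E → Bool) → ℝ, ∑ ω, cylWeight ν R ξ ω * g ω =
      ∑ ω, cylWeight ν (insert e R) (Function.update ξ e true) ω * g ω +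
      ∑ ω, cylWeight ν (insert e R) (Function.update ξ e false) ω * g ω := fun g => by
    rw [← Finset.sum_add_distrib]
    refine Finset.sum_congr rfl fun ω _ => ?_
    rw [cylWeight_insert he, cylWeight_insert he]
    cases ω e <;> simp
  have hZ := key (fun _ => 1)
  simp only [mul_one] at hZ
  have hO : ∑ ω, cylWeight ν R ξ ω * openInd e ω =
      ∑ ω, cylWeight ν (insert e R) (Function.update ξ e true) ω := by
    refine Finset.sum_congr rfl fun ω _ => ?_
    rw [cylWeight_insert he]
    unfold openInd
    cases ω e <;> simp
  have p1 := cylWeight_sum_pos hν (insert e R) (Function.update ξ e true)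
  have p2 := cylWeight_sum_pos hν (insert e R) (Function.update ξ e false)
  unfold condMean
  rw [key f, hO, hZ]
  field_simp
  ring

/-- The tower property. -/
theorem mean_condMean (hν : ∀ ω, 0 < ν ω) (R : Finset E) (f : (E → Bool) → ℝ) :
    mean ν (fun ω => condMean ν R ω f) = mean ν f := by
  unfold mean
  congr 1
  -- Resampling outside `R` is reversible for `ν`; this symmetry allows the two sums to be
  -- exchanged.
  have hsym : ∀ ω ω', ν ω * cylWeight ν R ω ω' = ν ω' * cylWeight ν R ω' ω := fun ω ω' => by
    unfold cylWeight
    by_cases h : ∀ e ∈ R, ω' e = ω e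
    · rw [if_pos h, if_pos (fun e he => (h e he).symm)]; ring
    · rw [if_neg h, if_neg (fun h' => h fun e he => (h' e he).symm)]; ring
  calc ∑ ω, ν ω * condMean ν R ω f
      = ∑ ω, ∑ ω', ν ω' * f ω' * (cylWeight ν R ω' ω / ∑ ζ, cylWeight ν R ω' ζ) := by
        refine Finset.sum_congr rfl fun ω _ => ?_
        unfold condMean
        rw [Finset.sum_div, Finset.mul_sum]
        refine Finset.sum_congr rfl fun ω' _ => ?_
        have h1 := hsym ω ω'
        by_cases h : ∀ e ∈ R, ω' e = ω e
        · have h2 : ∑ ζ, cylWeight ν R ω ζ = ∑ ζ, cylWeight ν R ω' ζ :=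
            Finset.sum_congr rfl fun ζ _ => cylWeight_congr (fun e he => (h e he).symm) ζ
          rw [h2]
          linear_combination (f ω' / ∑ ζ, cylWeight ν R ω' ζ) * h1
        · have h3 : cylWeight ν R ω ω' = 0 := by unfold cylWeight; rw [if_neg h]
          have h4 : cylWeight ν R ω' ω = 0 := by
            unfold cylWeight; rw [if_neg (fun h' => h fun e he => (h' e he).symm)]
          rw [h3, h4]; ring
    _ = ∑ ω', ν ω' * f ω' := by
        rw [Finset.sum_comm]
        refine Finset.sum_congr rfl fun ω' _ => ?_
        rw [← Finset.mul_sum, ← Finset.sum_div, div_self (cylWeight_sum_pos hν R ω').ne', mul_one]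

theorem mean_add {α : Type*} [Fintype α] (μ : α → ℝ) (f g : α → ℝ) :
    mean μ (fun ω => f ω + g ω) = mean μ f + mean μ g := by
  unfold mean
  rw [← add_div, ← Finset.sum_add_distrib]
  simp only [mul_add]

theorem mean_const_mul {α : Type*} [Fintype α] (μ : α → ℝ) (c : ℝ) (f : α → ℝ) :
    mean μ (fun ω => c * f ω) = c * mean μ f := by
  unfold mean
  rw [← mul_div_assoc, Finset.mul_sum]
  congr 1
  exact Finset.sum_congr rfl fun _ _ => by ring

theorem mean_sub {α : Type*} [Fintype α] (μ : α → ℝ) (f g : α → ℝ) :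
    mean μ (fun ω => f ω - g ω) = mean μ f - mean μ g := by
  unfold mean
  rw [← sub_div, ← Finset.sum_sub_distrib]
  simp only [mul_sub]

theorem mean_mono {α : Type*} [Fintype α] {μ : α → ℝ} (hμ : ∀ ω, 0 ≤ μ ω) {f g : α → ℝ}
    (h : ∀ ω, f ω ≤ g ω) : mean μ f ≤ mean μ g := by
  unfold mean
  exact div_le_div_of_nonneg_right
    (Finset.sum_le_sum fun ω _ => mul_le_mul_of_nonneg_left (h ω) (hμ ω))
    (Finset.sum_nonneg fun ω _ => hμ ω)

theorem mean_sum {α ι : Type*} [Fintype α] (μ : α → ℝ) (s : Finset ι) (f : ι → α → ℝ) :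
    mean μ (fun ω => ∑ i ∈ s, f i ω) = ∑ i ∈ s, mean μ (f i) := by
  unfold mean
  rw [← Finset.sum_div]
  congr 1
  simp only [Finset.mul_sum]
  exact Finset.sum_comm

end Monotonic

/-! ### The OSSS inequality for monotonic measures, and explorations as decision trees. -/

section DecisionTree

/-- Decision trees querying the states of edges, with real labels at the leaves. -/
inductive DTree (E : Type*) : Type _
  | leaf (g : ℝ) : DTree E
  | node (e : E) (t₀ t₁ : DTree E) : DTree E

namespace DTree

variable {E : Type*} [Fintype E] [DecidableEq E]

/-- The label of the leaf reached from `ω`. -/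
def run : DTree E → (E → Bool) → ℝ
  | leaf g, _ => g
  | node e t₀ t₁, ω => if ω e then t₁.run ω else t₀.run ω

/-- The total cost `c` of the edges queried when running the tree on `ω`. -/
def cost (c : E → ℝ) : DTree E → (E → Bool) → ℝ
  | leaf _, _ => 0
  | node e t₀ t₁, ω => c e + if ω e then t₁.cost c ω else t₀.cost c ω

/-- No edge of `R` is queried and no edge is queried twice. -/
def Fresh : DTree E → Finset E → Prop
  | leaf _, _ => True
  | node e t₀ t₁, R => e ∉ R ∧ t₀.Fresh (insert e R) ∧ t₁.Fresh (insert e R)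

/-- All leaf labels lie in `[-1, 1]`. -/
def Bounded : DTree E → Prop
  | leaf g => |g| ≤ 1
  | node _ t₀ t₁ => t₀.Bounded ∧ t₁.Bounded

/-- Expectation of the leaf label times `f` of a second configuration, for the monotone coupling
along the tree of a run started from `ξ` with a second configuration started from `η`. -/
def coupled (ν : (E → Bool) → ℝ) (f : (E → Bool) → ℝ) :
    DTree E → Finset E → (E → Bool) → (E → Bool) → ℝ
  | leaf g, R, _, η => g * condMean ν R η f
  | node e t₀ t₁, R, ξ, η =>
    let p := condMean ν R ξ (openInd e)
    let q := condMean ν R η (openInd e)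
    let R' := insert e R
    -- Both states of `e` are read off one uniform variable: the joint law of the events "open in
    -- the first" and "open in the second" has `min p q` on the diagonal. The tree follows the first
    -- configuration, while the second one only records its own values on the queried edges.
    min p q * coupled ν f t₁ R' (Function.update ξ e true) (Function.update η e true)
      + (p - min p q) * coupled ν f t₁ R' (Function.update ξ e true) (Function.update η e false)
      + (q - min p q) * coupled ν f t₀ R' (Function.update ξ e false) (Function.update η e true)
      + (1 - p - q + min p q) *
        coupled ν f t₀ R' (Function.update ξ e false) (Function.update η e false)

variable {ν : (E → Bool) → ℝ} {f : (E → Bool) → ℝ}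

theorem update_agree {R : Finset E} {η η' : E → Bool} (h : ∀ e ∈ R, η e = η' e) (e : E) (b : Bool) :
    ∀ e' ∈ insert e R, Function.update η e b e' = Function.update η' e b e' := by
  intro e' he'
  by_cases h1 : e' = e
  · subst h1; simp
  · rw [Function.update_of_ne h1, Function.update_of_ne h1]
    exact h e' ((Finset.mem_insert.1 he').resolve_left h1)

theorem update_le {R : Finset E} {η η' : E → Bool} (h : ∀ e ∈ R, η e ≤ η' e) (e : E)
    {b b' : Bool} (hb : b ≤ b') :
    ∀ e' ∈ insert e R, Function.update η e b e' ≤ Function.update η' e b' e' := by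
  intro e' he'
  by_cases h1 : e' = e
  · subst h1; simpa using hb
  · rw [Function.update_of_ne h1, Function.update_of_ne h1]
    exact h e' ((Finset.mem_insert.1 he').resolve_left h1)

theorem coupled_congr (t : DTree E) : ∀ (R : Finset E) (ξ η η' : E → Bool),
    (∀ e ∈ R, η e = η' e) → coupled ν f t R ξ η = coupled ν f t R ξ η' := by
  induction t with
  | leaf g => intro R ξ η η' h; simp only [coupled, condMean_congr h]
  | node e t₀ t₁ ih₀ ih₁ =>
    intro R ξ η η' h
    simp only [coupled, condMean_congr h (openInd e)]
    rw [ih₁ _ _ _ _ (update_agree h e true), ih₁ _ _ _ _ (update_agree h e false),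
      ih₀ _ _ _ _ (update_agree h e true), ih₀ _ _ _ _ (update_agree h e false)]

theorem agree_update {R : Finset E} {ξ ω : E → Bool} {e : E} {b : Bool}
    (h : ∀ e' ∈ insert e R, ω e' = Function.update ξ e b e') : ω e = b := by
  simpa using h e (Finset.mem_insert_self e R)

/-- On the diagonal the coupled expectation is an ordinary expectation. -/
theorem coupled_self (hν : ∀ ω, 0 < ν ω) (t : DTree E) : ∀ (R : Finset E) (ξ : E → Bool),
    t.Fresh R → coupled ν f t R ξ ξ = condMean ν R ξ (fun ω => t.run ω * f ω) := by
  induction t with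
  | leaf g => intro R ξ _; simp only [coupled, run, condMean_const_mul]
  | node e t₀ t₁ ih₀ ih₁ =>
    intro R ξ h
    rw [condMean_split hν h.1]
    have e1 : condMean ν (insert e R) (Function.update ξ e true)
        (fun ω => (node e t₀ t₁).run ω * f ω) =
        condMean ν (insert e R) (Function.update ξ e true) (fun ω => t₁.run ω * f ω) :=
      condMean_congr_on fun ω hω => by simp [run, agree_update hω]
    have e0 : condMean ν (insert e R) (Function.update ξ e false)
        (fun ω => (node e t₀ t₁).run ω * f ω) =
        condMean ν (insert e R) (Function.update ξ e false) (fun ω => t₀.run ω * f ω) :=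
      condMean_congr_on fun ω hω => by simp [run, agree_update hω]
    rw [e1, e0, ← ih₁ _ _ h.2.2, ← ih₀ _ _ h.2.1]
    simp only [coupled, min_self]
    ring

theorem abs_combination_le {a b c : ℝ} {X Y Z x y z : ℝ} (ha : 0 ≤ a) (hb : 0 ≤ b) (hc : 0 ≤ c)
    (hX : |X| ≤ x) (hY : |Y| ≤ y) (hZ : |Z| ≤ z) :
    |a * X + b * Y + c * Z| ≤ a * x + b * y + c * z := by
  rw [abs_le] at *
  constructor <;> nlinarith

/-- Run the tree with the same uniform variables for `η` and for `η' ≥ η`. The conditional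
probabilities are ordered, so the revealed values stay ordered, and at a leaf the label is at most
one in absolute value. The bound is therefore the change of the conditional mean of `f`, computed by
splitting along the same queries. -/
theorem coupled_lipschitz (hν : IsLatticeWeight ν) (hf : Monotone f) (t : DTree E) :
    ∀ (R : Finset E) (ξ η η' : E → Bool), t.Fresh R → t.Bounded → (∀ e ∈ R, η e ≤ η' e) →
    |coupled ν f t R ξ η' - coupled ν f t R ξ η| ≤ condMean ν R η' f - condMean ν R η f := by
  induction t with
  | leaf g =>
    intro R ξ η η' _ hg h
    simp only [coupled, ← mul_sub, abs_mul]
    have h1 : 0 ≤ condMean ν R η' f - condMean ν R η f :=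
      sub_nonneg.2 (condMean_monotone hν hf R h)
    rw [abs_of_nonneg h1]
    have : |g| ≤ 1 := hg
    nlinarith
  | node e t₀ t₁ ih₀ ih₁ =>
    intro R ξ η η' hF hB h
    have hp := condMean_openInd_mem hν.pos R ξ e
    have hq' := condMean_openInd_mem hν.pos R η' e
    have hq := condMean_openInd_mem hν.pos R η e
    have hqq : condMean ν R η (openInd e) ≤ condMean ν R η' (openInd e) :=
      condMean_monotone hν (openInd_monotone e) R h
    rw [condMean_split hν.pos hF.1 η' f, condMean_split hν.pos hF.1 η f]
    simp only [coupled]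
    generalize condMean ν R ξ (openInd e) = p at *
    generalize condMean ν R η' (openInd e) = q' at *
    generalize condMean ν R η (openInd e) = q at *
    have A1 := ih₁ (insert e R) (Function.update ξ e true) _ _ hF.2.2 hB.2
      (update_le h e (le_refl true))
    have A2 := ih₁ (insert e R) (Function.update ξ e true) _ _ hF.2.2 hB.2
      (update_le h e (Bool.false_le true))
    have A3 := ih₁ (insert e R) (Function.update ξ e true) _ _ hF.2.2 hB.2
      (update_le h e (le_refl false))
    have B1 := ih₀ (insert e R) (Function.update ξ e false) _ _ hF.2.1 hB.1
      (update_le h e (le_refl true))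
    have B2 := ih₀ (insert e R) (Function.update ξ e false) _ _ hF.2.1 hB.1
      (update_le h e (Bool.false_le true))
    have B3 := ih₀ (insert e R) (Function.update ξ e false) _ _ hF.2.1 hB.1
      (update_le h e (le_refl false))
    set m := min p q with hm
    set m' := min p q' with hm'
    have hmm : m ≤ m' := min_le_min le_rfl hqq
    have hm0 : 0 ≤ m := le_min hp.1 hq.1
    have hmp : m' ≤ p := min_le_left _ _
    have hd : q - m ≤ q' - m' := by
      rcases le_total p q with h1 | h1
      · rw [hm, hm', min_eq_left h1, min_eq_left (h1.trans hqq)]; linarith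
      · rw [hm, min_eq_right h1]; linarith [min_le_right p q']
    have hqm : 0 ≤ q - m := by linarith [min_le_right p q]
    have hlast : 0 ≤ 1 - p - q' + m' := by
      rcases le_total p q' with h1 | h1
      · rw [hm', min_eq_left h1]; linarith
      · rw [hm', min_eq_right h1]; linarith
    have C1 := abs_combination_le hm0 (sub_nonneg.2 hmm) (sub_nonneg.2 hmp) A1 A2 A3
    have C0 := abs_combination_le hqm (sub_nonneg.2 hd) hlast B1 B2 B3
    have C := (abs_add_le _ _).trans (add_le_add C1 C0)
    refine le_of_eq_of_le ?_ (C.trans (le_of_eq ?_))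
    · congr 1; ring
    · ring

/-- One replacement step. Sampling `e` in the two configurations independently instead of by the
common uniform variable moves mass `min p q - p q ≤ q (1 - q)` in each of the two subtrees. By
`coupled_lipschitz` each move costs at most the difference of the conditional means of `f` with `e`
open and closed. Times `q (1 - q)` this is the conditional covariance of `f` and `e`. -/
theorem mean_coupled_node (hν : IsLatticeWeight ν) (hf : Monotone f) {e : E} {t₀ t₁ : DTree E}
    {R : Finset E} (ξ : E → Bool) (hF : (node e t₀ t₁).Fresh R) (hB : (node e t₀ t₁).Bounded) :
    |mean ν (fun ω => coupled ν f (node e t₀ t₁) R ξ ω) -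
      (condMean ν R ξ (openInd e) *
          mean ν (fun ω => coupled ν f t₁ (insert e R) (Function.update ξ e true) ω) +
        (1 - condMean ν R ξ (openInd e)) *
          mean ν (fun ω => coupled ν f t₀ (insert e R) (Function.update ξ e false) ω))|
      ≤ 2 * covEdge ν f e := by
  set p := condMean ν R ξ (openInd e) with hpdef
  have hp := condMean_openInd_mem hν.pos R ξ e
  rw [← hpdef] at hp
  have htower : ∀ (t : DTree E) (ζ : E → Bool),
      mean ν (fun ω => coupled ν f t (insert e R) ζ ω) =
      mean ν (fun ω => condMean ν R ω (openInd e) *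
          coupled ν f t (insert e R) ζ (Function.update ω e true) +
        (1 - condMean ν R ω (openInd e)) *
          coupled ν f t (insert e R) ζ (Function.update ω e false)) := fun t ζ => by
    rw [← mean_condMean hν.pos R]
    congr 1
    funext ω
    rw [condMean_split hν.pos hF.1]
    congr 2
    · exact condMean_eq_of_forall hν.pos fun ω' h => coupled_congr t _ _ _ _ h
    · exact condMean_eq_of_forall hν.pos fun ω' h => coupled_congr t _ _ _ _ h
  rw [htower, htower, ← mean_const_mul, ← mean_const_mul, ← mean_add, ← mean_sub]
  -- Law of total covariance: the averaged conditional covariance is the full covariance minus the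
  -- covariance of the two conditional means, which is nonnegative by FKG since both are increasing.
  have hcov : mean ν (fun ω => condMean ν R ω (openInd e) * (1 - condMean ν R ω (openInd e)) *
      (condMean ν (insert e R) (Function.update ω e true) f -
        condMean ν (insert e R) (Function.update ω e false) f)) ≤ covEdge ν f e := by
    have h1 : ∀ ω, condMean ν R ω (openInd e) * (1 - condMean ν R ω (openInd e)) *
      (condMean ν (insert e R) (Function.update ω e true) f -
        condMean ν (insert e R) (Function.update ω e false) f) =
        condMean ν R ω (fun ω' => f ω' * openInd e ω') -
          condMean ν R ω f * condMean ν R ω (openInd e) := fun ω => by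
      rw [condMean_split hν.pos hF.1 ω (fun ω' => f ω' * openInd e ω'),
        condMean_split hν.pos hF.1 ω f]
      have e1 : condMean ν (insert e R) (Function.update ω e true)
          (fun ω' => f ω' * openInd e ω') =
          condMean ν (insert e R) (Function.update ω e true) f :=
        condMean_congr_on fun ω' h => by simp [openInd, agree_update h]
      have e0 : condMean ν (insert e R) (Function.update ω e false)
          (fun ω' => f ω' * openInd e ω') = 0 :=
        condMean_eq_of_forall hν.pos fun ω' h => by simp [openInd, agree_update h]
      rw [e1, e0]; ring
    simp only [h1]
    rw [mean_sub, mean_condMean hν.pos]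
    unfold covEdge
    have := mean_fkg hν (f := fun ω => condMean ν R ω f)
      (g := fun ω => condMean ν R ω (openInd e))
      (fun a b hab => condMean_monotone hν hf R fun e _ => hab e)
      (fun a b hab => condMean_monotone hν (openInd_monotone e) R fun e _ => hab e)
    rw [mean_condMean hν.pos, mean_condMean hν.pos] at this
    linarith
  refine le_trans ?_ (mul_le_mul_of_nonneg_left hcov (by norm_num : (0 : ℝ) ≤ 2))
  rw [← mean_const_mul]
  have hpt : ∀ ω, |coupled ν f (node e t₀ t₁) R ξ ω -
      (p * (condMean ν R ω (openInd e) *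
          coupled ν f t₁ (insert e R) (Function.update ξ e true) (Function.update ω e true) +
        (1 - condMean ν R ω (openInd e)) *
          coupled ν f t₁ (insert e R) (Function.update ξ e true) (Function.update ω e false)) +
      (1 - p) * (condMean ν R ω (openInd e) *
          coupled ν f t₀ (insert e R) (Function.update ξ e false) (Function.update ω e true) +
        (1 - condMean ν R ω (openInd e)) *
          coupled ν f t₀ (insert e R) (Function.update ξ e false) (Function.update ω e false)))| ≤
      2 * (condMean ν R ω (openInd e) * (1 - condMean ν R ω (openInd e)) *
      (condMean ν (insert e R) (Function.update ω e true) f -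
        condMean ν (insert e R) (Function.update ω e false) f)) := fun ω => by
    have A1 := coupled_lipschitz hν hf t₁ (insert e R) (Function.update ξ e true) _ _
      hF.2.2 hB.2 (update_le (fun e _ => le_refl (ω e)) e (Bool.false_le true))
    have A0 := coupled_lipschitz hν hf t₀ (insert e R) (Function.update ξ e false) _ _
      hF.2.1 hB.1 (update_le (fun e _ => le_refl (ω e)) e (Bool.false_le true))
    have hq := condMean_openInd_mem hν.pos R ω e
    simp only [coupled, ← hpdef]
    generalize condMean ν R ω (openInd e) = q at *
    have hc0 : 0 ≤ min p q - p * q := by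
      rcases le_total p q with h1 | h1
      · rw [min_eq_left h1]; nlinarith
      · rw [min_eq_right h1]; nlinarith
    have hc1 : min p q - p * q ≤ q * (1 - q) := by
      rcases le_total p q with h1 | h1
      · rw [min_eq_left h1]; nlinarith
      · rw [min_eq_right h1]; nlinarith
    have hM := (abs_nonneg _).trans A1
    generalize min p q = m at *
    have key := abs_combination_le (c := 0) hc0 hc0 le_rfl A1
      ((abs_neg _).trans_le A0) (le_refl |(0 : ℝ)|)
    refine le_trans (le_of_eq ?_) (key.trans ?_)
    · congr 1; ring
    · nlinarith
  refine abs_le.2 ⟨?_, ?_⟩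
  · rw [neg_le, ← neg_one_mul, ← mean_const_mul]
    exact mean_mono (fun ω => (hν.pos ω).le) fun ω => by
      rw [neg_one_mul]; exact (neg_le_abs _).trans (hpt ω)
  · exact mean_mono (fun ω => (hν.pos ω).le) fun ω => (le_abs_self _).trans (hpt ω)

/-- The replacement errors of `mean_coupled_node` add up along the tree to twice the cost of the
queried edges. Once every query is independent, a leaf contributes its label times the plain mean of
`f`. -/
theorem abs_mean_coupled_sub_le (hν : IsLatticeWeight ν) (hf : Monotone f) (t : DTree E) :
    ∀ (R : Finset E) (ξ : E → Bool), t.Fresh R → t.Bounded →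
    |mean ν (fun ω => coupled ν f t R ξ ω) - condMean ν R ξ t.run * mean ν f| ≤
      2 * condMean ν R ξ (t.cost (covEdge ν f)) := by
  induction t with
  | leaf g =>
    intro R ξ _ _
    simp only [coupled, run, cost, mean_const_mul, mean_condMean hν.pos]
    change |g * mean ν f - condMean ν R ξ (fun _ => g) * mean ν f| ≤
      2 * condMean ν R ξ (fun _ => 0)
    rw [condMean_const hν.pos, condMean_const hν.pos]
    simp
  | node e t₀ t₁ ih₀ ih₁ =>
    intro R ξ hF hB
    have I1 := ih₁ (insert e R) (Function.update ξ e true) hF.2.2 hB.2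
    have I0 := ih₀ (insert e R) (Function.update ξ e false) hF.2.1 hB.1
    have key := mean_coupled_node hν hf ξ hF hB
    have hp := condMean_openInd_mem hν.pos R ξ e
    have r1 : condMean ν (insert e R) (Function.update ξ e true) (node e t₀ t₁).run =
        condMean ν (insert e R) (Function.update ξ e true) t₁.run :=
      condMean_congr_on fun ω hω => by simp [run, agree_update hω]
    have r0 : condMean ν (insert e R) (Function.update ξ e false) (node e t₀ t₁).run =
        condMean ν (insert e R) (Function.update ξ e false) t₀.run :=
      condMean_congr_on fun ω hω => by simp [run, agree_update hω]
    have c1 : condMean ν (insert e R) (Function.update ξ e true)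
        ((node e t₀ t₁).cost (covEdge ν f)) = covEdge ν f e +
        condMean ν (insert e R) (Function.update ξ e true) (t₁.cost (covEdge ν f)) := by
      have h := condMean_add (ν := ν) (insert e R) (Function.update ξ e true)
        (fun _ => covEdge ν f e) (t₁.cost (covEdge ν f))
      rw [condMean_const hν.pos] at h
      rw [← h]
      exact condMean_congr_on fun ω hω => by simp [cost, agree_update hω]
    have c0 : condMean ν (insert e R) (Function.update ξ e false)
        ((node e t₀ t₁).cost (covEdge ν f)) = covEdge ν f e +
        condMean ν (insert e R) (Function.update ξ e false) (t₀.cost (covEdge ν f)) := by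
      have h := condMean_add (ν := ν) (insert e R) (Function.update ξ e false)
        (fun _ => covEdge ν f e) (t₀.cost (covEdge ν f))
      rw [condMean_const hν.pos] at h
      rw [← h]
      exact condMean_congr_on fun ω hω => by simp [cost, agree_update hω]
    rw [condMean_split hν.pos hF.1 ξ (node e t₀ t₁).run,
      condMean_split hν.pos hF.1 ξ ((node e t₀ t₁).cost (covEdge ν f)), r1, r0, c1, c0]
    generalize condMean ν R ξ (openInd e) = p at *
    rw [abs_le] at *
    constructor <;> nlinarith

end DTree

variable {E : Type*} [Fintype E] [DecidableEq E]

/-- The OSSS inequality for monotonic measures, in covariance form. -/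
theorem osss {ν : (E → Bool) → ℝ} (hν : IsLatticeWeight ν) {f : (E → Bool) → ℝ}
    (hf : Monotone f) (t : DTree E) (hF : t.Fresh ∅) (hB : t.Bounded) :
    mean ν (fun ω => t.run ω * f ω) - mean ν t.run * mean ν f ≤
      2 * mean ν (t.cost (covEdge ν f)) := by
  have := DTree.abs_mean_coupled_sub_le hν hf t ∅ (fun _ => false) hF hB
  -- With nothing revealed the second starting point is irrelevant, so both runs may start on the
  -- diagonal, where they coincide.
  have h0 : ∀ ω, DTree.coupled ν f t ∅ (fun _ => false) ω = mean ν (fun ω => t.run ω * f ω) :=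
    fun ω => by
      rw [DTree.coupled_congr t ∅ _ ω (fun _ => false) (by simp), DTree.coupled_self hν.pos _ _ _ hF,
        condMean_empty]
  simp only [h0] at this
  have hc := condMean_const hν.pos ∅ (fun _ => false) (mean ν (fun ω => t.run ω * f ω))
  rw [condMean_empty] at this hc
  rw [hc, condMean_empty] at this
  exact (le_abs_self _).trans this

open scoped Classical in
/-- The decision tree which keeps querying edges `e` satisfying `Q ξ e`, where `ξ` is the set of
edges already found to be open, for at most `k` steps. -/
def exploreTree (Q : (E → Bool) → E → Prop) (g : (E → Bool) → ℝ) :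
    ℕ → Finset E → (E → Bool) → DTree E
  | 0, _, ξ => .leaf (g ξ)
  | k + 1, R, ξ =>
    if h : ∃ e, e ∉ R ∧ Q ξ e then
      .node h.choose
        (exploreTree Q g k (insert h.choose R) (Function.update ξ h.choose false))
        (exploreTree Q g k (insert h.choose R) (Function.update ξ h.choose true))
    else .leaf (g ξ)

theorem exploreTree_fresh (Q : (E → Bool) → E → Prop) (g : (E → Bool) → ℝ) (k : ℕ) :
    ∀ R ξ, (exploreTree Q g k R ξ).Fresh R := by
  induction k with
  | zero => intro R ξ; trivial
  | succ k ih =>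
    intro R ξ
    unfold exploreTree
    split_ifs with h
    · exact ⟨h.choose_spec.1, ih _ _, ih _ _⟩
    · trivial

theorem exploreTree_bounded (Q : (E → Bool) → E → Prop) {g : (E → Bool) → ℝ}
    (hg : ∀ ω, |g ω| ≤ 1) (k : ℕ) : ∀ R ξ, (exploreTree Q g k R ξ).Bounded := by
  induction k with
  | zero => intro R ξ; exact hg ξ
  | succ k ih =>
    intro R ξ
    unfold exploreTree
    split_ifs with h
    · exact ⟨ih _ _, ih _ _⟩
    · exact hg ξ

/-- The tree stops either with every edge revealed, so that `ξ = ω`, or because no unrevealed edge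
satisfies `Q ξ`. In the second case `ξ`, which closes all unrevealed edges, differs from `ω` only
where `hdet` allows it. The cardinality bound says that the step budget cannot run out earlier. -/
theorem exploreTree_run {Q : (E → Bool) → E → Prop} {g : (E → Bool) → ℝ}
    (hdet : ∀ ξ ω : E → Bool, ξ ≤ ω → (∀ e, ω e ≠ ξ e → ¬ Q ξ e) → g ω = g ξ)
    (ω : E → Bool) (k : ℕ) : ∀ (R : Finset E) (ξ : E → Bool), Fintype.card E ≤ k + R.card →
      (∀ e ∈ R, ω e = ξ e) → (∀ e ∉ R, ξ e = false) → (exploreTree Q g k R ξ).run ω = g ω := by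
  induction k with
  | zero =>
    intro R ξ hk h1 _
    have hR : R = Finset.univ := Finset.eq_univ_of_card R
      (le_antisymm (Finset.card_le_univ R) (by simpa using hk))
    have : ω = ξ := funext fun e => h1 e (hR ▸ Finset.mem_univ e)
    rw [this]; rfl
  | succ k ih =>
    intro R ξ hk h1 h2
    unfold exploreTree
    split_ifs with h
    · obtain ⟨hR, -⟩ := h.choose_spec
      set e := h.choose
      have step : ∀ b, ω e = b →
          (exploreTree Q g k (insert e R) (Function.update ξ e b)).run ω = g ω := fun b hb => by
        apply ih
        · rw [Finset.card_insert_of_notMem hR]; omega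
        · intro e' he'
          by_cases h3 : e' = e
          · rw [h3, Function.update_self, hb]
          · rw [Function.update_of_ne h3]
            exact h1 e' ((Finset.mem_insert.1 he').resolve_left h3)
        · intro e' he'
          rw [Finset.mem_insert, not_or] at he'
          rw [Function.update_of_ne he'.1]
          exact h2 e' he'.2
      simp only [DTree.run]
      cases hb : ω e
      · simpa using step false hb
      · simpa using step true hb
    · refine (hdet ξ ω (fun e => ?_) fun e he hQ => h ⟨e, fun hR => he (h1 e hR), hQ⟩).symm
      by_cases hR : e ∈ R
      · exact (h1 e hR).ge
      · rw [h2 e hR]; exact Bool.false_le _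

-- The recorded configuration `ξ` stays below `ω` and `Q` is increasing, so a queried edge satisfies
-- `Q ω`; each edge is queried at most once.
open scoped Classical in
theorem exploreTree_cost_le {Q : (E → Bool) → E → Prop} {g : (E → Bool) → ℝ}
    (hQ : ∀ ξ ω : E → Bool, ξ ≤ ω → ∀ e, Q ξ e → Q ω e) {c : E → ℝ} (hc : ∀ e, 0 ≤ c e)
    (ω : E → Bool) (k : ℕ) : ∀ (R : Finset E) (ξ : E → Bool), ξ ≤ ω →
      (exploreTree Q g k R ξ).cost c ω ≤ ∑ e ∈ Rᶜ, if Q ω e then c e else 0 := by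
  have hnn : ∀ R : Finset E, 0 ≤ ∑ e ∈ R, if Q ω e then c e else 0 := fun R =>
    Finset.sum_nonneg fun e _ => by split_ifs; exacts [hc e, le_rfl]
  induction k with
  | zero => intro R ξ _; exact hnn _
  | succ k ih =>
    intro R ξ hξ
    unfold exploreTree
    split_ifs with h
    · obtain ⟨hR, hq⟩ := h.choose_spec
      set e := h.choose
      have hsplit : ∑ e ∈ Rᶜ, (if Q ω e then c e else 0) =
          c e + ∑ e ∈ (insert e R)ᶜ, if Q ω e then c e else 0 := by
        rw [Finset.compl_insert, ← Finset.add_sum_erase Rᶜ _ (Finset.mem_compl.2 hR),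
          if_pos (hQ ξ ω hξ e hq)]
      have step : ∀ b, ω e = b →
          (exploreTree Q g k (insert e R) (Function.update ξ e b)).cost c ω ≤
            ∑ e ∈ (insert e R)ᶜ, if Q ω e then c e else 0 := fun b hb => by
        apply ih
        intro e'
        by_cases h3 : e' = e
        · rw [h3, Function.update_self, hb]
        · rw [Function.update_of_ne h3]; exact hξ e'
      rw [hsplit]
      simp only [DTree.cost]
      cases hb : ω e
      · simpa using step false hb
      · simpa using step true hb
    · exact hnn _

open scoped Classical in
/-- The OSSS inequality for an event determined by an exploration. -/
theorem osss_explore {ν : (E → Bool) → ℝ} (hν : IsLatticeWeight ν) {f : (E → Bool) → ℝ}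
    (hf : Monotone f) (hf01 : ∀ ω, f ω = 0 ∨ f ω = 1) (Q : (E → Bool) → E → Prop)
    (hQ : ∀ ξ ω : E → Bool, ξ ≤ ω → ∀ e, Q ξ e → Q ω e)
    (hdet : ∀ ξ ω : E → Bool, ξ ≤ ω → (∀ e, ω e ≠ ξ e → ¬ Q ξ e) → f ω = f ξ) :
    mean ν f * (1 - mean ν f) ≤
      2 * ∑ e, mean ν (fun ω => if Q ω e then 1 else 0) * covEdge ν f e := by
  set t := exploreTree Q f (Fintype.card E) ∅ (fun _ => false) with ht
  have hrun : t.run = f := funext fun ω =>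
    exploreTree_run hdet ω _ _ _ (by simp) (by simp) (by simp)
  have hb : ∀ ω, |f ω| ≤ 1 := fun ω => by rcases hf01 ω with h | h <;> simp [h]
  have key := osss hν hf t (exploreTree_fresh _ _ _ _ _) (exploreTree_bounded _ hb _ _ _)
  rw [hrun] at key
  have hsq : (fun ω => f ω * f ω) = f := funext fun ω => by rcases hf01 ω with h | h <;> simp [h]
  rw [hsq] at key
  have hcost : mean ν (t.cost (covEdge ν f)) ≤
      ∑ e, mean ν (fun ω => if Q ω e then 1 else 0) * covEdge ν f e := by
    calc mean ν (t.cost (covEdge ν f))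
        ≤ mean ν (fun ω => ∑ e, covEdge ν f e * (if Q ω e then 1 else 0)) := by
          refine mean_mono (fun ω => (hν.pos ω).le) fun ω => ?_
          have := exploreTree_cost_le (g := f) hQ (fun e => covEdge_nonneg hν hf e) ω
            (Fintype.card E) ∅ (fun _ => false) (fun e => Bool.false_le _)
          simpa using this
      _ = _ := by
          rw [mean_sum]
          exact Finset.sum_congr rfl fun e _ => by rw [mean_const_mul]; ring
  linarith

end DecisionTree

/-! ### Edwards–Sokal coupling and the two-layer random-cluster measure on a finite graph. -/

section RandomCluster

/-- The spin at `v` of the configuration whose set of minus spins is `A`. -/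
def spin {V : Type*} [DecidableEq V] (A : Finset V) (v : V) : ℝ := if v ∈ A then -1 else 1

variable {V : Type*} [DecidableEq V] {E : Type*} [Fintype E] [DecidableEq E] (src tgt : E → V)

/-- The edge `e` has equal spins at its endpoints in the configuration with minus set `A`. -/
def Agree (A : Finset V) (e : E) : Prop := src e ∈ A ↔ tgt e ∈ A

/-- All open edges of `ω` have equal spins at their endpoints. -/
def Compat (ω : E → Bool) (A : Finset V) : Prop := ∀ e, ω e = true → Agree src tgt A e

open scoped Classical in
/-- The minus sets contained in `I` that are compatible with `ω`. -/
def compatSets (I : Finset V) (ω : E → Bool) : Finset (Finset V) :=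
  I.powerset.filter (Compat src tgt ω)

/-- The number of compatible minus sets. -/
def numCompat (I : Finset V) (ω : E → Bool) : ℝ := ((compatSets src tgt I ω).card : ℝ)

/-- Every compatible minus set inside `I` avoids `x`; equivalently the open cluster of `x` reaches
the complement of `I`. -/
def Forced (I : Finset V) (ω : E → Bool) (x : V) : Prop :=
  ∀ A ⊆ I, Compat src tgt ω A → x ∉ A

open scoped Classical in
/-- The indicator of `Forced`. -/
def forcedInd (I : Finset V) (x : V) (ω : E → Bool) : ℝ := if Forced src tgt I ω x then 1 else 0

variable {src tgt}

theorem mem_compatSets {I : Finset V} {ω : E → Bool} {A : Finset V} :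
    A ∈ compatSets src tgt I ω ↔ A ⊆ I ∧ Compat src tgt ω A := by
  simp [compatSets]

theorem Agree.symmDiff {A B : Finset V} {e : E} (hA : Agree src tgt A e) (hB : Agree src tgt B e) :
    Agree src tgt (symmDiff A B) e := by
  unfold Agree at *
  rw [Finset.mem_symmDiff, Finset.mem_symmDiff, hA, hB]

theorem Compat.symmDiff {ω : E → Bool} {A B : Finset V} (hA : Compat src tgt ω A)
    (hB : Compat src tgt ω B) : Compat src tgt ω (symmDiff A B) :=
  fun e he => (hA e he).symmDiff (hB e he)

theorem Compat.anti {ω ω' : E → Bool} (h : ω ≤ ω') {A : Finset V} (hA : Compat src tgt ω' A) :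
    Compat src tgt ω A := fun e he => hA e (by
      have := h e
      rw [he] at this
      exact top_le_iff.1 this)

theorem compat_empty (ω : E → Bool) : Compat src tgt ω ∅ := fun e _ => by simp [Agree]

theorem symmDiff_subset' {A B I : Finset V} (hA : A ⊆ I) (hB : B ⊆ I) : symmDiff A B ⊆ I :=
  fun x hx => by
    rw [Finset.mem_symmDiff] at hx
    rcases hx with h | h
    · exact hA h.1
    · exact hB h.1

theorem numCompat_nonneg (I : Finset V) (ω : E → Bool) : 0 ≤ numCompat src tgt I ω :=
  Nat.cast_nonneg _

theorem numCompat_pos (I : Finset V) (ω : E → Bool) : 0 < numCompat src tgt I ω :=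
  Nat.cast_pos.2 (Finset.card_pos.2
    ⟨∅, mem_compatSets.2 ⟨Finset.empty_subset _, compat_empty ω⟩⟩)

theorem numCompat_anti (I : Finset V) {ω ω' : E → Bool} (h : ω ≤ ω') :
    numCompat src tgt I ω' ≤ numCompat src tgt I ω := by
  refine Nat.cast_le.2 (Finset.card_le_card fun A hA => ?_)
  rw [mem_compatSets] at *
  exact ⟨hA.1, hA.2.anti h⟩

/-- Compatible sets form vector spaces over the field with two elements under symmetric difference.
With `X` and `Y` the spaces of `(I, ω)` and `(I', ω')`, the sum `X + Y` lies in the space of `(I, ω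
⊓ ω')` and `X ∩ Y` in that of `(I', ω ⊔ ω')`. The claim is `|X| |Y| = |X + Y| |X ∩ Y|`, obtained by
counting the fibres of the sum map. -/
theorem numCompat_lattice {I I' : Finset V} (hI : I' ⊆ I) (ω ω' : E → Bool) :
    numCompat src tgt I ω * numCompat src tgt I' ω' ≤
      numCompat src tgt I (ω ⊓ ω') * numCompat src tgt I' (ω ⊔ ω') := by
  unfold numCompat
  rw [mul_comm ((compatSets src tgt I (ω ⊓ ω')).card : ℝ)]
  rw [← Nat.cast_mul, ← Nat.cast_mul, Nat.cast_le, ← Finset.card_product]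
  refine (Finset.card_le_mul_card_image (f := fun p : Finset V × Finset V => symmDiff p.1 p.2)
    _ (compatSets src tgt I' (ω ⊔ ω')).card ?_).trans (Nat.mul_le_mul_left _ ?_)
  · intro b hb
    obtain ⟨p, hp, rfl⟩ := Finset.mem_image.1 hb
    rw [Finset.mem_product, mem_compatSets, mem_compatSets] at hp
    refine Finset.card_le_card_of_injOn (fun q => symmDiff q.2 p.2) ?_ ?_
    · intro q hq
      rw [Finset.mem_coe, Finset.mem_filter, Finset.mem_product, mem_compatSets,
        mem_compatSets] at hq
      rw [Finset.mem_coe, mem_compatSets]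
      refine ⟨symmDiff_subset' hq.1.2.1 hp.2.1, fun e he => ?_⟩
      have h2 : symmDiff q.2 p.2 = symmDiff q.1 p.1 := by
        have := hq.2
        rw [← symmDiff_symmDiff_cancel_left q.1 q.2, this, symmDiff_assoc q.1, symmDiff_assoc p.1,
          symmDiff_self, Finset.bot_eq_empty]
        simp
      rw [Pi.sup_apply] at he
      rcases Bool.or_eq_true_iff.1 he with h | h
      · change Agree src tgt (symmDiff q.2 p.2) e
        rw [h2]; exact hq.1.1.2.symmDiff hp.1.2 e h
      · exact hq.1.2.2.symmDiff hp.2.2 e h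
    · intro q hq q' hq' h
      rw [Finset.mem_coe, Finset.mem_filter] at hq hq'
      have h2 : q.2 = q'.2 := symmDiff_left_injective p.2 h
      have h1 : q.1 = q'.1 := by
        have := hq.2.trans hq'.2.symm
        rw [h2] at this
        exact symmDiff_left_injective _ this
      exact Prod.ext h1 h2
  · refine Finset.card_le_card fun b hb => ?_
    obtain ⟨p, hp, rfl⟩ := Finset.mem_image.1 hb
    rw [Finset.mem_product, mem_compatSets, mem_compatSets] at hp
    exact mem_compatSets.2 ⟨symmDiff_subset' hp.1.1 (hp.2.1.trans hI),
      (hp.1.2.anti inf_le_left).symmDiff (hp.2.2.anti inf_le_right)⟩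

theorem Forced.mono {I : Finset V} {ω ω' : E → Bool} (h : ω ≤ ω') {x : V}
    (hx : Forced src tgt I ω x) : Forced src tgt I ω' x :=
  fun A hA hc => hx A hA (hc.anti h)

theorem Forced.anti {I I' : Finset V} (h : I' ⊆ I) {ω : E → Bool} {x : V}
    (hx : Forced src tgt I ω x) : Forced src tgt I' ω x :=
  fun A hA hc => hx A (hA.trans h) hc

theorem forced_of_notMem {I : Finset V} (ω : E → Bool) {x : V} (hx : x ∉ I) :
    Forced src tgt I ω x := fun _ hA _ hxA => hx (hA hxA)

theorem forced_iff_of_open {I : Finset V} {ω : E → Bool} {e : E} (he : ω e = true) :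
    Forced src tgt I ω (src e) ↔ Forced src tgt I ω (tgt e) :=
  forall₃_congr fun _ _ hc => not_congr (hc e he)

theorem forcedInd_monotone (I : Finset V) (x : V) : Monotone (forcedInd src tgt I x) := by
  intro ω ω' h
  unfold forcedInd
  split_ifs with h1 h2 h2
  · exact le_rfl
  · exact absurd (h1.mono h) h2
  · exact zero_le_one
  · exact le_rfl

theorem forcedInd_anti {I I' : Finset V} (h : I' ⊆ I) (x : V) (ω : E → Bool) :
    forcedInd src tgt I x ω ≤ forcedInd src tgt I' x ω := by
  unfold forcedInd
  split_ifs with h1 h2 h2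
  · exact le_rfl
  · exact absurd (h1.anti h) h2
  · exact zero_le_one
  · exact le_rfl

theorem forcedInd_mem (I : Finset V) (x : V) (ω : E → Bool) :
    forcedInd src tgt I x ω = 0 ∨ forcedInd src tgt I x ω = 1 := by
  unfold forcedInd; split_ifs <;> simp

theorem forcedInd_nonneg (I : Finset V) (x : V) (ω : E → Bool) :
    0 ≤ forcedInd src tgt I x ω := by
  unfold forcedInd; split_ifs <;> norm_num

theorem forcedInd_le_one (I : Finset V) (x : V) (ω : E → Bool) :
    forcedInd src tgt I x ω ≤ 1 := by
  unfold forcedInd; split_ifs <;> norm_num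

theorem spin_symmDiff (A B : Finset V) (v : V) : spin (symmDiff A B) v = spin A v * spin B v := by
  unfold spin
  by_cases hA : v ∈ A <;> by_cases hB : v ∈ B <;> simp [Finset.mem_symmDiff, hA, hB]

/-- The spin at `x` is a character of the group of compatible sets: either it is trivial, or
translation by a set containing `x` cancels the sum. -/
theorem sum_spin_compatSets (I : Finset V) (ω : E → Bool) (x : V) :
    ∑ A ∈ compatSets src tgt I ω, spin A x = numCompat src tgt I ω * forcedInd src tgt I x ω := by
  unfold forcedInd
  split_ifs with h
  · rw [mul_one, numCompat, Finset.cast_card]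
    refine Finset.sum_congr rfl fun A hA => ?_
    rw [mem_compatSets] at hA
    simp [spin, h A hA.1 hA.2]
  · rw [mul_zero]
    unfold Forced at h
    push Not at h
    obtain ⟨B, hB, hc, hx⟩ := h
    refine Finset.sum_involution (fun A _ => symmDiff A B) ?_ ?_ ?_ ?_
    · intro A _
      rw [spin_symmDiff]
      simp [spin, hx]
    · intro A _ _ hAB
      rw [symmDiff_eq_left] at hAB
      rw [hAB] at hx
      simp at hx
    · intro A hA
      rw [mem_compatSets] at *
      exact ⟨symmDiff_subset' hA.1 hB, hA.2.symmDiff hc⟩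
    · intro A _
      exact symmDiff_symmDiff_cancel_right B A

open scoped Classical in
/-- The two-layer edge weight obtained from local weights `w`. -/
def layerFactor (w : Bool → Bool → ℝ) (a b : Prop) : ℝ :=
  w false false + (if a then w true false else 0) + (if b then w false true else 0)
    + (if a ∧ b then w true true else 0)

/-- Product of local weights. -/
def localProd (w : Bool → Bool → ℝ) (ω₁ ω₂ : E → Bool) : ℝ := ∏ e, w (ω₁ e) (ω₂ e)

open scoped Classical in
theorem prod_compat_ite (ω : E → Bool) (A : Finset V) :
    ∏ e, (if ω e = true → Agree src tgt A e then (1 : ℝ) else 0) =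
      if Compat src tgt ω A then 1 else 0 := by
  by_cases h : Compat src tgt ω A
  · rw [if_pos h]
    exact Finset.prod_eq_one fun e _ => if_pos (h e)
  · rw [if_neg h]
    unfold Compat at h
    push Not at h
    obtain ⟨e, he, hA⟩ := h
    exact Finset.prod_eq_zero (Finset.mem_univ e) (if_neg fun hc => hA (hc he))

-- Expanding the product over edges chooses a state of each edge in both layers; an open edge
-- survives only if it joins equal spins.
open scoped Classical in
theorem prod_layerFactor (w : Bool → Bool → ℝ) (A B : Finset V) :
    ∏ e, layerFactor w (Agree src tgt A e) (Agree src tgt B e) =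
      ∑ ω₁ : E → Bool, ∑ ω₂ : E → Bool, localProd w ω₁ ω₂ *
        ((if Compat src tgt ω₁ A then 1 else 0) * (if Compat src tgt ω₂ B then 1 else 0)) := by
  have h : ∀ e, layerFactor w (Agree src tgt A e) (Agree src tgt B e) =
      ∑ i : Bool, ∑ j : Bool, w i j * ((if i = true → Agree src tgt A e then 1 else 0) *
        (if j = true → Agree src tgt B e then 1 else 0)) := fun e => by
    simp only [Fintype.sum_bool, layerFactor]
    by_cases h1 : Agree src tgt A e <;> by_cases h2 : Agree src tgt B e <;> simp [h1, h2] <;> ring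
  simp only [h]
  rw [Finset.prod_univ_sum, Fintype.piFinset_univ]
  refine Finset.sum_congr rfl fun ω₁ _ => ?_
  rw [Finset.prod_univ_sum, Fintype.piFinset_univ]
  refine Finset.sum_congr rfl fun ω₂ _ => ?_
  rw [Finset.prod_mul_distrib, Finset.prod_mul_distrib, prod_compat_ite, prod_compat_ite]
  rfl

/-- The Edwards–Sokal coupling for two layers. -/
theorem edwards_sokal (w : Bool → Bool → ℝ) (I : Finset V) (g₁ g₂ : Finset V → ℝ) :
    ∑ A ∈ I.powerset, ∑ B ∈ I.powerset, g₁ A * g₂ B *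
        ∏ e, layerFactor w (Agree src tgt A e) (Agree src tgt B e) =
      ∑ ω₁ : E → Bool, ∑ ω₂ : E → Bool, localProd w ω₁ ω₂ *
        ((∑ A ∈ compatSets src tgt I ω₁, g₁ A) * ∑ B ∈ compatSets src tgt I ω₂, g₂ B) := by
  classical
  simp only [prod_layerFactor, Finset.mul_sum]
  have e1 : ∀ A ∈ I.powerset, ∑ B ∈ I.powerset, ∑ ω₁ : E → Bool, ∑ ω₂ : E → Bool,
      g₁ A * g₂ B * (localProd w ω₁ ω₂ * ((if Compat src tgt ω₁ A then 1 else 0) *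
        (if Compat src tgt ω₂ B then 1 else 0))) =
      ∑ ω₁ : E → Bool, ∑ ω₂ : E → Bool, ∑ B ∈ I.powerset,
      g₁ A * g₂ B * (localProd w ω₁ ω₂ * ((if Compat src tgt ω₁ A then 1 else 0) *
        (if Compat src tgt ω₂ B then 1 else 0))) := fun A _ => by
    rw [Finset.sum_comm]
    exact Finset.sum_congr rfl fun _ _ => Finset.sum_comm
  rw [Finset.sum_congr rfl e1, Finset.sum_comm]
  refine Finset.sum_congr rfl fun ω₁ _ => ?_
  rw [Finset.sum_comm]
  refine Finset.sum_congr rfl fun ω₂ _ => ?_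
  simp only [← Finset.mul_sum]
  unfold compatSets
  rw [Finset.sum_filter, Finset.sum_filter, Finset.sum_mul_sum, Finset.mul_sum]
  refine Finset.sum_congr rfl fun A _ => ?_
  rw [Finset.mul_sum]
  refine Finset.sum_congr rfl fun B _ => ?_
  split_ifs <;> simp
  ring

/-- Holley's condition for local weights. -/
def LocalHolley (w w' : Bool → Bool → ℝ) : Prop :=
  ∀ i j i' j', w i j * w' i' j' ≤ w (i ⊓ i') (j ⊓ j') * w' (i ⊔ i') (j ⊔ j')

/-- Local weights giving rise to a monotonic two-layer random-cluster measure. -/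
structure IsLocalWeight (w : Bool → Bool → ℝ) : Prop where
  nonneg : ∀ i j, 0 ≤ w i j
  diag_pos : ∀ i, 0 < w i i
  holley : LocalHolley w w

variable (src tgt) in
/-- The first marginal of the two-layer random-cluster weight. -/
def fkWeight (w : Bool → Bool → ℝ) (I : Finset V) (ω : E → Bool) : ℝ :=
  ∑ ω₂ : E → Bool, localProd w ω ω₂ * (numCompat src tgt I ω * numCompat src tgt I ω₂)

theorem localProd_nonneg {w : Bool → Bool → ℝ} (hw : ∀ i j, 0 ≤ w i j) (ω₁ ω₂ : E → Bool) :
    0 ≤ localProd w ω₁ ω₂ := Finset.prod_nonneg fun _ _ => hw _ _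

theorem fkWeight_pos {w : Bool → Bool → ℝ} (hw : ∀ i j, 0 ≤ w i j) (hd : ∀ i, 0 < w i i)
    (I : Finset V) (ω : E → Bool) : 0 < fkWeight src tgt w I ω := by
  refine Finset.sum_pos' (fun ω₂ _ => mul_nonneg (localProd_nonneg hw _ _)
    (mul_nonneg (numCompat_nonneg _ _) (numCompat_nonneg _ _))) ⟨ω, Finset.mem_univ _, ?_⟩
  exact mul_pos (Finset.prod_pos fun e _ => hd _) (mul_pos (numCompat_pos _ _) (numCompat_pos _ _))

theorem localProd_holley {w w' : Bool → Bool → ℝ} (hw : ∀ i j, 0 ≤ w i j)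
    (hw' : ∀ i j, 0 ≤ w' i j) (h : LocalHolley w w') (a b c d : E → Bool) :
    localProd w a b * localProd w' c d ≤
      localProd w (a ⊓ c) (b ⊓ d) * localProd w' (a ⊔ c) (b ⊔ d) := by
  unfold localProd
  rw [← Finset.prod_mul_distrib, ← Finset.prod_mul_distrib]
  exact Finset.prod_le_prod (fun e _ => mul_nonneg (hw _ _) (hw' _ _)) fun e _ => h _ _ _ _

/-- The joint weight of both layers satisfies Holley's condition, and the four functions theorem,
applied to the sum over the second layer, passes it to the first marginal. -/
theorem fkWeight_holley {w w' : Bool → Bool → ℝ} (hw : ∀ i j, 0 ≤ w i j)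
    (hw' : ∀ i j, 0 ≤ w' i j) (h : LocalHolley w w') {I I' : Finset V} (hI : I' ⊆ I)
    (a b : E → Bool) :
    fkWeight src tgt w I a * fkWeight src tgt w' I' b ≤
      fkWeight src tgt w I (a ⊓ b) * fkWeight src tgt w' I' (a ⊔ b) := by
  unfold fkWeight
  have hnn : ∀ (w : Bool → Bool → ℝ) (_ : ∀ i j, 0 ≤ w i j) (I : Finset V) (a : E → Bool),
      0 ≤ fun ω₂ => localProd w a ω₂ * (numCompat src tgt I a * numCompat src tgt I ω₂) :=
    fun w hw I a ω₂ => mul_nonneg (localProd_nonneg hw _ _)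
      (mul_nonneg (numCompat_nonneg _ _) (numCompat_nonneg _ _))
  refine four_functions_theorem_univ _ _ _ _ (hnn w hw I a) (hnn w' hw' I' b)
    (hnn w hw I (a ⊓ b)) (hnn w' hw' I' (a ⊔ b)) fun c d => ?_
  have h1 := localProd_holley hw hw' h a c b d
  have h2 := numCompat_lattice (src := src) (tgt := tgt) hI a b
  have h3 := numCompat_lattice (src := src) (tgt := tgt) hI c d
  have h4 := mul_le_mul h2 h3 (mul_nonneg (numCompat_nonneg _ _) (numCompat_nonneg _ _))
    (mul_nonneg (numCompat_nonneg _ _) (numCompat_nonneg _ _))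
  have h5 := mul_le_mul h1 h4 (mul_nonneg (mul_nonneg (numCompat_nonneg _ _)
    (numCompat_nonneg _ _)) (mul_nonneg (numCompat_nonneg _ _) (numCompat_nonneg _ _)))
    (mul_nonneg (localProd_nonneg hw _ _) (localProd_nonneg hw' _ _))
  refine le_of_eq_of_le ?_ (h5.trans_eq ?_) <;> ring

theorem IsLocalWeight.isLatticeWeight {w : Bool → Bool → ℝ} (hw : IsLocalWeight w)
    (I : Finset V) : IsLatticeWeight (fkWeight src tgt w I) where
  pos := fkWeight_pos hw.nonneg hw.diag_pos I
  lattice := fkWeight_holley hw.nonneg hw.nonneg hw.holley (Finset.Subset.refl I)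

theorem mean_fkWeight_le {w w' : Bool → Bool → ℝ} (hw : ∀ i j, 0 ≤ w i j)
    (hd : ∀ i, 0 < w i i) (hw' : ∀ i j, 0 ≤ w' i j) (hd' : ∀ i, 0 < w' i i)
    (h : LocalHolley w w') {I I' : Finset V} (hI : I' ⊆ I) {f : (E → Bool) → ℝ}
    (hf : Monotone f) :
    mean (fkWeight src tgt w I) f ≤ mean (fkWeight src tgt w' I') f := by
  have p1 := fkWeight_pos (src := src) (tgt := tgt) hw hd I
  have p2 := fkWeight_pos (src := src) (tgt := tgt) hw' hd' I'
  unfold mean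
  rw [div_le_div_iff₀ (Finset.sum_pos (fun ω _ => p1 ω) Finset.univ_nonempty)
    (Finset.sum_pos (fun ω _ => p2 ω) Finset.univ_nonempty), mul_comm (∑ ω, _ * f ω) (∑ ω, _)]
  have := holley_compare (fun ω => (p1 ω).le) (fun ω => (p2 ω).le) hf
    (fkWeight_holley hw hw' h hI)
  linarith

theorem mean_forcedInd (w : Bool → Bool → ℝ) (I : Finset V) (x : V) :
    mean (fkWeight src tgt w I) (forcedInd src tgt I x) =
      (∑ A ∈ I.powerset, ∑ B ∈ I.powerset, spin A x *
        ∏ e, layerFactor w (Agree src tgt A e) (Agree src tgt B e)) /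
      ∑ A ∈ I.powerset, ∑ B ∈ I.powerset,
        ∏ e, layerFactor w (Agree src tgt A e) (Agree src tgt B e) := by
  have h1 := edwards_sokal (src := src) (tgt := tgt) w I (fun A => spin A x) (fun _ => 1)
  have h2 := edwards_sokal (src := src) (tgt := tgt) w I (fun _ => 1) (fun _ => 1)
  simp only [mul_one, one_mul, sum_spin_compatSets, Finset.sum_const, nsmul_eq_mul] at h1 h2
  rw [h1, h2]
  unfold mean fkWeight
  congr 1
  refine Finset.sum_congr rfl fun ω _ => ?_
  rw [Finset.sum_mul]
  refine Finset.sum_congr rfl fun ω₂ _ => ?_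
  unfold numCompat
  ring

/-- On the left `x` must be connected to the boundary in both layers, on the right only in the
first. -/
theorem sum_spin_mul_spin_le {w : Bool → Bool → ℝ} (hw : ∀ i j, 0 ≤ w i j) (I : Finset V) (x : V) :
    ∑ A ∈ I.powerset, ∑ B ∈ I.powerset, spin A x * spin B x *
        ∏ e, layerFactor w (Agree src tgt A e) (Agree src tgt B e) ≤
      ∑ A ∈ I.powerset, ∑ B ∈ I.powerset, spin A x *
        ∏ e, layerFactor w (Agree src tgt A e) (Agree src tgt B e) := by
  have h1 := edwards_sokal (src := src) (tgt := tgt) w I (fun A => spin A x) (fun B => spin B x)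
  have h2 := edwards_sokal (src := src) (tgt := tgt) w I (fun A => spin A x) (fun _ => 1)
  simp only [mul_one, sum_spin_compatSets, Finset.sum_const, nsmul_eq_mul] at h1 h2
  rw [h1, h2]
  refine Finset.sum_le_sum fun ω₁ _ => Finset.sum_le_sum fun ω₂ _ =>
    mul_le_mul_of_nonneg_left (mul_le_mul_of_nonneg_left ?_ ?_) (localProd_nonneg hw _ _)
  · exact mul_le_of_le_one_right (numCompat_nonneg _ _) (forcedInd_le_one _ _ _)
  · exact mul_nonneg (numCompat_nonneg _ _) (forcedInd_nonneg _ _ _)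

/-- Tilting the first layer of local weights. -/
def tilt (h : ℝ) (w : Bool → Bool → ℝ) (i j : Bool) : ℝ := (if i then Real.exp h else 1) * w i j

theorem tilt_zero (w : Bool → Bool → ℝ) : tilt 0 w = w := by
  funext i j; simp [tilt]

theorem IsLocalWeight.tilt {w : Bool → Bool → ℝ} (hw : IsLocalWeight w) (h : ℝ) :
    IsLocalWeight (tilt h w) where
  nonneg i j := by
    unfold AshkinTeller.tilt
    exact mul_nonneg (by split_ifs <;> positivity) (hw.nonneg i j)
  diag_pos i := by
    unfold AshkinTeller.tilt
    exact mul_pos (by split_ifs <;> positivity) (hw.diag_pos i)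
  holley i j i' j' := by
    have h1 := hw.holley i j i' j'
    unfold AshkinTeller.tilt
    have e1 : (if (i ⊓ i') = true then Real.exp h else 1) *
        (if (i ⊔ i') = true then Real.exp h else 1) =
        (if i = true then Real.exp h else 1) * (if i' = true then Real.exp h else 1) := by
      cases i <;> cases i' <;> simp
    have e2 : 0 ≤ (if i = true then Real.exp h else 1) * (if i' = true then Real.exp h else 1) :=
      mul_nonneg (by split_ifs <;> positivity) (by split_ifs <;> positivity)
    have := mul_le_mul_of_nonneg_left h1 e2
    refine le_of_eq_of_le ?_ (this.trans_eq ?_)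
    · ring
    · rw [← e1]; ring

theorem fkWeight_tilt (h : ℝ) (w : Bool → Bool → ℝ) (I : Finset V) (ω : E → Bool) :
    fkWeight src tgt (tilt h w) I ω = Real.exp (h * ∑ e, openInd e ω) * fkWeight src tgt w I ω := by
  unfold fkWeight
  rw [Finset.mul_sum]
  refine Finset.sum_congr rfl fun ω₂ _ => ?_
  have : localProd (tilt h w) ω ω₂ = Real.exp (h * ∑ e, openInd e ω) * localProd w ω ω₂ := by
    unfold localProd tilt
    rw [Finset.prod_mul_distrib, Finset.mul_sum, Real.exp_sum]
    congr 1
    refine Finset.prod_congr rfl fun e _ => ?_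
    unfold openInd
    split_ifs <;> simp
  rw [this]; ring

/-- Derivative of an expectation along the tilt. -/
theorem hasDerivAt_mean_tilt {w : Bool → Bool → ℝ} (hw : IsLocalWeight w) (I : Finset V)
    (f : (E → Bool) → ℝ) (h : ℝ) :
    HasDerivAt (fun h => mean (fkWeight src tgt (tilt h w) I) f)
      (∑ e, covEdge (fkWeight src tgt (tilt h w) I) f e) h := by
  have hd : ∀ ω : E → Bool, HasDerivAt (fun h => fkWeight src tgt (tilt h w) I ω)
      (fkWeight src tgt (tilt h w) I ω * ∑ e, openInd e ω) h := fun ω => by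
    simp only [fkWeight_tilt]
    have := (((hasDerivAt_id h).mul_const (∑ e, openInd e ω)).exp).mul_const
      (fkWeight src tgt w I ω)
    refine this.congr_deriv ?_
    simp only [id]
    ring
  have hZ : 0 < ∑ ω, fkWeight src tgt (tilt h w) I ω :=
    Finset.sum_pos (fun ω _ => fkWeight_pos (hw.tilt h).nonneg (hw.tilt h).diag_pos I ω)
      Finset.univ_nonempty
  have hn := HasDerivAt.fun_sum (u := Finset.univ) fun ω _ => (hd ω).mul_const (f ω)
  have hz := HasDerivAt.fun_sum (u := Finset.univ) fun ω _ => hd ω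
  have := hn.fun_div hz hZ.ne'
  unfold mean
  refine this.congr_deriv ?_
  unfold covEdge
  rw [Finset.sum_sub_distrib, ← mean_sum, ← Finset.mul_sum, ← mean_sum]
  unfold mean
  have e1 : ∑ ω, fkWeight src tgt (tilt h w) I ω * ∑ e, f ω * openInd e ω =
      ∑ ω, fkWeight src tgt (tilt h w) I ω * (∑ e, openInd e ω) * f ω :=
    Finset.sum_congr rfl fun ω _ => by rw [← Finset.mul_sum]; ring
  rw [e1]
  field_simp

/-! ### Finite energy and the first step of a path expansion for connections. -/

section HighTemperature

theorem sum_bool_split (e : E) (T : (E → Bool) → ℝ) :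
    ∑ ω, T ω = ∑ ω, if ω e = false then T ω + T (Function.update ω e true) else 0 := by
  rw [← Finset.sum_filter, Finset.sum_add_distrib,
    ← Finset.sum_filter_add_sum_filter_not Finset.univ (fun ω : E → Bool => ω e = false)]
  congr 1
  refine Finset.sum_bij' (fun ω _ => Function.update ω e false)
    (fun ω _ => Function.update ω e true) ?_ ?_ ?_ ?_ ?_
  · intro ω _; simp
  · intro ω _; simp
  · intro ω hω
    simp only [Finset.mem_filter, Finset.mem_univ, true_and, Bool.not_eq_false] at hω
    simp [← hω]
  · intro ω hω
    simp only [Finset.mem_filter, Finset.mem_univ, true_and] at hω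
    simp [← hω]
  · intro ω hω
    simp only [Finset.mem_filter, Finset.mem_univ, true_and, Bool.not_eq_false] at hω
    simp [← hω]

theorem localProd_update (w : Bool → Bool → ℝ) (e : E) (ω₁ ω₂ : E → Bool) (i j : Bool) :
    localProd w (Function.update ω₁ e i) (Function.update ω₂ e j) =
      w i j * ∏ e' ∈ Finset.univ.erase e, w (ω₁ e') (ω₂ e') := by
  unfold localProd
  rw [← Finset.mul_prod_erase Finset.univ _ (Finset.mem_univ e)]
  simp only [Function.update_self]
  congr 1
  refine Finset.prod_congr rfl fun e' he' => ?_
  rw [Function.update_of_ne (Finset.ne_of_mem_erase he'),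
    Function.update_of_ne (Finset.ne_of_mem_erase he')]

/-- Opening an edge multiplies the weight by a bounded factor. -/
theorem fkWeight_update_le {w : Bool → Bool → ℝ} (hw : IsLocalWeight w) (I : Finset V) (e : E)
    (ω : E → Bool) :
    w false false * fkWeight src tgt w I (Function.update ω e true) ≤
      (w true false + w true true) * fkWeight src tgt w I (Function.update ω e false) := by
  unfold fkWeight
  rw [sum_bool_split e, sum_bool_split e (fun ω₂ => localProd w (Function.update ω e false) ω₂ * _),
    Finset.mul_sum, Finset.mul_sum]
  refine Finset.sum_le_sum fun ω₂ _ => ?_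
  split_ifs with h
  · have h2 : Function.update ω₂ e false = ω₂ := by rw [← h]; simp
    have e1 := localProd_update w e ω ω₂ true false
    have e2 := localProd_update w e ω ω₂ true true
    have e3 := localProd_update w e ω ω₂ false false
    have e4 := localProd_update w e ω ω₂ false true
    rw [h2] at e1 e3
    rw [e1, e2, e3, e4]
    have hP : 0 ≤ ∏ e' ∈ Finset.univ.erase e, w (ω e') (ω₂ e') :=
      Finset.prod_nonneg fun _ _ => hw.nonneg _ _
    generalize ∏ e' ∈ Finset.univ.erase e, w (ω e') (ω₂ e') = P at *
    have l1 : numCompat src tgt I (Function.update ω e true) ≤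
        numCompat src tgt I (Function.update ω e false) :=
      numCompat_anti I (update_le_update_iff.2 ⟨Bool.false_le _, fun _ _ => le_rfl⟩)
    have l2 : numCompat src tgt I (Function.update ω₂ e true) ≤ numCompat src tgt I ω₂ :=
      numCompat_anti I (by
        conv_lhs => rw [← h2]
        exact update_le_update_iff.2 ⟨Bool.false_le _, fun _ _ => le_rfl⟩)
    have n1 := numCompat_nonneg (src := src) (tgt := tgt) I (Function.update ω e true)
    have n2 := numCompat_nonneg (src := src) (tgt := tgt) I (Function.update ω₂ e true)
    have n3 := numCompat_nonneg (src := src) (tgt := tgt) I (Function.update ω e false)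
    have n4 := numCompat_nonneg (src := src) (tgt := tgt) I ω₂
    generalize numCompat src tgt I (Function.update ω e true) = a at *
    generalize numCompat src tgt I (Function.update ω₂ e true) = b at *
    generalize numCompat src tgt I (Function.update ω e false) = c at *
    generalize numCompat src tgt I ω₂ = d at *
    have m1 : a * d ≤ c * d := mul_le_mul_of_nonneg_right l1 n4
    have m2 : a * b ≤ c * d := mul_le_mul l1 l2 n2 n3
    have w0 := hw.nonneg false false
    have w1 := hw.nonneg true false
    have w2 := hw.nonneg true true
    have w3 := hw.nonneg false true
    calc w false false * (w true false * P * (a * d) + w true true * P * (a * b))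
        ≤ w false false * (w true false * P * (c * d) + w true true * P * (c * d)) := by
          gcongr
      _ = (w true false + w true true) * (w false false * P * (c * d)) := by ring
      _ ≤ _ := by
          gcongr
          exact le_add_of_nonneg_right (by positivity)
  · simp

/-- As `G` ignores the state of `e`, configurations can be paired by that state and compared with
`fkWeight_update_le`. -/
theorem mean_openInd_mul_le {w : Bool → Bool → ℝ} (hw : IsLocalWeight w) (I : Finset V) (e : E)
    {G : (E → Bool) → ℝ} (hG0 : ∀ ω, 0 ≤ G ω)
    (hG : ∀ ω b, G (Function.update ω e b) = G ω) :
    mean (fkWeight src tgt w I) (fun ω => openInd e ω * G ω) ≤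
      (w true false + w true true) / w false false * mean (fkWeight src tgt w I) G := by
  have hZ : 0 < ∑ ω, fkWeight src tgt w I ω :=
    Finset.sum_pos (fun ω _ => fkWeight_pos hw.nonneg hw.diag_pos I ω) Finset.univ_nonempty
  unfold mean
  rw [← mul_div_assoc]
  refine div_le_div_of_nonneg_right ?_ hZ.le
  rw [sum_bool_split e, sum_bool_split e (fun ω => _ * G ω), Finset.mul_sum]
  refine Finset.sum_le_sum fun ω _ => ?_
  split_ifs with h
  · have h2 : Function.update ω e false = ω := by rw [← h]; simp
    have h3 := fkWeight_update_le (src := src) (tgt := tgt) hw I e ω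
    rw [h2] at h3
    have h0 := hw.diag_pos false
    have h4 : fkWeight src tgt w I (Function.update ω e true) ≤
        (w true false + w true true) / w false false * fkWeight src tgt w I ω := by
      rw [div_mul_eq_mul_div, le_div_iff₀ h0]; linarith
    have p1 := (fkWeight_pos (src := src) (tgt := tgt) hw.nonneg hw.diag_pos I
      (Function.update ω e true)).le
    have hq : 0 ≤ (w true false + w true true) / w false false :=
      div_nonneg (add_nonneg (hw.nonneg _ _) (hw.nonneg _ _)) h0.le
    simp only [hG, openInd, h, Function.update_self, if_true, Bool.false_eq_true, if_false, zero_mul,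
      mul_zero, zero_add, one_mul]
    have := mul_le_mul_of_nonneg_right h4 (hG0 ω)
    have := mul_nonneg hq (mul_nonneg p1 (hG0 ω))
    nlinarith
  · simp

variable (src tgt) in
open scoped Classical in
/-- The configuration obtained by closing all edges at `x`. -/
def closeAt (x : V) (ω : E → Bool) (e : E) : Bool :=
  if src e = x ∨ tgt e = x then false else ω e

theorem closeAt_le (x : V) (ω : E → Bool) : closeAt src tgt x ω ≤ ω := fun e => by
  unfold closeAt; split_ifs
  · exact Bool.false_le _
  · exact le_rfl

variable (src tgt) in
/-- The endpoint of `e` opposite to `x`. -/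
def otherEnd (x : V) (e : E) : V := if src e = x then tgt e else src e

/-- Close all edges at `x` and let `N` be the set of sites no longer connected to the boundary. If
every open edge at `x` led into `N`, then `N` would be compatible with `ω` and contain `x`, contrary
to `Forced`. -/
theorem forced_exists_open {I : Finset V} {x : V} (hx : x ∈ I) {ω : E → Bool}
    (h : Forced src tgt I ω x) :
    ∃ e, (src e = x ∨ tgt e = x) ∧ ω e = true ∧
      Forced src tgt I (closeAt src tgt x ω) (otherEnd src tgt x e) := by
  classical
  by_contra hcon
  push Not at hcon
  set ω' := closeAt src tgt x ω with hω'
  have hN : ∀ v, v ∈ I.filter (fun v => ¬ Forced src tgt I ω' v) ↔ ¬ Forced src tgt I ω' v :=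
    fun v => by
      rw [Finset.mem_filter, and_iff_right_iff_imp]
      intro h1
      by_contra h2
      exact h1 (forced_of_notMem _ h2)
  have hxN : ¬ Forced src tgt I ω' x := fun hF => by
    refine hF {x} (by simpa using hx) (fun e he => ?_) (by simp)
    rw [hω', closeAt] at he
    split_ifs at he with h1
    rw [not_or] at h1
    simp [Agree, h1.1, h1.2]
  refine h (I.filter fun v => ¬ Forced src tgt I ω' v) (Finset.filter_subset _ _)
    (fun e he => ?_) ((hN x).2 hxN)
  unfold Agree
  rw [hN, hN]
  by_cases h1 : src e = x ∨ tgt e = x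
  · have h2 := hcon e h1 he
    unfold otherEnd at h2
    split_ifs at h2 with h3
    · rw [h3]; exact iff_of_true hxN h2
    · rw [h1.resolve_left h3]; exact iff_of_true h2 hxN
  · have h2 : ω' e = true := by rw [hω', closeAt, if_neg h1]; exact he
    exact not_congr (forced_iff_of_open h2)

-- A connection from `x` uses an open edge `e` at `x` and then a connection avoiding all edges at
-- `x`. The second event does not depend on `e`, so finite energy factors out the opening of `e`.
open scoped Classical in
theorem mean_forcedInd_le_sum {w : Bool → Bool → ℝ} (hw : IsLocalWeight w) {I : Finset V} {x : V}
    (hx : x ∈ I) :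
    mean (fkWeight src tgt w I) (forcedInd src tgt I x) ≤
      (w true false + w true true) / w false false *
        ∑ e ∈ Finset.univ.filter (fun e => src e = x ∨ tgt e = x),
          mean (fkWeight src tgt w I) (forcedInd src tgt I (otherEnd src tgt x e)) := by
  have hpos := fun ω => (fkWeight_pos (src := src) (tgt := tgt) hw.nonneg hw.diag_pos I ω).le
  have hq : 0 ≤ (w true false + w true true) / w false false :=
    div_nonneg (add_nonneg (hw.nonneg _ _) (hw.nonneg _ _)) (hw.nonneg _ _)
  calc mean (fkWeight src tgt w I) (forcedInd src tgt I x)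
      ≤ mean (fkWeight src tgt w I)
          (fun ω => ∑ e ∈ Finset.univ.filter (fun e => src e = x ∨ tgt e = x),
            openInd e ω * forcedInd src tgt I (otherEnd src tgt x e) (closeAt src tgt x ω)) := by
        refine mean_mono hpos fun ω => ?_
        have hnn : ∀ e ∈ Finset.univ.filter (fun e => src e = x ∨ tgt e = x), 0 ≤ openInd e ω *
            forcedInd src tgt I (otherEnd src tgt x e) (closeAt src tgt x ω) := fun e _ =>
          mul_nonneg (by unfold openInd; split_ifs <;> norm_num) (forcedInd_nonneg _ _ _)
        by_cases h : Forced src tgt I ω x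
        · obtain ⟨e, he, ho, hF⟩ := forced_exists_open hx h
          refine le_trans ?_ (Finset.single_le_sum hnn
            (Finset.mem_filter.2 ⟨Finset.mem_univ e, he⟩))
          simp [forcedInd, h, hF, openInd, ho]
        · unfold forcedInd at *
          rw [if_neg h]
          exact Finset.sum_nonneg hnn
    _ ≤ _ := by
        rw [mean_sum, Finset.mul_sum]
        refine Finset.sum_le_sum fun e he => ?_
        refine (mean_openInd_mul_le hw I e (G := fun ω => forcedInd src tgt I
          (otherEnd src tgt x e) (closeAt src tgt x ω)) (fun ω => forcedInd_nonneg _ _ _)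
          (fun ω b => ?_)).trans (mul_le_mul_of_nonneg_left (mean_mono hpos fun ω =>
            forcedInd_monotone _ _ (closeAt_le x ω)) hq)
        have : closeAt src tgt x (Function.update ω e b) = closeAt src tgt x ω := by
          funext e'
          unfold closeAt
          split_ifs with h1
          · rfl
          · rw [Function.update_of_ne]
            rintro rfl
            exact h1 (Finset.mem_filter.1 he).2
        simp only [this]

end HighTemperature

end RandomCluster

/-! ### Griffiths inequalities for characters of a group of symmetric differences. -/

section Griffiths

variable {α : Type*} [GeneralizedBooleanAlgebra α]

/-- Real characters for the symmetric difference. -/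
structure IsChar (χ : α → ℝ) : Prop where
  map_symmDiff : ∀ a b, χ (symmDiff a b) = χ a * χ b
  sq_eq_one : ∀ a, χ a * χ a = 1

/-- Nonnegative combinations of characters. -/
inductive PosFun : (α → ℝ) → Prop
  | smul (c : ℝ) (hc : 0 ≤ c) (χ : α → ℝ) (hχ : IsChar χ) : PosFun fun a => c * χ a
  | add (f g : α → ℝ) (hf : PosFun f) (hg : PosFun g) : PosFun fun a => f a + g a

theorem IsChar.one : IsChar (fun _ : α => (1 : ℝ)) := ⟨by simp, by simp⟩

theorem IsChar.mul {χ ψ : α → ℝ} (hχ : IsChar χ) (hψ : IsChar ψ) : IsChar fun a => χ a * ψ a where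
  map_symmDiff a b := by rw [hχ.map_symmDiff, hψ.map_symmDiff]; ring
  sq_eq_one a := by rw [mul_mul_mul_comm, hχ.sq_eq_one, hψ.sq_eq_one, one_mul]

theorem IsChar.eq_or {χ : α → ℝ} (hχ : IsChar χ) (a : α) : χ a = 1 ∨ χ a = -1 :=
  mul_self_eq_one_iff.1 (hχ.sq_eq_one a)

theorem PosFun.const {c : ℝ} (hc : 0 ≤ c) : PosFun fun _ : α => c := by
  simpa using PosFun.smul c hc (fun _ : α => (1 : ℝ)) IsChar.one

theorem IsChar.posFun {χ : α → ℝ} (hχ : IsChar χ) : PosFun χ := by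
  simpa using PosFun.smul 1 zero_le_one χ hχ

theorem PosFun.mul {f g : α → ℝ} (hf : PosFun f) (hg : PosFun g) : PosFun fun a => f a * g a := by
  induction hf with
  | smul c hc χ hχ =>
    induction hg with
    | smul d hd ψ hψ =>
      have := PosFun.smul (c * d) (mul_nonneg hc hd) _ (hχ.mul hψ)
      convert this using 2; ring
    | add f g _ _ h1 h2 =>
      have := PosFun.add _ _ h1 h2
      convert this using 2; ring
  | add f g _ _ h1 h2 =>
    have := PosFun.add _ _ h1 h2
    convert this using 2; ring

theorem PosFun.prod {ι : Type*} (s : Finset ι) {f : ι → α → ℝ} (hf : ∀ i ∈ s, PosFun (f i)) :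
    PosFun fun a => ∏ i ∈ s, f i a := by
  classical
  induction s using Finset.induction_on with
  | empty => simpa using PosFun.const (α := α) zero_le_one
  | insert i s hi ih =>
    simp only [Finset.prod_insert hi]
    exact (hf i (Finset.mem_insert_self _ _)).mul
      (ih fun j hj => hf j (Finset.mem_insert_of_mem hj))

/-- A character takes only the values `±1`, so `exp (c χ) = cosh c + χ sinh c`. -/
theorem IsChar.exp_posFun {χ : α → ℝ} (hχ : IsChar χ) {c : ℝ} (hc : 0 ≤ c) :
    PosFun fun a => Real.exp (c * χ a) := by
  have h : (fun a => Real.exp (c * χ a)) = fun a => Real.cosh c + Real.sinh c * χ a := by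
    funext a
    rcases hχ.eq_or a with h | h <;> rw [h]
    · rw [mul_one, mul_one, Real.cosh_add_sinh]
    · rw [mul_neg, mul_one, mul_neg, mul_one, ← sub_eq_add_neg, Real.cosh_sub_sinh]
  rw [h]
  exact PosFun.add _ _ (PosFun.const (Real.cosh_pos c).le)
    (PosFun.smul _ (Real.sinh_nonneg_iff.2 hc) χ hχ)

theorem exp_sum_posFun {ι : Type*} (T : Finset ι) {c : ι → ℝ} {χ : ι → α → ℝ}
    (hc : ∀ i ∈ T, 0 ≤ c i) (hχ : ∀ i ∈ T, IsChar (χ i)) :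
    PosFun fun a => Real.exp (∑ i ∈ T, c i * χ i a) := by
  simp only [Real.exp_sum]
  exact PosFun.prod T fun i hi => (hχ i hi).exp_posFun (hc i hi)

theorem sum_symmDiff_right {S : Finset α} (hS : ∀ a ∈ S, ∀ b ∈ S, symmDiff a b ∈ S) (f : α → ℝ)
    {b : α} (hb : b ∈ S) : ∑ a ∈ S, f (symmDiff a b) = ∑ a ∈ S, f a :=
  Finset.sum_bij' (fun a _ => symmDiff a b) (fun a _ => symmDiff a b)
    (fun a ha => hS a ha b hb) (fun a ha => hS a ha b hb)
    (fun a _ => symmDiff_symmDiff_cancel_right b a)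
    (fun a _ => symmDiff_symmDiff_cancel_right b a) (fun _ _ => rfl)

theorem sum_symmDiff_left {S : Finset α} (hS : ∀ a ∈ S, ∀ b ∈ S, symmDiff a b ∈ S) (f : α → ℝ)
    {b : α} (hb : b ∈ S) : ∑ a ∈ S, f (symmDiff b a) = ∑ a ∈ S, f a := by
  rw [← sum_symmDiff_right hS f hb]
  simp only [symmDiff_comm]

/-- The first Griffiths inequality. -/
theorem PosFun.sum_nonneg {S : Finset α} (hS : ∀ a ∈ S, ∀ b ∈ S, symmDiff a b ∈ S) {f : α → ℝ}
    (hf : PosFun f) : 0 ≤ ∑ a ∈ S, f a := by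
  induction hf with
  | smul c hc χ hχ =>
    rw [← Finset.mul_sum]
    refine mul_nonneg hc ?_
    by_cases h : ∃ b ∈ S, χ b = -1
    · obtain ⟨b, hb, h1⟩ := h
      have := sum_symmDiff_right hS χ hb
      simp only [hχ.map_symmDiff, h1, mul_neg, mul_one, Finset.sum_neg_distrib] at this
      linarith
    · push Not at h
      refine Finset.sum_nonneg fun a ha => ?_
      rw [(hχ.eq_or a).resolve_right (h a ha)]
      exact zero_le_one
  | add f g _ _ h1 h2 => rw [Finset.sum_add_distrib]; exact add_nonneg h1 h2

/-- The second Griffiths inequality, by Ginibre's duplication argument. -/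
theorem griffiths_second {S : Finset α} (hS : ∀ a ∈ S, ∀ b ∈ S, symmDiff a b ∈ S) {ι : Type*}
    (T : Finset ι) {c : ι → ℝ} {χ : ι → α → ℝ} (hc : ∀ i ∈ T, 0 ≤ c i)
    (hχ : ∀ i ∈ T, IsChar (χ i)) {f g : α → ℝ} (hf : PosFun f) (hg : PosFun g) :
    (∑ a ∈ S, f a * Real.exp (∑ i ∈ T, c i * χ i a)) *
        ∑ a ∈ S, g a * Real.exp (∑ i ∈ T, c i * χ i a) ≤
      (∑ a ∈ S, Real.exp (∑ i ∈ T, c i * χ i a)) *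
        ∑ a ∈ S, f a * g a * Real.exp (∑ i ∈ T, c i * χ i a) := by
  induction hg with
  | smul d hd ψ hψ =>
    set ρ : α → ℝ := fun a => Real.exp (∑ i ∈ T, c i * χ i a) with hρ
    -- Writing the second copy as `symmDiff a b`, the two weights merge into one with couplings `c i
    -- * (1 + χ i b)`. These are nonnegative, so for each fixed `b` the first inequality applies to
    -- the sum over `a`.
    have hdup : ∀ b, (fun a => ρ a * ρ (symmDiff a b)) =
        fun a => Real.exp (∑ i ∈ T, (c i * (1 + χ i b)) * χ i a) := fun b => by
      funext a
      rw [hρ]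
      simp only
      rw [← Real.exp_add, ← Finset.sum_add_distrib]
      congr 1
      refine Finset.sum_congr rfl fun i hi => ?_
      rw [(hχ i hi).map_symmDiff]; ring
    have hpos : 0 ≤ ∑ b ∈ S, (1 - ψ b) * ∑ a ∈ S, f a * ψ a * (ρ a * ρ (symmDiff a b)) := by
      refine Finset.sum_nonneg fun b _ => mul_nonneg ?_ (PosFun.sum_nonneg hS ?_)
      · rcases hψ.eq_or b with h | h <;> rw [h] <;> norm_num
      · refine (hf.mul hψ.posFun).mul ?_
        rw [hdup b]
        refine exp_sum_posFun T (fun i hi => mul_nonneg (hc i hi) ?_) hχ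
        rcases (hχ i hi).eq_or b with h | h <;> rw [h] <;> norm_num
    have e1 : ∑ b ∈ S, (1 - ψ b) * ∑ a ∈ S, f a * ψ a * (ρ a * ρ (symmDiff a b)) =
        (∑ a ∈ S, ρ a) * (∑ a ∈ S, f a * ψ a * ρ a) -
          (∑ a ∈ S, f a * ρ a) * ∑ a ∈ S, ψ a * ρ a := by
      have r : (∑ a ∈ S, ρ a) * (∑ a ∈ S, f a * ψ a * ρ a) -
          (∑ a ∈ S, f a * ρ a) * ∑ a ∈ S, ψ a * ρ a =
          ∑ a ∈ S, ∑ b ∈ S, (ρ b * (f a * ψ a * ρ a) - f a * ρ a * (ψ b * ρ b)) := by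
        rw [mul_comm (∑ a ∈ S, ρ a), Finset.sum_mul_sum, Finset.sum_mul_sum,
          ← Finset.sum_sub_distrib]
        refine Finset.sum_congr rfl fun a _ => ?_
        rw [← Finset.sum_sub_distrib]
        exact Finset.sum_congr rfl fun b _ => by ring
      rw [r]
      simp only [Finset.mul_sum]
      rw [Finset.sum_comm]
      refine Finset.sum_congr rfl fun a ha => ?_
      rw [← sum_symmDiff_left hS (fun i => ρ i * (f a * ψ a * ρ a) - f a * ρ a * (ψ i * ρ i)) ha]
      refine Finset.sum_congr rfl fun b _ => ?_
      rw [hψ.map_symmDiff]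
      ring
    rw [e1] at hpos
    have e2 : ∑ a ∈ S, d * ψ a * ρ a = d * ∑ a ∈ S, ψ a * ρ a := by
      rw [Finset.mul_sum]; exact Finset.sum_congr rfl fun _ _ => by ring
    have e3 : ∑ a ∈ S, f a * (d * ψ a) * ρ a = d * ∑ a ∈ S, f a * ψ a * ρ a := by
      rw [Finset.mul_sum]; exact Finset.sum_congr rfl fun _ _ => by ring
    change (∑ a ∈ S, f a * ρ a) * ∑ a ∈ S, d * ψ a * ρ a ≤
      (∑ a ∈ S, ρ a) * ∑ a ∈ S, f a * (d * ψ a) * ρ a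
    rw [e2, e3]
    nlinarith [mul_nonneg hd hpos]
  | add g h _ _ h1 h2 =>
    simp only [add_mul, mul_add, Finset.sum_add_distrib]
    linarith

end Griffiths

/-! ### The two-layer spin model on the square lattice, parametrised by sets of minus spins. -/

section Lattice

/-- Edges of the square lattice: a vertex and a direction. -/
abbrev Edge : Type := Site × Bool

/-- The unit vector of a direction. -/
def dirVec (d : Bool) : Site := if d then (0, 1) else (1, 0)

/-- The first endpoint of an edge. -/
def esrc (e : Edge) : Site := e.1

/-- The second endpoint of an edge. -/
def etgt (e : Edge) : Site := e.1 + dirVec e.2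

/-- The edges with an endpoint in `I`. -/
def touch (I : Finset Site) : Finset Edge :=
  (I ×ˢ Finset.univ) ∪ (I ×ˢ Finset.univ).image fun p => (p.1 - dirVec p.2, p.2)

theorem mem_touch {I : Finset Site} {e : Edge} : e ∈ touch I ↔ esrc e ∈ I ∨ etgt e ∈ I := by
  unfold touch esrc etgt
  rw [Finset.mem_union, Finset.mem_image]
  refine or_congr (by simp) ⟨?_, fun h => ⟨(e.1 + dirVec e.2, e.2), by simpa using h, by simp⟩⟩
  rintro ⟨p, hp, rfl⟩
  simpa using hp

theorem touch_mono {I I' : Finset Site} (h : I ⊆ I') : touch I ⊆ touch I' := fun e he => by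
  rw [mem_touch] at *
  exact he.imp (fun h1 => h h1) fun h1 => h h1

/-- Coupling constants of the two-layer model. -/
structure Coupling where
  /-- First layer. -/
  k₁ : ℝ
  /-- Second layer. -/
  k₂ : ℝ
  /-- Interaction of the layers. -/
  k₃ : ℝ

/-- All couplings are nonnegative. -/
def Coupling.Nonneg (K : Coupling) : Prop := 0 ≤ K.k₁ ∧ 0 ≤ K.k₂ ∧ 0 ≤ K.k₃

/-- Multiplication of the couplings by an inverse temperature. -/
def Coupling.scale (b : ℝ) (K : Coupling) : Coupling := ⟨b * K.k₁, b * K.k₂, b * K.k₃⟩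

theorem Coupling.Nonneg.scale {K : Coupling} (hK : K.Nonneg) {b : ℝ} (hb : 0 ≤ b) :
    (K.scale b).Nonneg :=
  ⟨mul_nonneg hb hK.1, mul_nonneg hb hK.2.1, mul_nonneg hb hK.2.2⟩

/-- Pairs of minus sets. -/
abbrev Minus : Type := Finset Site × Finset Site

/-- The product of the spins of `A` at the endpoints of `e`. -/
def bond (A : Finset Site) (e : Edge) : ℝ := spin A (esrc e) * spin A (etgt e)

/-- The exponent contributed by an edge. -/
def energy (K : Coupling) (A : Minus) (e : Edge) : ℝ :=
  K.k₁ * bond A.1 e + K.k₂ * bond A.2 e + K.k₃ * (bond A.1 e * bond A.2 e)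

/-- The Boltzmann weight. -/
def boltz (K : Coupling) (T : Finset Edge) (A : Minus) : ℝ := Real.exp (∑ e ∈ T, energy K A e)

/-- Pairs of minus sets contained in `I`. -/
def minusIn (I : Finset Site) : Finset Minus := I.powerset ×ˢ I.powerset

/-- Expectation in the volume `I` with plus boundary conditions and edge set `T`. -/
def gibbs (K : Coupling) (T : Finset Edge) (I : Finset Site) (f : Minus → ℝ) : ℝ :=
  (∑ A ∈ minusIn I, f A * boltz K T A) / ∑ A ∈ minusIn I, boltz K T A

/-- Expectation in the volume `I` with plus boundary conditions. -/
def state (K : Coupling) (I : Finset Site) (f : Minus → ℝ) : ℝ := gibbs K (touch I) I f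

theorem mem_minusIn {I : Finset Site} {A : Minus} : A ∈ minusIn I ↔ A.1 ⊆ I ∧ A.2 ⊆ I := by
  simp [minusIn]

theorem minusIn_mono {I I' : Finset Site} (h : I ⊆ I') : minusIn I ⊆ minusIn I' := fun A hA => by
  rw [mem_minusIn] at *
  exact ⟨hA.1.trans h, hA.2.trans h⟩

theorem boltz_pos (K : Coupling) (T : Finset Edge) (A : Minus) : 0 < boltz K T A := Real.exp_pos _

theorem sum_boltz_pos (K : Coupling) (T : Finset Edge) (I : Finset Site) :
    0 < ∑ A ∈ minusIn I, boltz K T A :=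
  Finset.sum_pos (fun A _ => boltz_pos K T A) ⟨(∅, ∅), mem_minusIn.2 (by simp)⟩

theorem minusIn_symmDiff (I : Finset Site) :
    ∀ A ∈ minusIn I, ∀ B ∈ minusIn I, symmDiff A B ∈ minusIn I := fun A hA B hB => by
  rw [mem_minusIn] at *
  exact ⟨symmDiff_subset' hA.1 hB.1, symmDiff_subset' hA.2 hB.2⟩

theorem spin_sq (A : Finset Site) (v : Site) : spin A v * spin A v = 1 := by
  unfold spin; split_ifs <;> norm_num

theorem isChar_spin_fst (v : Site) : IsChar fun A : Minus => spin A.1 v :=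
  ⟨fun A B => spin_symmDiff A.1 B.1 v, fun A => spin_sq A.1 v⟩

theorem isChar_spin_snd (v : Site) : IsChar fun A : Minus => spin A.2 v :=
  ⟨fun A B => spin_symmDiff A.2 B.2 v, fun A => spin_sq A.2 v⟩

theorem isChar_bond_fst (e : Edge) : IsChar fun A : Minus => bond A.1 e :=
  (isChar_spin_fst _).mul (isChar_spin_fst _)

theorem isChar_bond_snd (e : Edge) : IsChar fun A : Minus => bond A.2 e :=
  (isChar_spin_snd _).mul (isChar_spin_snd _)

/-- The coupling constant attached to a type of interaction. -/
def Coupling.coef (K : Coupling) : Fin 3 → ℝ := ![K.k₁, K.k₂, K.k₃]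

/-- The character attached to a type of interaction and an edge. -/
def bondChar (i : Fin 3) (e : Edge) (A : Minus) : ℝ :=
  ![bond A.1 e, bond A.2 e, bond A.1 e * bond A.2 e] i

theorem isChar_bondChar (i : Fin 3) (e : Edge) : IsChar (bondChar i e) := by
  fin_cases i
  · exact isChar_bond_fst e
  · exact isChar_bond_snd e
  · exact (isChar_bond_fst e).mul (isChar_bond_snd e)

theorem Coupling.Nonneg.coef {K : Coupling} (hK : K.Nonneg) (i : Fin 3) : 0 ≤ K.coef i := by
  fin_cases i
  · exact hK.1
  · exact hK.2.1
  · exact hK.2.2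

theorem boltz_eq (K : Coupling) (T : Finset Edge) (A : Minus) :
    boltz K T A = Real.exp (∑ p ∈ T ×ˢ Finset.univ, K.coef p.2 * bondChar p.2 p.1 A) := by
  unfold boltz
  rw [Finset.sum_product]
  congr 1
  refine Finset.sum_congr rfl fun e _ => ?_
  rw [Fin.sum_univ_three]
  rfl

theorem boltz_posFun {K : Coupling} (hK : K.Nonneg) (T : Finset Edge) : PosFun (boltz K T) := by
  rw [funext (boltz_eq K T)]
  exact exp_sum_posFun _ (fun p _ => hK.coef p.2) fun p _ => isChar_bondChar p.2 p.1

theorem gibbs_mul_le {K : Coupling} (hK : K.Nonneg) (T : Finset Edge) (I : Finset Site)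
    {f g : Minus → ℝ} (hf : PosFun f) (hg : PosFun g) :
    gibbs K T I f * gibbs K T I g ≤ gibbs K T I fun A => f A * g A := by
  have hZ := sum_boltz_pos K T I
  have := griffiths_second (minusIn_symmDiff I) (T ×ˢ Finset.univ) (c := fun p => K.coef p.2)
    (χ := fun p => bondChar p.2 p.1) (fun p _ => hK.coef p.2) (fun p _ => isChar_bondChar p.2 p.1)
    hf hg
  simp only [← boltz_eq] at this
  unfold gibbs
  rw [div_mul_div_comm, div_le_div_iff₀ (mul_pos hZ hZ) hZ]
  calc _ ≤ _ := mul_le_mul_of_nonneg_right this hZ.le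
    _ = _ := by ring

theorem gibbs_nonneg {K : Coupling} (hK : K.Nonneg) (T : Finset Edge) (I : Finset Site)
    {f : Minus → ℝ} (hf : PosFun f) : 0 ≤ gibbs K T I f := by
  exact div_nonneg (PosFun.sum_nonneg (minusIn_symmDiff I) (hf.mul (boltz_posFun hK T)))
    (sum_boltz_pos K T I).le

theorem gibbs_mono_fun (K : Coupling) (T : Finset Edge) (I : Finset Site)
    {f g : Minus → ℝ} (h : ∀ A ∈ minusIn I, f A ≤ g A) : gibbs K T I f ≤ gibbs K T I g :=
  div_le_div_of_nonneg_right (Finset.sum_le_sum fun A hA =>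
    mul_le_mul_of_nonneg_right (h A hA) (boltz_pos K T A).le) (sum_boltz_pos K T I).le

theorem gibbs_const (K : Coupling) (T : Finset Edge) (I : Finset Site) (c : ℝ) :
    gibbs K T I (fun _ => c) = c := by
  unfold gibbs
  rw [← Finset.mul_sum, mul_div_assoc, div_self (sum_boltz_pos K T I).ne', mul_one]

theorem gibbs_congr (K : Coupling) (T : Finset Edge) (I : Finset Site)
    {f g : Minus → ℝ} (h : ∀ A ∈ minusIn I, f A = g A) : gibbs K T I f = gibbs K T I g := by
  unfold gibbs
  rw [Finset.sum_congr rfl fun A hA => by rw [h A hA]]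

theorem energy_sub (K K' : Coupling) (A : Minus) (e : Edge) :
    energy K' A e = energy K A e + energy ⟨K'.k₁ - K.k₁, K'.k₂ - K.k₂, K'.k₃ - K.k₃⟩ A e := by
  unfold energy; ring

/-- Expectations of positive functions increase with the couplings. -/
theorem gibbs_mono_coupling {K K' : Coupling} (hK : K.Nonneg) (h₁ : K.k₁ ≤ K'.k₁)
    (h₂ : K.k₂ ≤ K'.k₂) (h₃ : K.k₃ ≤ K'.k₃) (T : Finset Edge) (I : Finset Site) {f : Minus → ℝ}
    (hf : PosFun f) : gibbs K T I f ≤ gibbs K' T I f := by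
  set D : Coupling := ⟨K'.k₁ - K.k₁, K'.k₂ - K.k₂, K'.k₃ - K.k₃⟩ with hD
  have hDn : D.Nonneg := ⟨sub_nonneg.2 h₁, sub_nonneg.2 h₂, sub_nonneg.2 h₃⟩
  have hb : ∀ A, boltz K' T A = boltz D T A * boltz K T A := fun A => by
    unfold boltz
    rw [← Real.exp_add, ← Finset.sum_add_distrib]
    congr 1
    exact Finset.sum_congr rfl fun e _ => by rw [energy_sub K K', ← hD, add_comm]
  -- The Boltzmann factor of the extra couplings is itself a positive function, so the second
  -- Griffiths inequality correlates it with `f`.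
  have hg : PosFun (boltz D T) := boltz_posFun hDn T
  have key := gibbs_mul_le hK T I hf hg
  have hZ := sum_boltz_pos K T I
  have hZ' := sum_boltz_pos K' T I
  unfold gibbs at key ⊢
  rw [← mul_div_right_comm, div_le_div_iff_of_pos_right hZ] at key
  simp only [hb] at hZ' ⊢
  rw [le_div_iff₀ hZ']
  rw [← mul_div_assoc, div_le_iff₀ hZ] at key
  have : ∑ A ∈ minusIn I, f A * (boltz D T A * boltz K T A) =
      ∑ A ∈ minusIn I, f A * boltz D T A * boltz K T A :=
    Finset.sum_congr rfl fun _ _ => by ring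
  rw [this]
  rw [div_mul_eq_mul_div, div_le_iff₀ hZ]
  exact key

theorem bond_eq_one_of_not_touch {A I : Finset Site} (hA : A ⊆ I) {e : Edge} (he : e ∉ touch I) :
    bond A e = 1 := by
  rw [mem_touch, not_or] at he
  unfold bond spin
  rw [if_neg fun h => he.1 (hA h), if_neg fun h => he.2 (hA h), one_mul]

/-- Edges not touching the volume do not matter. -/
theorem gibbs_eq_state (K : Coupling) {T : Finset Edge} {I : Finset Site} (hT : touch I ⊆ T)
    (f : Minus → ℝ) : gibbs K T I f = state K I f := by
  have hb : ∀ A ∈ minusIn I, boltz K T A =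
      Real.exp (∑ e ∈ T \ touch I, (K.k₁ + K.k₂ + K.k₃)) * boltz K (touch I) A := fun A hA => by
    rw [mem_minusIn] at hA
    unfold boltz
    rw [← Real.exp_add, ← Finset.sum_sdiff hT]
    congr 2
    refine Finset.sum_congr rfl fun e he => ?_
    have h1 := (Finset.mem_sdiff.1 he).2
    unfold energy
    rw [bond_eq_one_of_not_touch hA.1 h1, bond_eq_one_of_not_touch hA.2 h1]
    ring
  unfold state gibbs
  set c := Real.exp (∑ e ∈ T \ touch I, (K.k₁ + K.k₂ + K.k₃)) with hc
  have hcpos : c ≠ 0 := (Real.exp_pos _).ne'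
  rw [Finset.sum_congr rfl fun A hA => hb A hA,
    Finset.sum_congr rfl fun A hA => (by rw [hb A hA] : f A * boltz K T A = f A * (c * _))]
  rw [← Finset.mul_sum]
  simp only [mul_left_comm _ c]
  rw [← Finset.mul_sum, mul_div_mul_left _ _ hcpos]

theorem spin_le_one (A : Finset Site) (v : Site) : spin A v ≤ 1 := by
  unfold spin; split_ifs <;> norm_num

/-- The indicator that both spins are plus on `S`. -/
def plusOn (S : Finset Site) (A : Minus) : ℝ :=
  ∏ v ∈ S, ((1 + spin A.1 v) / 2) * ((1 + spin A.2 v) / 2)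

theorem plusOn_posFun (S : Finset Site) : PosFun (plusOn S) := by
  have h : ∀ χ : Minus → ℝ, IsChar χ → PosFun fun A => (1 + χ A) / 2 := fun χ hχ => by
    have := (PosFun.const (α := Minus) (c := 1 / 2) (by norm_num)).add _ _
      (PosFun.smul (1 / 2) (by norm_num) χ hχ)
    convert this using 2; ring
  exact PosFun.prod S fun v _ => (h _ (isChar_spin_fst v)).mul (h _ (isChar_spin_snd v))

theorem plusOn_eq (S : Finset Site) (A : Minus) :
    plusOn S A = if (∀ v ∈ S, v ∉ A.1 ∧ v ∉ A.2) then 1 else 0 := by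
  unfold plusOn
  split_ifs with h
  · refine Finset.prod_eq_one fun v hv => ?_
    simp [spin, h v hv]
  · push Not at h
    obtain ⟨v, hv, h1⟩ := h
    refine Finset.prod_eq_zero hv ?_
    by_cases h2 : v ∈ A.1
    · simp [spin, h2]
    · simp [spin, h1 h2]

/-- Forcing plus spins on `I' \ I` turns the larger volume into the smaller one. Since this
indicator is a positive function, Griffiths then compares volumes. -/
theorem sum_plusOn {I I' : Finset Site} (h : I ⊆ I') (g : Minus → ℝ) :
    ∑ A ∈ minusIn I', plusOn (I' \ I) A * g A = ∑ A ∈ minusIn I, g A := by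
  rw [← Finset.sum_subset (minusIn_mono h)]
  · refine Finset.sum_congr rfl fun A hA => ?_
    rw [mem_minusIn] at hA
    rw [plusOn_eq, if_pos, one_mul]
    intro v hv
    rw [Finset.mem_sdiff] at hv
    exact ⟨fun h1 => hv.2 (hA.1 h1), fun h1 => hv.2 (hA.2 h1)⟩
  · intro A hA hA'
    rw [mem_minusIn] at hA hA'
    rw [plusOn_eq, if_neg, zero_mul]
    intro h1
    refine hA' ⟨fun v hv => ?_, fun v hv => ?_⟩ <;> by_contra h2
    · exact (h1 v (Finset.mem_sdiff.2 ⟨hA.1 hv, h2⟩)).1 hv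
    · exact (h1 v (Finset.mem_sdiff.2 ⟨hA.2 hv, h2⟩)).2 hv

/-- Expectations of positive functions decrease with the volume. -/
theorem state_anti {K : Coupling} (hK : K.Nonneg) {I I' : Finset Site} (h : I ⊆ I')
    {f : Minus → ℝ} (hf : PosFun f) : state K I' f ≤ state K I f := by
  rw [← gibbs_eq_state K (touch_mono h)]
  have key := gibbs_mul_le hK (touch I') I' hf (plusOn_posFun (I' \ I))
  have hZ := sum_boltz_pos K (touch I') I'
  have hZ' := sum_boltz_pos K (touch I') I
  unfold state gibbs at *
  have e1 := sum_plusOn h (boltz K (touch I'))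
  have e2 : ∑ A ∈ minusIn I', f A * plusOn (I' \ I) A * boltz K (touch I') A =
      ∑ A ∈ minusIn I, f A * boltz K (touch I') A := by
    rw [← sum_plusOn h]
    exact Finset.sum_congr rfl fun _ _ => by ring
  rw [e1, e2, ← mul_div_assoc, div_le_div_iff_of_pos_right hZ] at key
  rwa [le_div_iff₀ hZ']

/-- Expectations are invariant under translations. -/
theorem state_translate (K : Coupling) (I : Finset Site) (x : Site) (f : Minus → ℝ) :
    state K (I.map (addRightEmbedding x)) f =
      state K I fun A => f (A.1.map (addRightEmbedding x), A.2.map (addRightEmbedding x)) := by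
  set τ := addRightEmbedding x with hτ
  have hspin : ∀ (A : Finset Site) (v : Site), spin (A.map τ) (τ v) = spin A v := fun A v => by
    simp only [spin, Finset.mem_map' τ]
  have hT : touch (I.map τ) = (touch I).map ⟨fun e : Edge => (τ e.1, e.2), fun e e' h => by
      simpa [Prod.ext_iff] using h⟩ := by
    ext e
    rw [mem_touch]
    constructor
    · intro h
      refine Finset.mem_map.2 ⟨(e.1 - x, e.2), mem_touch.2 (h.imp ?_ ?_), by simp [hτ]⟩
      · intro h1
        obtain ⟨v, hv, hv'⟩ := Finset.mem_map.1 h1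
        have : esrc (e.1 - x, e.2) = v := by
          change e.1 - x = v
          rw [sub_eq_iff_eq_add]; exact hv'.symm
        rwa [this]
      · intro h1
        obtain ⟨v, hv, hv'⟩ := Finset.mem_map.1 h1
        have : etgt (e.1 - x, e.2) = v := by
          change e.1 - x + dirVec e.2 = v
          have : v + x = e.1 + dirVec e.2 := hv'
          rw [← eq_sub_iff_add_eq] at this
          rw [this]; abel
        rwa [this]
    · intro h
      obtain ⟨e', he', rfl⟩ := Finset.mem_map.1 h
      refine (mem_touch.1 he').imp (fun h1 => Finset.mem_map_of_mem τ h1) fun h1 => ?_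
      have : etgt (τ e'.1, e'.2) = τ (etgt e') := by
        change e'.1 + x + dirVec e'.2 = e'.1 + dirVec e'.2 + x
        abel
      change etgt (τ e'.1, e'.2) ∈ _
      rw [this]
      exact Finset.mem_map_of_mem τ h1
  have hb : ∀ A : Minus, boltz K (touch (I.map τ)) (A.1.map τ, A.2.map τ) = boltz K (touch I) A :=
    fun A => by
      unfold boltz
      rw [hT, Finset.sum_map]
      congr 1
      refine Finset.sum_congr rfl fun e _ => ?_
      have hbond : ∀ B : Finset Site, bond (B.map τ) (τ e.1, e.2) = bond B e := fun B => by
        unfold bond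
        have h1 : esrc (τ e.1, e.2) = τ (esrc e) := rfl
        have h2 : etgt (τ e.1, e.2) = τ (etgt e) := by
          change e.1 + x + dirVec e.2 = e.1 + dirVec e.2 + x
          abel
        rw [h1, h2, hspin, hspin]
      change K.k₁ * bond (A.1.map τ) (τ e.1, e.2) + K.k₂ * bond (A.2.map τ) (τ e.1, e.2) +
        K.k₃ * (bond (A.1.map τ) (τ e.1, e.2) * bond (A.2.map τ) (τ e.1, e.2)) = energy K A e
      rw [hbond, hbond]
      rfl
  have hsum : ∀ g : Minus → ℝ, ∑ A ∈ minusIn (I.map τ), g A =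
      ∑ A ∈ minusIn I, g (A.1.map τ, A.2.map τ) := fun g => by
    unfold minusIn
    have hp : (I.map τ).powerset = I.powerset.map ⟨Finset.map τ, Finset.map_injective τ⟩ := by
      ext B
      rw [Finset.mem_powerset, Finset.mem_map, Finset.subset_map_iff]
      constructor
      · rintro ⟨C, hC, rfl⟩; exact ⟨C, Finset.mem_powerset.2 hC, rfl⟩
      · rintro ⟨C, hC, rfl⟩; exact ⟨C, Finset.mem_powerset.1 hC, rfl⟩
    rw [Finset.sum_product, Finset.sum_product, hp, Finset.sum_map]
    refine Finset.sum_congr rfl fun B _ => ?_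
    rw [Finset.sum_map]
    rfl
  unfold state gibbs
  rw [hsum, hsum]
  simp only [hb]

end Lattice

/-! ### Boxes and balls in the supremum norm. -/

section Geometry

/-- The supremum norm of a site, as a natural number. -/
def nrm (v : Site) : ℕ := max v.1.natAbs v.2.natAbs

/-- The sites of supremum norm less than `n`. -/
def box (n : ℕ) : Finset Site := Finset.Ioo (-(n : ℤ)) n ×ˢ Finset.Ioo (-(n : ℤ)) n

/-- The translate of a box. -/
def ballAt (x : Site) (n : ℕ) : Finset Site := (box n).map (addRightEmbedding x)

theorem mem_box {n : ℕ} {v : Site} : v ∈ box n ↔ nrm v < n := by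
  simp only [box, nrm, Finset.mem_product, Finset.mem_Ioo]
  omega

theorem box_mono {m n : ℕ} (h : m ≤ n) : box m ⊆ box n := fun v hv => by
  rw [mem_box] at *; omega

theorem mem_ballAt {x : Site} {n : ℕ} {v : Site} : v ∈ ballAt x n ↔ nrm (v - x) < n := by
  unfold ballAt
  rw [Finset.mem_map]
  constructor
  · rintro ⟨u, hu, rfl⟩
    rw [mem_box] at hu
    simpa using hu
  · intro h
    exact ⟨v - x, mem_box.2 h, by simp⟩

theorem nrm_etgt_le (e : Edge) : nrm (etgt e) ≤ nrm (esrc e) + 1 := by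
  obtain ⟨v, d⟩ := e
  cases d <;> simp only [nrm, etgt, esrc, dirVec, if_true, Bool.false_eq_true, if_false,
    Prod.fst_add, Prod.snd_add] <;> omega

theorem nrm_esrc_le (e : Edge) : nrm (esrc e) ≤ nrm (etgt e) + 1 := by
  obtain ⟨v, d⟩ := e
  cases d <;> simp only [nrm, etgt, esrc, dirVec, if_true, Bool.false_eq_true, if_false,
    Prod.fst_add, Prod.snd_add] <;> omega

theorem nrm_zero : nrm 0 = 0 := by simp [nrm]

theorem nrm_le_add (u v : Site) : nrm v ≤ nrm (v - u) + nrm u := by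
  simp only [nrm, Prod.fst_sub, Prod.snd_sub]; omega

theorem nrm_le_add' (u v : Site) : nrm u ≤ nrm (v - u) + nrm v := by
  simp only [nrm, Prod.fst_sub, Prod.snd_sub]; omega

end Geometry

/-! ### Local random-cluster weights, and domination of a tilt by an increase of inverse
temperature. -/

section LocalWeights

/-- Local random-cluster weights of the two-layer model. -/
def locW (K : Coupling) : Bool → Bool → ℝ
  | false, false => Real.exp (-K.k₁ - K.k₂ + K.k₃)
  | true, false => Real.exp (K.k₁ - K.k₂ - K.k₃) - Real.exp (-K.k₁ - K.k₂ + K.k₃)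
  | false, true => Real.exp (-K.k₁ + K.k₂ - K.k₃) - Real.exp (-K.k₁ - K.k₂ + K.k₃)
  | true, true => Real.exp (K.k₁ + K.k₂ + K.k₃) - Real.exp (K.k₁ - K.k₂ - K.k₃)
      - Real.exp (-K.k₁ + K.k₂ - K.k₃) + Real.exp (-K.k₁ - K.k₂ + K.k₃)

/-- Local weights with the weight of the empty state equal to one. -/
def normW (x₁ x₂ y : ℝ) : Bool → Bool → ℝ
  | false, false => 1
  | true, false => x₁
  | false, true => x₂
  | true, true => y

/-- Of the sixteen cases of Holley's condition nine have comparable states in the right order and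
are equalities; the hypotheses are the other seven. -/
theorem localHolley_normW {x₁ x₂ y x₁' x₂' y' : ℝ} (h1 : x₁ ≤ x₁') (h2 : x₂ ≤ x₂')
    (hy : y ≤ y') (hy2 : y * x₂' ≤ x₂ * y') (hy1 : y * x₁' ≤ x₁ * y') (h12 : x₁ * x₂' ≤ y')
    (h21 : x₂ * x₁' ≤ y') : LocalHolley (normW x₁ x₂ y) (normW x₁' x₂' y') := by
  intro i j i' j'
  cases i <;> cases j <;> cases i' <;> cases j' <;> simp [normW] <;> linarith

theorem LocalHolley.smul {w w' : Bool → Bool → ℝ} (h : LocalHolley w w') {c c' : ℝ} (hc : 0 ≤ c)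
    (hc' : 0 ≤ c') : LocalHolley (fun i j => c * w i j) (fun i j => c' * w' i j) := by
  intro i j i' j'
  have := mul_le_mul_of_nonneg_left (h i j i' j') (mul_nonneg hc hc')
  refine le_of_eq_of_le ?_ (this.trans_eq ?_) <;> ring

/-- First normalised weight. -/
def wX (a : ℝ) : ℝ := Real.exp (2 * a) - 1

/-- Normalised weight of the full state. -/
def wY (K : Coupling) : ℝ :=
  wX (K.k₁ - K.k₃) * wX (K.k₂ - K.k₃) +
    Real.exp (2 * (K.k₁ - K.k₃)) * Real.exp (2 * (K.k₂ - K.k₃)) * (Real.exp (4 * K.k₃) - 1)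

theorem locW_eq (K : Coupling) : locW K = fun i j => Real.exp (-K.k₁ - K.k₂ + K.k₃) *
    normW (wX (K.k₁ - K.k₃)) (wX (K.k₂ - K.k₃)) (wY K) i j := by
  have e1 : Real.exp (K.k₁ - K.k₂ - K.k₃) =
      Real.exp (-K.k₁ - K.k₂ + K.k₃) * Real.exp (2 * (K.k₁ - K.k₃)) := by
    rw [← Real.exp_add]; congr 1; ring
  have e2 : Real.exp (-K.k₁ + K.k₂ - K.k₃) =
      Real.exp (-K.k₁ - K.k₂ + K.k₃) * Real.exp (2 * (K.k₂ - K.k₃)) := by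
    rw [← Real.exp_add]; congr 1; ring
  have e3 : Real.exp (K.k₁ + K.k₂ + K.k₃) = Real.exp (-K.k₁ - K.k₂ + K.k₃) *
      (Real.exp (2 * (K.k₁ - K.k₃)) * Real.exp (2 * (K.k₂ - K.k₃)) * Real.exp (4 * K.k₃)) := by
    rw [← Real.exp_add, ← Real.exp_add, ← Real.exp_add]; congr 1; ring
  funext i j
  cases i <;> cases j <;> simp only [locW, normW, e1, e2, e3, wX, wY] <;> ring

theorem wX_nonneg {a : ℝ} (ha : 0 ≤ a) : 0 ≤ wX a := by
  unfold wX
  have := Real.one_le_exp (by positivity : 0 ≤ 2 * a)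
  linarith

theorem wX_mono {a b : ℝ} (h : a ≤ b) : wX a ≤ wX b := by
  unfold wX
  have := Real.exp_le_exp.2 (by linarith : 2 * a ≤ 2 * b)
  linarith

/-- Couplings for which the random-cluster representation is monotonic. -/
def Coupling.Admissible (K : Coupling) : Prop := 0 < K.k₃ ∧ K.k₃ ≤ K.k₁ ∧ K.k₃ ≤ K.k₂

theorem Coupling.Admissible.nonneg {K : Coupling} (hK : K.Admissible) : K.Nonneg :=
  ⟨hK.1.le.trans hK.2.1, hK.1.le.trans hK.2.2, hK.1.le⟩

theorem Coupling.Admissible.scale {K : Coupling} (hK : K.Admissible) {b : ℝ} (hb : 0 < b) :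
    (K.scale b).Admissible :=
  ⟨mul_pos hb hK.1, mul_le_mul_of_nonneg_left hK.2.1 hb.le,
    mul_le_mul_of_nonneg_left hK.2.2 hb.le⟩

theorem mul_wX_le_wY {K : Coupling} (hK : K.Admissible) :
    wX (K.k₁ - K.k₃) * wX (K.k₂ - K.k₃) ≤ wY K := by
  unfold wY
  have := Real.one_le_exp (by linarith [hK.1] : 0 ≤ 4 * K.k₃)
  have h2 : 0 ≤ Real.exp (4 * K.k₃) - 1 := by linarith
  have := mul_nonneg (mul_pos (Real.exp_pos (2 * (K.k₁ - K.k₃)))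
    (Real.exp_pos (2 * (K.k₂ - K.k₃)))).le h2
  linarith

theorem wY_pos {K : Coupling} (hK : K.Admissible) : 0 < wY K := by
  unfold wY
  have h1 := Real.one_lt_exp_iff.2 (by linarith [hK.1] : 0 < 4 * K.k₃)
  have h2 : 0 < Real.exp (4 * K.k₃) - 1 := by linarith
  have := mul_pos (mul_pos (Real.exp_pos (2 * (K.k₁ - K.k₃)))
    (Real.exp_pos (2 * (K.k₂ - K.k₃)))) h2
  have := mul_nonneg (wX_nonneg (sub_nonneg.2 hK.2.1)) (wX_nonneg (sub_nonneg.2 hK.2.2))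
  linarith

theorem locW_isLocalWeight {K : Coupling} (hK : K.Admissible) : IsLocalWeight (locW K) := by
  have hx1 := wX_nonneg (sub_nonneg.2 hK.2.1)
  have hx2 := wX_nonneg (sub_nonneg.2 hK.2.2)
  have hy := wY_pos hK
  have hE := Real.exp_pos (-K.k₁ - K.k₂ + K.k₃)
  rw [locW_eq]
  refine ⟨fun i j => mul_nonneg hE.le ?_, fun i => mul_pos hE ?_, LocalHolley.smul ?_ hE.le hE.le⟩
  · cases i <;> cases j <;> simp only [normW] <;> linarith
  · cases i <;> simp only [normW] <;> linarith
  · refine localHolley_normW le_rfl le_rfl le_rfl (by linarith) (by linarith) (mul_wX_le_wY hK) ?_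
    rw [mul_comm]; exact mul_wX_le_wY hK

/-- `sinh`-type comparison: `(exp (c b) - 1)` grows at least like `b exp (c b / 2)`. -/
theorem exp_sub_one_ratio {c b b' : ℝ} (hc : 0 ≤ c) (hb : 0 < b) (hbb : b ≤ b') :
    Real.exp (c * (b' - b) / 2) * b' * (Real.exp (c * b) - 1) ≤ b * (Real.exp (c * b') - 1) := by
  have hsinh : b' * Real.sinh (c * b / 2) ≤ b * Real.sinh (c * b' / 2) := by
    have hconv : ConvexOn ℝ (Set.Ici 0) Real.sinh := by
      refine convexOn_of_deriv2_nonneg (convex_Ici 0) Real.continuous_sinh.continuousOn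
        Real.differentiable_sinh.differentiableOn ?_ ?_
      · rw [Real.deriv_sinh]; exact Real.differentiable_cosh.differentiableOn
      · intro x hx
        rw [interior_Ici] at hx
        simp only [Function.iterate_succ, Function.iterate_zero, Function.comp_apply, id,
          Real.deriv_sinh, Real.deriv_cosh]
        exact Real.sinh_nonneg_iff.2 (le_of_lt hx)
    have hb' : 0 < b' := hb.trans_le hbb
    have h := hconv.2 (show c * b' / 2 ∈ Set.Ici (0 : ℝ) from Set.mem_Ici.2 (by positivity))
      (show (0 : ℝ) ∈ Set.Ici (0 : ℝ) from Set.mem_Ici.2 le_rfl) (show 0 ≤ b / b' by positivity)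
      (show 0 ≤ 1 - b / b' by rw [sub_nonneg, div_le_one hb']; exact hbb) (by ring)
    simp only [smul_eq_mul, mul_zero, add_zero, Real.sinh_zero] at h
    have e : b / b' * (c * b' / 2) = c * b / 2 := by field_simp
    rw [e, div_mul_eq_mul_div, le_div_iff₀ hb'] at h
    linarith
  have e1 : ∀ t : ℝ, Real.exp t - 1 = 2 * Real.exp (t / 2) * Real.sinh (t / 2) := fun t => by
    rw [Real.sinh_eq]
    have h1 : Real.exp t = Real.exp (t / 2) * Real.exp (t / 2) := by
      rw [← Real.exp_add]; congr 1; ring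
    have h2 : Real.exp (t / 2) * Real.exp (-(t / 2)) = 1 := by
      rw [← Real.exp_add]; simp
    rw [h1]; linear_combination h2
  rw [e1, e1]
  have e2 : Real.exp (c * b' / 2) = Real.exp (c * (b' - b) / 2) * Real.exp (c * b / 2) := by
    rw [← Real.exp_add]; congr 1; ring
  rw [e2]
  have := mul_le_mul_of_nonneg_left hsinh
    (by positivity : 0 ≤ 2 * (Real.exp (c * (b' - b) / 2) * Real.exp (c * b / 2)))
  linarith

/-- `(1 - exp (-a b)) / b` is decreasing. -/
theorem one_sub_exp_ratio {a b b' : ℝ} (hb : 0 < b) (hbb : b ≤ b') :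
    b * (1 - Real.exp (-(a * b'))) ≤ b' * (1 - Real.exp (-(a * b))) := by
  have hb' : 0 < b' := hb.trans_le hbb
  have h := convexOn_exp.2 (Set.mem_univ (-(a * b'))) (Set.mem_univ 0)
    (show 0 ≤ b / b' by positivity)
    (show 0 ≤ 1 - b / b' by rw [sub_nonneg, div_le_one hb']; exact hbb) (by ring)
  simp only [smul_eq_mul, mul_zero, add_zero, Real.exp_zero, mul_one] at h
  have e : b / b' * (-(a * b')) = -(a * b) := by field_simp
  rw [e] at h
  have e3 : b / b' * Real.exp (-(a * b')) + (1 - b / b') =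
      (b * Real.exp (-(a * b')) + (b' - b)) / b' := by field_simp
  rw [e3, le_div_iff₀ hb'] at h
  nlinarith

theorem tilt_smul_normW (h c x₁ x₂ y : ℝ) : tilt h (fun i j => c * normW x₁ x₂ y i j) =
    fun i j => c * normW (Real.exp h * x₁) x₂ (Real.exp h * y) i j := by
  funext i j
  cases i <;> cases j <;> simp [tilt, normW] <;> ring

/-- Raising `b` to `b'` gains a factor `exp (2 k₃ (b' - b))` in `exp (4 k₃ b) - 1` and `exp ((k₁ -
k₃) (b' - b))` in `wX (b (k₁ - k₃))`. The rate must not exceed either gain, except that for `k₁ =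
k₃` the second weight is identically zero and imposes nothing. -/
theorem exists_tilt_rate {K : Coupling} (hK : K.Admissible) :
    ∃ κ : ℝ, 0 < κ ∧ κ ≤ 2 * K.k₃ ∧ (K.k₁ = K.k₃ ∨ κ ≤ K.k₁ - K.k₃) := by
  rcases hK.2.1.eq_or_lt with h | h
  · exact ⟨2 * K.k₃, by linarith [hK.1], le_rfl, Or.inl h.symm⟩
  · exact ⟨min (2 * K.k₃) (K.k₁ - K.k₃), lt_min (by linarith [hK.1]) (by linarith),
      min_le_left _ _, Or.inr (min_le_right _ _)⟩

/-- Raising the inverse temperature dominates a tilt of the first layer. -/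
theorem localHolley_tilt {K : Coupling} (hK : K.Admissible) {κ : ℝ}
    (hκ3 : κ ≤ 2 * K.k₃) (hκ1 : K.k₁ = K.k₃ ∨ κ ≤ K.k₁ - K.k₃) {b b' h : ℝ} (hb : 0 < b)
    (hbb : b ≤ b') (h0 : 0 ≤ h) (hh : h ≤ κ * (b' - b)) :
    LocalHolley (tilt h (locW (K.scale b))) (locW (K.scale b')) := by
  have hb' : 0 < b' := hb.trans_le hbb
  have hδ : 0 ≤ b' - b := sub_nonneg.2 hbb
  have hA := hK.scale hb
  have hA' := hK.scale hb'
  rw [locW_eq, locW_eq, tilt_smul_normW]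
  refine LocalHolley.smul ?_ (Real.exp_pos _).le (Real.exp_pos _).le
  set k₁ := K.k₁
  set k₂ := K.k₂
  set k₃ := K.k₃
  have hk₃ : 0 < k₃ := hK.1
  have ha₁ : 0 ≤ k₁ - k₃ := sub_nonneg.2 hK.2.1
  have ha₂ : 0 ≤ k₂ - k₃ := sub_nonneg.2 hK.2.2
  have s1 : (K.scale b).k₁ - (K.scale b).k₃ = b * (k₁ - k₃) := by
    simp only [Coupling.scale]; ring
  have s2 : (K.scale b).k₂ - (K.scale b).k₃ = b * (k₂ - k₃) := by
    simp only [Coupling.scale]; ring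
  have s1' : (K.scale b').k₁ - (K.scale b').k₃ = b' * (k₁ - k₃) := by
    simp only [Coupling.scale]; ring
  have s2' : (K.scale b').k₂ - (K.scale b').k₃ = b' * (k₂ - k₃) := by
    simp only [Coupling.scale]; ring
  have hy2 := mul_wX_le_wY hA'
  have hyeq : wY (K.scale b) = wX (b * (k₁ - k₃)) * wX (b * (k₂ - k₃)) +
      (wX (b * (k₁ - k₃)) + 1) * (wX (b * (k₂ - k₃)) + 1) * (Real.exp (4 * k₃ * b) - 1) := by
    unfold wY
    have s3 : 4 * (K.scale b).k₃ = 4 * k₃ * b := by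
      change 4 * (b * K.k₃) = 4 * K.k₃ * b
      ring
    rw [s1, s2, s3]
    simp only [wX, sub_add_cancel]
  have hyeq' : wY (K.scale b') = wX (b' * (k₁ - k₃)) * wX (b' * (k₂ - k₃)) +
      (wX (b' * (k₁ - k₃)) + 1) * (wX (b' * (k₂ - k₃)) + 1) * (Real.exp (4 * k₃ * b') - 1) := by
    unfold wY
    have s3 : 4 * (K.scale b').k₃ = 4 * k₃ * b' := by
      change 4 * (b' * K.k₃) = 4 * K.k₃ * b'
      ring
    rw [s1', s2', s3]
    simp only [wX, sub_add_cancel]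
  have hx1n := wX_nonneg (mul_nonneg hb.le ha₁)
  have hx2n := wX_nonneg (mul_nonneg hb.le ha₂)
  have hx1m : wX (b * (k₁ - k₃)) ≤ wX (b' * (k₁ - k₃)) :=
    wX_mono (mul_le_mul_of_nonneg_right hbb ha₁)
  have hx2m : wX (b * (k₂ - k₃)) ≤ wX (b' * (k₂ - k₃)) :=
    wX_mono (mul_le_mul_of_nonneg_right hbb ha₂)
  -- Besides the tilt, the convexity of `sinh` yields a spare factor `b' / b`, kept here because the
  -- mixed inequalities will consume it.
  have hV : Real.exp h * b' * (Real.exp (4 * k₃ * b) - 1) ≤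
      b * (Real.exp (4 * k₃ * b') - 1) := by
    have := exp_sub_one_ratio (c := 4 * k₃) (by positivity) hb hbb
    have hv : 0 ≤ Real.exp (4 * k₃ * b) - 1 := by
      linarith [Real.one_le_exp (by positivity : 0 ≤ 4 * k₃ * b)]
    have h1 : Real.exp h ≤ Real.exp (4 * k₃ * (b' - b) / 2) := Real.exp_le_exp.2 (by nlinarith)
    calc _ ≤ Real.exp (4 * k₃ * (b' - b) / 2) * b' * (Real.exp (4 * k₃ * b) - 1) := by gcongr
      _ ≤ _ := this
  have hX : Real.exp h * wX (b * (k₁ - k₃)) ≤ wX (b' * (k₁ - k₃)) := by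
    rcases hκ1 with h1 | h1
    · rw [h1]; simp [wX]
    · have := exp_sub_one_ratio (c := 2 * (k₁ - k₃)) (by positivity) hb hbb
      have h2 : Real.exp h ≤ Real.exp (2 * (k₁ - k₃) * (b' - b) / 2) :=
        Real.exp_le_exp.2 (by nlinarith)
      have e1 : Real.exp (2 * (k₁ - k₃) * b) - 1 = wX (b * (k₁ - k₃)) := by
        unfold wX; congr 2; ring
      have e2 : Real.exp (2 * (k₁ - k₃) * b') - 1 = wX (b' * (k₁ - k₃)) := by
        unfold wX; congr 2; ring
      rw [e1, e2] at this
      have h3 : b * (Real.exp h * wX (b * (k₁ - k₃))) ≤ b * wX (b' * (k₁ - k₃)) := by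
        refine le_trans ?_ this
        calc b * (Real.exp h * wX (b * (k₁ - k₃)))
            ≤ b' * (Real.exp (2 * (k₁ - k₃) * (b' - b) / 2) * wX (b * (k₁ - k₃))) := by gcongr
          _ = _ := by ring
      exact le_of_mul_le_mul_left h3 hb
  -- Equivalent to `z / (z + 1) ≤ (b' / b) * (x / (x + 1))`, where `x / (x + 1) = 1 - exp (-2 a b)`
  -- is concave in `b`. The loss `b' / b` is exactly what `hV` has in reserve.
  have hR : ∀ a, 0 ≤ a → b * (wX (b' * a) * (wX (b * a) + 1)) ≤
      b' * (wX (b * a) * (wX (b' * a) + 1)) := fun a ha => by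
    have := one_sub_exp_ratio (a := 2 * a) hb hbb
    have e1 : ∀ t, wX (t * a) = (1 - Real.exp (-(2 * a * t))) * Real.exp (2 * (t * a)) := fun t => by
      unfold wX
      have : Real.exp (-(2 * a * t)) * Real.exp (2 * (t * a)) = 1 := by
        rw [← Real.exp_add, ← Real.exp_zero]; congr 1; ring
      linear_combination this
    have e2 : ∀ t, wX (t * a) + 1 = Real.exp (2 * (t * a)) := fun t => by unfold wX; ring
    rw [e2, e2, e1, e1]
    have := mul_le_mul_of_nonneg_right this (by positivity :
      0 ≤ Real.exp (2 * (b' * a)) * Real.exp (2 * (b * a)))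
    linarith
  have hR1 := hR _ ha₁
  have hR2 := hR _ ha₂
  rw [s1', s2', hyeq'] at hy2
  rw [s1, s2, s1', s2']
  have hvn : 0 ≤ Real.exp (4 * k₃ * b) - 1 := by
    linarith [Real.one_le_exp (by positivity : 0 ≤ 4 * k₃ * b)]
  have hH : 1 ≤ Real.exp h := Real.one_le_exp h0
  rw [hyeq, hyeq']
  clear hyeq hyeq'
  generalize wX (b * (k₁ - k₃)) = x₁ at *
  generalize wX (b * (k₂ - k₃)) = x₂ at *
  generalize wX (b' * (k₁ - k₃)) = z₁ at *
  generalize wX (b' * (k₂ - k₃)) = z₂ at *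
  generalize Real.exp (4 * k₃ * b) - 1 = v at *
  generalize Real.exp (4 * k₃ * b') - 1 = v' at *
  generalize Real.exp h = H at *
  have hz1 : 0 ≤ z₁ := hx1n.trans hx1m
  have hz2 : 0 ≤ z₂ := hx2n.trans hx2m
  have hHv : H * v ≤ v' := by
    have : b * (H * v) ≤ b * v' := by
      refine le_trans ?_ hV
      calc b * (H * v) ≤ b' * (H * v) := by gcongr
        _ = _ := by ring
    exact le_of_mul_le_mul_left this hb
  have hv'n : 0 ≤ v' := (mul_nonneg (by linarith) hvn).trans hHv
  -- The difficult part of the two mixed conditions `y * x' ≤ x * y'`: multiplying `hR` by `hV`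
  -- cancels `b` and `b'`.
  have hcross : ∀ p q r r' : ℝ, 0 ≤ p → p ≤ q → 0 ≤ r → 0 ≤ r' →
      b * (r' * (r + 1)) ≤ b' * (r * (r' + 1)) →
      H * ((p + 1) * (r + 1) * v) * r' ≤ r * ((q + 1) * (r' + 1) * v') :=
    fun p q r r' hp hpq hr hr' hrr => by
    have hq : 0 ≤ q := hp.trans hpq
    have t1 : (b * (r' * (r + 1))) * (H * b' * v) ≤ (b' * (r * (r' + 1))) * (b * v') :=
      mul_le_mul hrr hV (by positivity) (by positivity)
    have t2 : b * b' * (H * (r' * (r + 1) * v)) ≤ b * b' * (r * (r' + 1) * v') := by linarith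
    have t3 := le_of_mul_le_mul_left t2 (by positivity)
    calc H * ((p + 1) * (r + 1) * v) * r' = (p + 1) * (H * (r' * (r + 1) * v)) := by ring
      _ ≤ (q + 1) * (r * (r' + 1) * v') := by gcongr
      _ = _ := by ring
  have hc2 := hcross x₁ z₁ x₂ z₂ hx1n hx1m hx2n hz2 hR2
  have hc1 := hcross x₂ z₂ x₁ z₁ hx2n hx2m hx1n hz1 hR1
  have hT : H * (x₁ * x₂) ≤ z₁ * z₂ := by
    calc H * (x₁ * x₂) = (H * x₁) * x₂ := by ring
      _ ≤ z₁ * z₂ := mul_le_mul hX hx2m hx2n hz1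
  refine localHolley_normW hX hx2m ?_ ?_ ?_ ?_ ?_
  · calc H * (x₁ * x₂ + (x₁ + 1) * (x₂ + 1) * v)
        = H * (x₁ * x₂) + (x₁ + 1) * (x₂ + 1) * (H * v) := by ring
      _ ≤ z₁ * z₂ + (z₁ + 1) * (z₂ + 1) * v' := by gcongr
  · calc H * (x₁ * x₂ + (x₁ + 1) * (x₂ + 1) * v) * z₂
        = (H * x₁) * (x₂ * z₂) + H * ((x₁ + 1) * (x₂ + 1) * v) * z₂ := by ring
      _ ≤ z₁ * (x₂ * z₂) + x₂ * ((z₁ + 1) * (z₂ + 1) * v') := by gcongr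
      _ = _ := by ring
  · have t := mul_nonneg hx1n hz1
    have t0 : H * (x₁ * x₂) * z₁ ≤ H * x₁ * (z₁ * z₂) := by
      calc H * (x₁ * x₂) * z₁ = H * (x₁ * z₁) * x₂ := by ring
        _ ≤ H * (x₁ * z₁) * z₂ := by gcongr
        _ = _ := by ring
    have t1 : x₁ * ((z₂ + 1) * (z₁ + 1) * v') ≤ H * (x₁ * ((z₂ + 1) * (z₁ + 1) * v')) :=
      le_mul_of_one_le_left (by positivity) hH
    linarith
  · calc H * x₁ * z₂ ≤ z₁ * z₂ := by gcongr
      _ ≤ _ := hy2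
  · calc x₂ * z₁ ≤ z₂ * z₁ := by gcongr
      _ = z₁ * z₂ := by ring
      _ ≤ _ := hy2

end LocalWeights

/-! ### The random-cluster representation of the lattice model and the magnetisation in boxes. -/

section Representation

variable (T : Finset Edge)

/-- First endpoint of an edge of `T`. -/
def subSrc (e : T) : Site := esrc e.1

/-- Second endpoint of an edge of `T`. -/
def subTgt (e : T) : Site := etgt e.1

variable {T}

/-- The weights `locW` are the inclusion–exclusion inverse of the four possible values of the edge
factor, one for each pattern of agreement in the two layers. -/
theorem layerFactor_locW (K : Coupling) (A : Minus) (e : T) :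
    layerFactor (locW K) (Agree (subSrc T) (subTgt T) A.1 e) (Agree (subSrc T) (subTgt T) A.2 e) =
      Real.exp (energy K A e) := by
  have hb : ∀ B : Finset Site, (Agree (subSrc T) (subTgt T) B e ∧ bond B e = 1) ∨
      (¬ Agree (subSrc T) (subTgt T) B e ∧ bond B e = -1) := fun B => by
    unfold Agree bond spin subSrc subTgt
    by_cases h1 : esrc e.1 ∈ B <;> by_cases h2 : etgt e.1 ∈ B <;> simp [h1, h2]
  unfold energy layerFactor
  rcases hb A.1 with ⟨h1, e1⟩ | ⟨h1, e1⟩ <;> rcases hb A.2 with ⟨h2, e2⟩ | ⟨h2, e2⟩ <;>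
    simp only [e1, e2, h1, h2, if_true, if_false, and_self, and_true, and_false, locW] <;> ring_nf

theorem prod_layerFactor_locW (K : Coupling) (A : Minus) :
    ∏ e, layerFactor (locW K) (Agree (subSrc T) (subTgt T) A.1 e)
      (Agree (subSrc T) (subTgt T) A.2 e) = boltz K T A := by
  simp only [layerFactor_locW]
  rw [← Real.exp_sum, boltz, Finset.sum_coe_sort T (fun e => energy K A e)]

theorem sum_minusIn_boltz (K : Coupling) (I : Finset Site) (g : Finset Site → Finset Site → ℝ) :
    ∑ A ∈ minusIn I, g A.1 A.2 * boltz K T A = ∑ A ∈ I.powerset, ∑ B ∈ I.powerset, g A B *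
      ∏ e, layerFactor (locW K) (Agree (subSrc T) (subTgt T) A e)
        (Agree (subSrc T) (subTgt T) B e) := by
  unfold minusIn
  rw [Finset.sum_product]
  exact Finset.sum_congr rfl fun A _ => Finset.sum_congr rfl fun B _ => by
    rw [← prod_layerFactor_locW K (A, B)]

/-- The random-cluster representation of the magnetisation of the first layer. -/
theorem gibbs_spin_eq (K : Coupling) (I : Finset Site) (x : Site) :
    gibbs K T I (fun A => spin A.1 x) =
      mean (fkWeight (subSrc T) (subTgt T) (locW K) I) (forcedInd (subSrc T) (subTgt T) I x) := by
  rw [mean_forcedInd]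
  unfold gibbs
  have h1 := sum_minusIn_boltz (T := T) K I fun A _ => spin A x
  have h2 := sum_minusIn_boltz (T := T) K I fun _ _ => 1
  simp only [one_mul] at h2
  rw [h1, h2]

theorem gibbs_spin_mul_spin_le {K : Coupling} (hK : K.Admissible) (I : Finset Site) (x : Site) :
    gibbs K T I (fun A => spin A.1 x * spin A.2 x) ≤ gibbs K T I (fun A => spin A.1 x) := by
  unfold gibbs
  refine div_le_div_of_nonneg_right ?_ (sum_boltz_pos K T I).le
  have h1 := sum_minusIn_boltz (T := T) K I fun A _ => spin A x
  have h2 := sum_minusIn_boltz (T := T) K I fun A B => spin A x * spin B x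
  rw [h1, h2]
  exact sum_spin_mul_spin_le (locW_isLocalWeight hK).nonneg I x

/-- The magnetisation of the first layer at the centre of a box with plus boundary conditions. -/
def magnet (K : Coupling) (n : ℕ) : ℝ := state K (box n) fun A => spin A.1 0

theorem state_ballAt (K : Coupling) (x : Site) (n : ℕ) :
    state K (ballAt x n) (fun A => spin A.1 x) = magnet K n := by
  unfold ballAt magnet
  rw [state_translate]
  congr 1
  funext A
  have h : (0 : Site) ∈ A.1 ↔ x ∈ A.1.map (addRightEmbedding x) := by
    rw [Finset.mem_map]
    constructor
    · intro h; exact ⟨0, h, by simp⟩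
    · rintro ⟨v, hv, hx⟩
      have : v = 0 := by simpa using hx
      rwa [← this]
  simp only [spin, h]

theorem magnet_nonneg {K : Coupling} (hK : K.Nonneg) (n : ℕ) : 0 ≤ magnet K n :=
  gibbs_nonneg hK _ _ (isChar_spin_fst 0).posFun

theorem magnet_anti {K : Coupling} (hK : K.Nonneg) : Antitone (magnet K) := fun _ _ h =>
  state_anti hK (box_mono h) (isChar_spin_fst 0).posFun

theorem magnet_le_one (K : Coupling) (n : ℕ) : magnet K n ≤ 1 := by
  have := gibbs_mono_fun K (touch (box n)) (box n) (f := fun A => spin A.1 0) (g := fun _ => 1)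
    (fun A _ => spin_le_one _ _)
  rwa [gibbs_const] at this

theorem magnet_mono {K : Coupling} (hK : K.Nonneg) {b b' : ℝ} (hb : 0 ≤ b) (hbb : b ≤ b') (n : ℕ) :
    magnet (K.scale b) n ≤ magnet (K.scale b') n :=
  gibbs_mono_coupling (K' := K.scale b') (hK.scale hb) (mul_le_mul_of_nonneg_right hbb hK.1)
    (mul_le_mul_of_nonneg_right hbb hK.2.1) (mul_le_mul_of_nonneg_right hbb hK.2.2) _ _
    (isChar_spin_fst 0).posFun

end Representation

/-! ### Exploring from spheres: the differential inequality and its integrated form. -/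

section Exploration

/-- The sites of `box (2 * n)` that do not have norm `k`. -/
def offSphere (n k : ℕ) : Finset Site := (box (2 * n)).filter fun v => nrm v ≠ k

variable {T : Finset Edge}

/-- The edge `e` touches `box n` and its exploration is triggered by the open edges `ω`, when
starting from the sphere of radius `k`. -/
def Reveals (T : Finset Edge) (n k : ℕ) (ω : T → Bool) (e : T) : Prop :=
  e.1 ∈ touch (box n) ∧ (Forced (subSrc T) (subTgt T) (offSphere n k) ω (esrc e.1) ∨
    Forced (subSrc T) (subTgt T) (offSphere n k) ω (etgt e.1))

theorem Reveals.mono {n k : ℕ} {ξ ω : T → Bool} (h : ξ ≤ ω) (e : T) (hr : Reveals T n k ξ e) :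
    Reveals T n k ω e :=
  ⟨hr.1, hr.2.imp (fun h1 => h1.mono h) fun h1 => h1.mono h⟩

/-- Let `C` be the set of sites connected by `ξ` to the sphere of radius `k` or to the complement of
the large box. Every edge touching `box n` with an endpoint in `C` is revealed, hence agrees in `ξ`
and `ω`. A set `A` showing that the origin is not connected in `ξ` yields one for `ω`: if the origin
is in `C`, take `A ∩ C`; otherwise take `box k \ C`, since a connection out of `box k` would have to
cross the sphere, which lies in `C`. -/
theorem forced_of_agree_off_reveals {n k : ℕ} (hk : 1 ≤ k) (hkn : k ≤ n) {ξ ω : T → Bool}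
    (hdet : ∀ e, ω e ≠ ξ e → ¬ Reveals T n k ξ e)
    (h : Forced (subSrc T) (subTgt T) (box n) ω 0) :
    Forced (subSrc T) (subTgt T) (box n) ξ 0 := by
  classical
  intro A hA hc h0
  set C : Site → Prop := fun v => Forced (subSrc T) (subTgt T) (offSphere n k) ξ v with hC
  have hopen : ∀ e : T, ξ e = true → (C (esrc e.1) ↔ C (etgt e.1)) := fun e he =>
    forced_iff_of_open (src := subSrc T) (tgt := subTgt T) he
  have hclosed : ∀ e : T, ω e = true → ξ e ≠ true →
      (esrc e.1 ∉ box n ∧ etgt e.1 ∉ box n) ∨ (¬ C (esrc e.1) ∧ ¬ C (etgt e.1)) :=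
    fun e he hξ => by
      have h1 := hdet e (by rw [he]; exact fun h => hξ h.symm)
      unfold Reveals at h1
      rw [mem_touch] at h1
      tauto
  have hsphere : ∀ v, nrm v = k → C v := fun v hv => forced_of_notMem _ (by
    simp [offSphere, hv])
  by_cases h0C : C 0
  · refine h (A.filter C) ((Finset.filter_subset _ _).trans hA) (fun e he => ?_)
      (Finset.mem_filter.2 ⟨h0, h0C⟩)
    unfold Agree
    rw [Finset.mem_filter, Finset.mem_filter]
    change (esrc e.1 ∈ A ∧ C (esrc e.1)) ↔ (etgt e.1 ∈ A ∧ C (etgt e.1))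
    by_cases hξ : ξ e = true
    · exact and_congr (hc e hξ) (hopen e hξ)
    · rcases hclosed e he hξ with h1 | h1
      · exact iff_of_false (fun h2 => h1.1 (hA h2.1)) fun h2 => h1.2 (hA h2.1)
      · exact iff_of_false (fun h2 => h1.1 h2.2) fun h2 => h1.2 h2.2
  · refine h ((box k).filter fun v => ¬ C v) ((Finset.filter_subset _ _).trans (box_mono hkn))
      (fun e he => ?_) (Finset.mem_filter.2 ⟨mem_box.2 (by rw [nrm_zero]; omega), h0C⟩)
    unfold Agree
    rw [Finset.mem_filter, Finset.mem_filter, mem_box, mem_box]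
    change (nrm (esrc e.1) < k ∧ ¬ C (esrc e.1)) ↔ (nrm (etgt e.1) < k ∧ ¬ C (etgt e.1))
    have hboth : ¬ C (esrc e.1) → ¬ C (etgt e.1) →
        ((nrm (esrc e.1) < k ∧ ¬ C (esrc e.1)) ↔ (nrm (etgt e.1) < k ∧ ¬ C (etgt e.1))) :=
      fun h1 h2 => by
        have n1 : nrm (esrc e.1) ≠ k := fun hn => h1 (hsphere _ hn)
        have n2 : nrm (etgt e.1) ≠ k := fun hn => h2 (hsphere _ hn)
        have l1 := nrm_etgt_le e.1
        have l2 := nrm_esrc_le e.1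
        constructor
        · rintro ⟨h3, -⟩; exact ⟨by omega, h2⟩
        · rintro ⟨h3, -⟩; exact ⟨by omega, h1⟩
    by_cases hξ : ξ e = true
    · by_cases h1 : C (esrc e.1)
      · exact iff_of_false (fun h2 => h2.2 h1) fun h2 => h2.2 ((hopen e hξ).1 h1)
      · exact hboth h1 fun h2 => h1 ((hopen e hξ).2 h2)
    · rcases hclosed e he hξ with h1 | h1
      · rw [mem_box, mem_box] at h1
        exact iff_of_false (fun h2 => h1.1 (by omega)) fun h2 => h1.2 (by omega)
      · exact hboth h1.1 h1.2

theorem forcedInd_eq_of_agree {n k : ℕ} (hk : 1 ≤ k) (hkn : k ≤ n) {ξ ω : T → Bool} (hle : ξ ≤ ω)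
    (hdet : ∀ e, ω e ≠ ξ e → ¬ Reveals T n k ξ e) :
    forcedInd (subSrc T) (subTgt T) (box n) 0 ω = forcedInd (subSrc T) (subTgt T) (box n) 0 ξ := by
  unfold forcedInd
  congr 1
  exact propext ⟨forced_of_agree_off_reveals hk hkn hdet, fun h => h.mono hle⟩

/-- The natural-number distance. -/
def gap (a k : ℕ) : ℕ := (a - k) + (k - a)

/-- To reach the sphere from `u` one must leave the ball of radius `gap (nrm u) k` around `u`, so
the magnetisation in that ball bounds the probability. The doubled box is there to contain all these
balls. -/
theorem ballAt_subset_offSphere {n k : ℕ} (hk : 1 ≤ k) (hkn : k ≤ n) {u : Site} (hu : nrm u ≤ n) :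
    ballAt u (gap (nrm u) k) ⊆ offSphere n k := fun v hv => by
  rw [mem_ballAt] at hv
  have h1 := nrm_le_add u v
  have h2 := nrm_le_add' u v
  unfold gap at hv
  rw [offSphere, Finset.mem_filter, mem_box]
  omega

/-- Probability that a site of the box is connected to the sphere of radius `k`. -/
theorem mean_forcedInd_offSphere_le {K K' : Coupling} (hK : K.Admissible) (hK' : K'.Admissible)
    {h : ℝ} (hH : LocalHolley (tilt h (locW K)) (locW K')) {n k : ℕ} (hk : 1 ≤ k) (hkn : k ≤ n)
    {u : Site} (hu : nrm u ≤ n) (hT : touch (box (2 * n)) ⊆ T) :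
    mean (fkWeight (subSrc T) (subTgt T) (tilt h (locW K)) (box (2 * n)))
        (forcedInd (subSrc T) (subTgt T) (offSphere n k) u) ≤
      magnet K' (gap (nrm u) k) := by
  have hw := (locW_isLocalWeight hK).tilt h
  have hw' := locW_isLocalWeight hK'
  have hsub := ballAt_subset_offSphere hk hkn hu
  have hsub2 : offSphere n k ⊆ box (2 * n) := Finset.filter_subset _ _
  calc mean (fkWeight (subSrc T) (subTgt T) (tilt h (locW K)) (box (2 * n)))
        (forcedInd (subSrc T) (subTgt T) (offSphere n k) u)
      ≤ mean (fkWeight (subSrc T) (subTgt T) (tilt h (locW K)) (box (2 * n)))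
        (forcedInd (subSrc T) (subTgt T) (ballAt u (gap (nrm u) k)) u) :=
        mean_mono (fun ω => (fkWeight_pos hw.nonneg hw.diag_pos _ ω).le)
          fun ω => forcedInd_anti hsub u ω
    _ ≤ mean (fkWeight (subSrc T) (subTgt T) (locW K') (ballAt u (gap (nrm u) k)))
        (forcedInd (subSrc T) (subTgt T) (ballAt u (gap (nrm u) k)) u) :=
        mean_fkWeight_le hw.nonneg hw.diag_pos hw'.nonneg hw'.diag_pos hH
          (hsub.trans hsub2) (forcedInd_monotone _ _)
    _ = magnet K' (gap (nrm u) k) := by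
        rw [← gibbs_spin_eq, gibbs_eq_state K' ((touch_mono (hsub.trans hsub2)).trans hT),
          state_ballAt]

/-- Each distance occurs at most twice, once with `k ≤ a` and once with `k > a`. -/
theorem sum_gap_le {m : ℕ → ℝ} (hm : ∀ d, 0 ≤ m d) {a n : ℕ} (ha : a ≤ n) :
    ∑ k ∈ Finset.Icc 1 n, m (gap a k) ≤ 2 * ∑ d ∈ Finset.range (n + 1), m d := by
  have hinj : ∀ s : Finset ℕ, s ⊆ Finset.Icc 1 n → Set.InjOn (gap a) s →
      ∑ k ∈ s, m (gap a k) ≤ ∑ d ∈ Finset.range (n + 1), m d := fun s hs hi => by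
    rw [← Finset.sum_image (f := m) (g := gap a) (fun x hx y hy h => hi hx hy h)]
    refine Finset.sum_le_sum_of_subset_of_nonneg (fun d hd => ?_) fun d _ _ => hm d
    obtain ⟨k, hk, rfl⟩ := Finset.mem_image.1 hd
    have := Finset.mem_Icc.1 (hs hk)
    rw [Finset.mem_range]
    unfold gap
    omega
  rw [← Finset.sum_filter_add_sum_filter_not (Finset.Icc 1 n) (fun k => k ≤ a), two_mul]
  refine add_le_add (hinj _ (Finset.filter_subset _ _) ?_) (hinj _ (Finset.filter_subset _ _) ?_)
  · intro x hx y hy h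
    simp only [Finset.coe_filter, Set.mem_ofPred_eq, gap] at hx hy h
    omega
  · intro x hx y hy h
    simp only [Finset.coe_filter, Set.mem_ofPred_eq, gap] at hx hy h
    omega

theorem esrc_nrm_le_of_touch {n : ℕ} {e : Edge} (he : e ∈ touch (box n)) :
    nrm (esrc e) ≤ n ∧ nrm (etgt e) ≤ n := by
  rw [mem_touch, mem_box, mem_box] at he
  have l1 := nrm_etgt_le e
  have l2 := nrm_esrc_le e
  omega

/-- The differential inequality behind sharpness. -/
theorem mean_mul_one_sub_le {K K' : Coupling} (hK : K.Admissible) (hK' : K'.Admissible)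
    {h : ℝ} (hH : LocalHolley (tilt h (locW K)) (locW K')) (n : ℕ) (hT : touch (box (2 * n)) ⊆ T) :
    let ν := fkWeight (subSrc T) (subTgt T) (tilt h (locW K)) (box (2 * n))
    let f := forcedInd (subSrc T) (subTgt T) (box n) 0
    n * (mean ν f * (1 - mean ν f)) ≤
      8 * (∑ d ∈ Finset.range (n + 1), magnet K' d) * ∑ e, covEdge ν f e := by
  classical
  intro ν f
  have hw := (locW_isLocalWeight hK).tilt h
  have hν : IsLatticeWeight ν := hw.isLatticeWeight _
  have hf : Monotone f := forcedInd_monotone _ _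
  set M := ∑ d ∈ Finset.range (n + 1), magnet K' d with hM
  have hm0 := magnet_nonneg hK'.nonneg
  have hM0 : 0 ≤ M := Finset.sum_nonneg fun d _ => hm0 d
  have hstep : ∀ k ∈ Finset.Icc 1 n, mean ν f * (1 - mean ν f) ≤
      2 * ∑ e, mean ν (fun ω => if Reveals T n k ω e then 1 else 0) * covEdge ν f e := by
    intro k hk
    rw [Finset.mem_Icc] at hk
    convert osss_explore hν hf (fun ω => forcedInd_mem _ _ ω) (Reveals T n k)
      (fun ξ ω h e he => he.mono h e)
      (fun ξ ω h hd => forcedInd_eq_of_agree hk.1 hk.2 h hd)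
  -- The factor four: two endpoints, each with the factor two of `sum_gap_le`. The factor two of
  -- OSSS makes it eight.
  have hrev : ∀ e : T, ∑ k ∈ Finset.Icc 1 n,
      mean ν (fun ω => if Reveals T n k ω e then 1 else 0) ≤ 4 * M := by
    intro e
    by_cases he : e.1 ∈ touch (box n)
    · have hn := esrc_nrm_le_of_touch he
      calc ∑ k ∈ Finset.Icc 1 n, mean ν (fun ω => if Reveals T n k ω e then 1 else 0)
          ≤ ∑ k ∈ Finset.Icc 1 n,
              (magnet K' (gap (nrm (esrc e.1)) k) + magnet K' (gap (nrm (etgt e.1)) k)) := by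
            refine Finset.sum_le_sum fun k hk => ?_
            rw [Finset.mem_Icc] at hk
            refine le_trans ?_ (add_le_add
              (mean_forcedInd_offSphere_le hK hK' hH hk.1 hk.2 hn.1 hT)
              (mean_forcedInd_offSphere_le hK hK' hH hk.1 hk.2 hn.2 hT))
            rw [← mean_add]
            refine mean_mono (fun ω => (hν.pos ω).le) fun ω => ?_
            have a1 := forcedInd_nonneg (src := subSrc T) (tgt := subTgt T)
              (offSphere n k) (esrc e.1) ω
            have a2 := forcedInd_nonneg (src := subSrc T) (tgt := subTgt T)
              (offSphere n k) (etgt e.1) ω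
            split_ifs with hr
            · rcases hr.2 with h1 | h1
              · have : forcedInd (subSrc T) (subTgt T) (offSphere n k) (esrc e.1) ω = 1 :=
                  if_pos h1
                linarith
              · have : forcedInd (subSrc T) (subTgt T) (offSphere n k) (etgt e.1) ω = 1 :=
                  if_pos h1
                linarith
            · linarith
        _ ≤ 4 * M := by
            rw [Finset.sum_add_distrib]
            have := sum_gap_le hm0 hn.1
            have := sum_gap_le hm0 hn.2
            linarith
    · have : ∀ k, mean ν (fun ω => if Reveals T n k ω e then (1 : ℝ) else 0) = 0 := fun k => by
        have h0 : (fun ω => if Reveals T n k ω e then (1 : ℝ) else 0) = fun ω => 0 * (1 : ℝ) :=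
          funext fun ω => by rw [if_neg fun hr => he hr.1, zero_mul]
        rw [h0, mean_const_mul, zero_mul]
      simp only [this, Finset.sum_const_zero]
      linarith
  calc n * (mean ν f * (1 - mean ν f))
      = ∑ k ∈ Finset.Icc 1 n, mean ν f * (1 - mean ν f) := by
        rw [Finset.sum_const, Nat.card_Icc, nsmul_eq_mul]; simp
    _ ≤ ∑ k ∈ Finset.Icc 1 n,
        2 * ∑ e, mean ν (fun ω => if Reveals T n k ω e then 1 else 0) * covEdge ν f e :=
        Finset.sum_le_sum hstep
    _ = 2 * ∑ e, (∑ k ∈ Finset.Icc 1 n,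
        mean ν (fun ω => if Reveals T n k ω e then 1 else 0)) * covEdge ν f e := by
        rw [← Finset.mul_sum, Finset.sum_comm]
        simp only [Finset.sum_mul]
    _ ≤ 2 * ∑ e, (4 * M) * covEdge ν f e := by
        refine mul_le_mul_of_nonneg_left (Finset.sum_le_sum fun e _ => ?_) (by norm_num)
        exact mul_le_mul_of_nonneg_right (hrev e) (covEdge_nonneg hν hf e)
    _ = _ := by rw [← Finset.mul_sum]; ring

/-- Grönwall's argument: `G h * exp (-c h)` is nondecreasing. -/
theorem le_mul_exp_of_hasDerivAt {G G' : ℝ → ℝ} {c H : ℝ} (hH : 0 ≤ H)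
    (hG : ∀ h, HasDerivAt G (G' h) h) (hineq : ∀ h, 0 ≤ h → h ≤ H → c * G h ≤ G' h) :
    G 0 ≤ G H * Real.exp (-(c * H)) := by
  have hd : ∀ h, HasDerivAt (fun h => G h * Real.exp (-(c * h)))
      (G' h * Real.exp (-(c * h)) + G h * (Real.exp (-(c * h)) * -(c * 1))) h :=
    fun h => (hG h).mul (((hasDerivAt_id h).const_mul c).neg.exp)
  have hmono : MonotoneOn (fun h => G h * Real.exp (-(c * h))) (Set.Icc 0 H) := by
    refine monotoneOn_of_deriv_nonneg (convex_Icc 0 H)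
      (fun h _ => (hd h).continuousAt.continuousWithinAt)
      (fun h _ => (hd h).differentiableAt.differentiableWithinAt) fun h hh => ?_
    rw [interior_Icc] at hh
    rw [(hd h).deriv]
    have := mul_le_mul_of_nonneg_right (hineq h hh.1.le hh.2.le) (Real.exp_pos (-(c * h))).le
    linarith
  have := hmono (Set.left_mem_Icc.2 hH) (Set.right_mem_Icc.2 hH) hH
  simpa using this

/-- Integrated form of the differential inequality. -/
theorem magnet_two_mul_le {K : Coupling} (hK : K.Admissible) {κ : ℝ} (hκ0 : 0 < κ)
    (hκ3 : κ ≤ 2 * K.k₃) (hκ1 : K.k₁ = K.k₃ ∨ κ ≤ K.k₁ - K.k₃) {b b' : ℝ} (hb : 0 < b)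
    (hbb : b ≤ b') (n : ℕ) (hn : magnet (K.scale b') n ≤ 1 / 2) :
    magnet (K.scale b) (2 * n) ≤ magnet (K.scale b') n * Real.exp (-(κ / 16 * (b' - b) *
      (n / ∑ d ∈ Finset.range (n + 1), magnet (K.scale b') d))) := by
  have hA := hK.scale hb
  have hA' := hK.scale (hb.trans_le hbb)
  obtain ⟨T, hT⟩ : ∃ T, T = touch (box (2 * n)) := ⟨_, rfl⟩
  set f := forcedInd (subSrc T) (subTgt T) (box n) 0 with hf
  set M := ∑ d ∈ Finset.range (n + 1), magnet (K.scale b') d with hM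
  set G : ℝ → ℝ := fun h =>
    mean (fkWeight (subSrc T) (subTgt T) (tilt h (locW (K.scale b))) (box (2 * n))) f with hG
  set H := κ * (b' - b) with hHdef
  have hH0 : 0 ≤ H := mul_nonneg hκ0.le (sub_nonneg.2 hbb)
  have hsub : box n ⊆ box (2 * n) := box_mono (by omega)
  -- Throughout the range of `h` the tilted measure at `b` is dominated by the measure at `b'`, and
  -- shrinking the volume to `box n` only helps.
  have hbound : ∀ h, 0 ≤ h → h ≤ H → G h ≤ magnet (K.scale b') n := fun h h0 h1 => by
    have hw := (locW_isLocalWeight hA).tilt h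
    have hw' := locW_isLocalWeight hA'
    have := mean_fkWeight_le (src := subSrc T) (tgt := subTgt T) hw.nonneg hw.diag_pos hw'.nonneg
      hw'.diag_pos (localHolley_tilt hK hκ3 hκ1 hb hbb h0 h1) hsub
      (forcedInd_monotone (src := subSrc T) (tgt := subTgt T) (box n) 0)
    rw [← gibbs_spin_eq, gibbs_eq_state _ ((touch_mono hsub).trans hT.ge)] at this
    exact this
  have hderiv : ∀ h, HasDerivAt G
      (∑ e, covEdge (fkWeight (subSrc T) (subTgt T) (tilt h (locW (K.scale b))) (box (2 * n))) f e)
      h := fun h => hasDerivAt_mean_tilt (locW_isLocalWeight hA) _ f h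
  have hG0 : ∀ h, 0 ≤ G h := fun h => by
    have hw := (locW_isLocalWeight hA).tilt h
    have := mean_mono (fun ω => (fkWeight_pos (src := subSrc T) (tgt := subTgt T) hw.nonneg
      hw.diag_pos (box (2 * n)) ω).le) (f := fun _ => 0 * 1) (g := f)
      (fun ω => by rw [zero_mul]; exact forcedInd_nonneg _ _ ω)
    rwa [mean_const_mul, zero_mul] at this
  have hMpos : 0 < M := by
    have h0 : magnet (K.scale b') 0 = 1 := by
      have : ∀ A ∈ minusIn (box 0), (fun A : Minus => spin A.1 0) A = 1 := fun A hA => by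
        have h1 : (0 : Site) ∉ A.1 := fun h => by
          have := (mem_minusIn.1 hA).1 h
          rw [mem_box] at this
          omega
        simp [spin, h1]
      unfold magnet state
      rw [gibbs_congr _ _ _ this, gibbs_const]
    refine lt_of_lt_of_le ?_ (Finset.single_le_sum (f := fun d => magnet (K.scale b') d)
      (fun d _ => magnet_nonneg hA'.nonneg d) (Finset.mem_range.2 (Nat.succ_pos n)))
    simp only [h0]
    exact zero_lt_one
  -- The constant eight of the differential inequality, doubled because `1 - G h ≥ 1 / 2`.
  set c := (n : ℝ) / (16 * M) with hc
  have hineq : ∀ h, 0 ≤ h → h ≤ H → c * G h ≤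
      ∑ e, covEdge (fkWeight (subSrc T) (subTgt T) (tilt h (locW (K.scale b))) (box (2 * n))) f e :=
    fun h h0 h1 => by
      have key := mean_mul_one_sub_le (T := T) hA hA' (localHolley_tilt hK hκ3 hκ1 hb hbb h0 h1) n hT.ge
      simp only at key
      change n * (G h * (1 - G h)) ≤ _ at key
      have h2 := (hbound h h0 h1).trans hn
      have h3 : (n : ℝ) * (G h * (1 / 2)) ≤ n * (G h * (1 - G h)) := by
        have := hG0 h
        gcongr
        linarith
      rw [hc, div_mul_eq_mul_div, div_le_iff₀ (by positivity)]
      linarith [h3.trans key]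
  have h0H := le_mul_exp_of_hasDerivAt hH0 hderiv hineq
  have hstart : magnet (K.scale b) (2 * n) ≤ G 0 := by
    have hw := locW_isLocalWeight hA
    have h1 : magnet (K.scale b) (2 * n) = mean (fkWeight (subSrc T) (subTgt T)
        (locW (K.scale b)) (box (2 * n))) (forcedInd (subSrc T) (subTgt T) (box (2 * n)) 0) := by
      rw [← gibbs_spin_eq, gibbs_eq_state _ hT.ge]; rfl
    rw [h1, hG]
    simp only [tilt_zero]
    exact mean_mono (fun ω => (fkWeight_pos hw.nonneg hw.diag_pos _ ω).le)
      fun ω => forcedInd_anti hsub 0 ω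
  refine hstart.trans (h0H.trans ?_)
  have e : -(κ / 16 * (b' - b) * (n / M)) = -(c * H) := by
    rw [hc, hHdef]; field_simp
  rw [e]
  exact mul_le_mul_of_nonneg_right (hbound H hH0 le_rfl) (Real.exp_pos _).le

end Exploration

/-! ### From the integrated inequality to exponential decay. -/

section Sharpness

/-- A family satisfying the inequality obtained from exploration arguments. -/
structure SharpFamily (m : ℝ → ℕ → ℝ) (c : ℝ) : Prop where
  rate_pos : 0 < c
  nonneg : ∀ b n, 0 < b → 0 ≤ m b n
  at_zero : ∀ b, 0 < b → m b 0 = 1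
  anti : ∀ b, 0 < b → Antitone (m b)
  mono : ∀ b b' n, 0 < b → b ≤ b' → m b n ≤ m b' n
  decay : ∀ b b' n, 0 < b → b ≤ b' → m b' n ≤ 1 / 2 →
    m b (2 * n) ≤ Real.exp (-(c * (b' - b) * (n / ∑ d ∈ Finset.range (n + 1), m b' d)))

variable {m : ℝ → ℕ → ℝ} {c : ℝ}

/-- Partial sums of the family. -/
def partialSum (m : ℝ → ℕ → ℝ) (b : ℝ) (n : ℕ) : ℝ := ∑ d ∈ Finset.range (n + 1), m b d

namespace SharpFamily

theorem one_le_partialSum (hm : SharpFamily m c) {b : ℝ} (hb : 0 < b) (n : ℕ) :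
    1 ≤ partialSum m b n := by
  rw [← hm.at_zero b hb]
  exact Finset.single_le_sum (f := m b) (fun d _ => hm.nonneg b d hb)
    (Finset.mem_range.2 (Nat.succ_pos n))

theorem partialSum_mono (hm : SharpFamily m c) {b : ℝ} (hb : 0 < b) {n n' : ℕ} (h : n ≤ n') :
    partialSum m b n ≤ partialSum m b n' :=
  Finset.sum_le_sum_of_subset_of_nonneg (Finset.range_subset_range.2 (by omega))
    fun d _ _ => hm.nonneg b d hb

theorem partialSum_mono_left (hm : SharpFamily m c) {b b' : ℝ} (hb : 0 < b) (hbb : b ≤ b')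
    (n : ℕ) : partialSum m b n ≤ partialSum m b' n :=
  Finset.sum_le_sum fun d _ => hm.mono b b' d hb hbb

/-- The terms beyond `n` are at most `m b n`; this carries the bound on averages from one dyadic
scale to the next. -/
theorem partialSum_two_mul (hm : SharpFamily m c) {b : ℝ} (hb : 0 < b) (n : ℕ) :
    partialSum m b (2 * n) ≤ partialSum m b n + n * m b n := by
  unfold partialSum
  have : 2 * n + 1 = (n + 1) + n := by ring
  rw [this, Finset.sum_range_add]
  have h2 : ∑ x ∈ Finset.range n, m b (n + 1 + x) ≤ ∑ _x ∈ Finset.range n, m b n :=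
    Finset.sum_le_sum fun x _ => hm.anti b hb (by omega)
  rw [Finset.sum_const, Finset.card_range, nsmul_eq_mul] at h2
  linarith

theorem le_exp_of_partialSum_le (hm : SharpFamily m c) {b b' S : ℝ} (hb : 0 < b) (hbb : b ≤ b')
    {n : ℕ} (hn : m b' n ≤ 1 / 2) (hS : partialSum m b' n ≤ S) :
    m b (2 * n) ≤ Real.exp (-(c * (b' - b) * (n / S))) := by
  refine (hm.decay b b' n hb hbb hn).trans (Real.exp_le_exp.2 (neg_le_neg ?_))
  have h1 := hm.one_le_partialSum (hb.trans_le hbb) n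
  have h2 : 0 ≤ c * (b' - b) := mul_nonneg hm.rate_pos.le (sub_nonneg.2 hbb)
  exact mul_le_mul_of_nonneg_left
    (div_le_div_of_nonneg_left (Nat.cast_nonneg n) (lt_of_lt_of_le one_pos h1) hS) h2

theorem exp_neg_le_sq {x : ℝ} (hx : 0 < x) : Real.exp (-x) ≤ 2 / x ^ 2 := by
  have := Real.quadratic_le_exp_of_nonneg hx.le
  rw [Real.exp_neg, inv_eq_one_div, div_le_div_iff₀ (Real.exp_pos x) (by positivity)]
  nlinarith

theorem exp_neg_le_cube {x : ℝ} (hx : 0 < x) : Real.exp (-x) ≤ 6 / x ^ 3 := by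
  have := Real.pow_div_factorial_le_exp x hx.le 3
  rw [Real.exp_neg, inv_eq_one_div, div_le_div_iff₀ (Real.exp_pos x) (by positivity)]
  simp only [Nat.factorial] at this
  push_cast at this
  rw [div_le_iff₀ (by norm_num)] at this
  linarith

/-- First stage: power decay of the averages along dyadic scales. -/
theorem dyadic_decay (hm : SharpFamily m c) {b δ ε : ℝ} (hδ : 0 < δ) (hb : δ < b) (hε : 0 < ε)
    (hεδ : ε ≤ 3 * (c * δ) ^ 2 / 1024) (hε1 : ε ≤ 1) {j₀ : ℕ}
    (hA : partialSum m b (2 ^ j₀) ≤ ε * 2 ^ j₀) (ha : m b (2 ^ j₀) ≤ ε / 2) (i : ℕ) :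
    partialSum m (b - δ * (1 - (7 / 8) ^ i)) (2 ^ (j₀ + i)) ≤ ε * (3 / 4) ^ i * 2 ^ (j₀ + i) ∧
      m (b - δ * (1 - (7 / 8) ^ i)) (2 ^ (j₀ + i)) ≤ ε / 2 * (3 / 4) ^ i := by
  have hc := hm.rate_pos
  induction i with
  | zero => simpa using ⟨hA, ha⟩
  | succ i ih =>
    obtain ⟨ih1, ih2⟩ := ih
    set b₁ := b - δ * (1 - (7 / 8) ^ i) with hb₁
    set b₂ := b - δ * (1 - (7 / 8) ^ (i + 1)) with hb₂
    have hμ : (0 : ℝ) < (7 / 8) ^ i := by positivity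
    -- The decrements of the inverse temperature form a geometric series of total `δ`.
    have hdiff : b₁ - b₂ = δ / 8 * (7 / 8) ^ i := by rw [hb₁, hb₂, pow_succ]; ring
    have hb₂0 : 0 < b₂ := by
      rw [hb₂]
      have : (0 : ℝ) < (7 / 8) ^ (i + 1) := by positivity
      nlinarith
    have hb21 : b₂ ≤ b₁ := by
      have : 0 ≤ δ / 8 * (7 / 8) ^ i := by positivity
      linarith
    have hb₁0 : 0 < b₁ := hb₂0.trans_le hb21
    have h34 : (0 : ℝ) < (3 / 4) ^ i := by positivity
    have hpow : (2 : ℕ) ^ (j₀ + (i + 1)) = 2 * 2 ^ (j₀ + i) := by rw [← add_assoc, pow_succ]; ring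
    have h2 : (0 : ℝ) < 2 ^ (j₀ + i) := by positivity
    refine ⟨?_, ?_⟩
    · rw [hpow]
      have e1 := hm.partialSum_two_mul hb₂0 (2 ^ (j₀ + i))
      have e2 := hm.partialSum_mono_left hb₂0 hb21 (2 ^ (j₀ + i))
      have e3 := hm.mono b₂ b₁ (2 ^ (j₀ + i)) hb₂0 hb21
      push_cast at e1
      have e4 : (2 : ℝ) ^ (j₀ + i) * m b₂ (2 ^ (j₀ + i)) ≤
          2 ^ (j₀ + i) * (ε / 2 * (3 / 4) ^ i) := by
        gcongr; exact e3.trans ih2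
      -- The ratio `3 / 4` is forced: the old sum plus half of it is `3 / 2` times the old sum, over
      -- twice the length.
      have e5 : ε * (3 / 4) ^ (i + 1) * (2 : ℝ) ^ (j₀ + (i + 1)) =
          ε * (3 / 4) ^ i * 2 ^ (j₀ + i) + 2 ^ (j₀ + i) * (ε / 2 * (3 / 4) ^ i) := by
        rw [← add_assoc, pow_succ, pow_succ]; ring
      rw [e5]
      linarith
    · rw [hpow]
      have hle1 : m b₁ (2 ^ (j₀ + i)) ≤ 1 / 2 := by
        refine ih2.trans ?_
        have : (3 / 4 : ℝ) ^ i ≤ 1 := pow_le_one₀ (by norm_num) (by norm_num)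
        nlinarith
      refine (hm.le_exp_of_partialSum_le hb₂0 hb21 hle1 ih1).trans ?_
      have hx : c * (b₁ - b₂) * (((2 ^ (j₀ + i) : ℕ) : ℝ) / (ε * (3 / 4) ^ i * 2 ^ (j₀ + i))) =
          c * δ / 8 * (7 / 8) ^ i / (ε * (3 / 4) ^ i) := by
        rw [hdiff]; push_cast; field_simp
      rw [hx]
      refine (exp_neg_le_sq (by positivity)).trans ?_
      -- Here `(7 / 8) ^ 2 = 49 / 64` exceeds `3 / 4 = 48 / 64`: the decrements shrink slowly enough
      -- for the quadratic bound on the exponential to close the induction. The constant `3 / 1024`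
      -- collects the numerical factors.
      have hq : ((3 : ℝ) / 4) ^ i ≤ ((7 / 8) ^ i) ^ 2 := by
        rw [← pow_mul, mul_comm i 2, pow_mul]
        exact pow_le_pow_left₀ (by norm_num) (by norm_num) i
      rw [div_pow, div_div_eq_mul_div, div_le_iff₀ (by positivity)]
      have e6 : ε * (ε * (3 / 4) ^ i) ≤ 3 * (c * δ) ^ 2 / 1024 * (ε * ((7 / 8) ^ i) ^ 2) := by
        gcongr
      calc 2 * (ε * (3 / 4) ^ i) ^ 2 = 2 * (3 / 4) ^ i * (ε * (ε * (3 / 4) ^ i)) := by ring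
        _ ≤ 2 * (3 / 4) ^ i * (3 * (c * δ) ^ 2 / 1024 * (ε * ((7 / 8) ^ i) ^ 2)) := by gcongr
        _ = ε / 2 * (3 / 4) ^ (i + 1) * (c * δ / 8 * (7 / 8) ^ i) ^ 2 := by rw [pow_succ]; ring

/-- Second stage: boundedness of the partial sums. -/
theorem exists_partialSum_bound (hm : SharpFamily m c) {b δ ε : ℝ} (hδ : 0 < δ) (hb : 2 * δ < b)
    (hε : 0 < ε) (hεδ : ε ≤ 3 * (c * δ) ^ 2 / 1024) (hε1 : ε ≤ 1) {j₀ : ℕ}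
    (hA : partialSum m b (2 ^ j₀) ≤ ε * 2 ^ j₀) (ha : m b (2 ^ j₀) ≤ ε / 2) :
    ∃ S, 0 < S ∧ ∀ n, partialSum m (b - 2 * δ) n ≤ S := by
  have hc := hm.rate_pos
  have hb2 : 0 < b - 2 * δ := by linarith
  have hb1 : 0 < b - δ := by linarith
  have hstage : ∀ i : ℕ, m (b - 2 * δ) (2 ^ (j₀ + 1 + i)) ≤
      6 * (ε / (c * δ)) ^ 3 * (27 / 64) ^ i := fun i => by
    obtain ⟨h1, h2⟩ := hm.dyadic_decay hδ (by linarith) hε hεδ hε1 hA ha i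
    have hle : b - δ ≤ b - δ * (1 - (7 / 8) ^ i) := by
      have : (0 : ℝ) < (7 / 8) ^ i := by positivity
      nlinarith
    have h3 := (hm.partialSum_mono_left hb1 hle (2 ^ (j₀ + i))).trans h1
    have h4 : m (b - δ) (2 ^ (j₀ + i)) ≤ 1 / 2 := by
      refine ((hm.mono _ _ _ hb1 hle).trans h2).trans ?_
      have : (3 / 4 : ℝ) ^ i ≤ 1 := pow_le_one₀ (by norm_num) (by norm_num)
      nlinarith
    have hpow : (2 : ℕ) ^ (j₀ + 1 + i) = 2 * 2 ^ (j₀ + i) := by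
      rw [show j₀ + 1 + i = (j₀ + i) + 1 by ring, pow_succ]; ring
    rw [hpow]
    refine (hm.le_exp_of_partialSum_le hb2 (by linarith) h4 h3).trans ?_
    have h34 : (0 : ℝ) < (3 / 4) ^ i := by positivity
    have h2' : (0 : ℝ) < 2 ^ (j₀ + i) := by positivity
    have hx : c * (b - δ - (b - 2 * δ)) *
        (((2 ^ (j₀ + i) : ℕ) : ℝ) / (ε * (3 / 4) ^ i * 2 ^ (j₀ + i))) =
        c * δ / (ε * (3 / 4) ^ i) := by
      push_cast; field_simp; ring
    rw [hx]
    -- The cube is needed: `(3 / 4) ^ 3 = 27 / 64` is below `1 / 2`, so the dyadic blocks `2 ^ i *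
    -- m` are summable, whereas `(3 / 4) ^ 2` is above `1 / 2`.
    refine (exp_neg_le_cube (by positivity)).trans (le_of_eq ?_)
    have : ((27 : ℝ) / 64) ^ i = ((3 / 4) ^ i) ^ 3 := by
      rw [← pow_mul, mul_comm i 3, pow_mul]; norm_num
    rw [this]
    field_simp
  -- Chosen so that `D * (1 - 27 / 32)` is the bound on the first dyadic block; the induction below
  -- sums the geometric series.
  set D : ℝ := 32 / 5 * 2 ^ (j₀ + 1) * (6 * (ε / (c * δ)) ^ 3) with hD
  have hD0 : 0 < D := by positivity
  have hind : ∀ i : ℕ, partialSum m (b - 2 * δ) (2 ^ (j₀ + 1 + i)) ≤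
      partialSum m (b - 2 * δ) (2 ^ (j₀ + 1)) + D - D * (27 / 32) ^ i := fun i => by
    induction i with
    | zero => simp
    | succ i ih =>
      have hpow : (2 : ℕ) ^ (j₀ + 1 + (i + 1)) = 2 * 2 ^ (j₀ + 1 + i) := by
        rw [← add_assoc, pow_succ]; ring
      rw [hpow]
      refine (hm.partialSum_two_mul hb2 _).trans ?_
      have h1 := hstage i
      have h2 : ((2 ^ (j₀ + 1 + i) : ℕ) : ℝ) * m (b - 2 * δ) (2 ^ (j₀ + 1 + i)) ≤
          5 / 32 * D * (27 / 32) ^ i := by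
        push_cast
        calc (2 : ℝ) ^ (j₀ + 1 + i) * m (b - 2 * δ) (2 ^ (j₀ + 1 + i))
            ≤ 2 ^ (j₀ + 1 + i) * (6 * (ε / (c * δ)) ^ 3 * (27 / 64) ^ i) := by gcongr
          _ = 5 / 32 * D * (27 / 32) ^ i := by
            have : ((27 : ℝ) / 32) ^ i = 2 ^ i * (27 / 64) ^ i := by rw [← mul_pow]; norm_num
            rw [this, hD, pow_add 2 (j₀ + 1) i]
            ring
      have h3 : D * (27 / 32 : ℝ) ^ (i + 1) = D * (27 / 32) ^ i - 5 / 32 * D * (27 / 32) ^ i := by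
        rw [pow_succ]; ring
      rw [h3]
      linarith
  have hp1 := hm.one_le_partialSum hb2 (2 ^ (j₀ + 1))
  refine ⟨partialSum m (b - 2 * δ) (2 ^ (j₀ + 1)) + D, by linarith, fun n => ?_⟩
  have hn : n ≤ 2 ^ (j₀ + 1 + n) := (Nat.lt_two_pow_self).le.trans
    (Nat.pow_le_pow_right (by norm_num) (by omega))
  refine (hm.partialSum_mono hb2 hn).trans ((hind n).trans ?_)
  have : 0 < D * (27 / 32 : ℝ) ^ n := by positivity
  linarith

/-- A Cesàro argument: past `N` the terms are below `ε / 2`, and a long enough range absorbs the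
first `N` terms into the other half. -/
theorem exists_dyadic_start {b ε : ℝ} (hε : 0 < ε)
    (h0 : Tendsto (m b) atTop (𝓝 0)) :
    ∃ j₀ : ℕ, partialSum m b (2 ^ j₀) ≤ ε * 2 ^ j₀ ∧ m b (2 ^ j₀) ≤ ε / 2 := by
  obtain ⟨N, hN⟩ := (h0.eventually (gt_mem_nhds (half_pos hε))).exists_forall_of_atTop
  have hbound : ∀ n, partialSum m b (N + n) ≤ partialSum m b N + n * (ε / 2) := fun n => by
    induction n with
    | zero => simp
    | succ n ih =>
      have : partialSum m b (N + (n + 1)) = partialSum m b (N + n) + m b (N + n + 1) := by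
        unfold partialSum
        rw [← add_assoc, Finset.sum_range_succ]
      rw [this]
      have := (hN (N + n + 1) (by omega)).le
      push_cast
      linarith
  obtain ⟨k, hk⟩ := exists_nat_ge (partialSum m b N / (ε / 2))
  rw [div_le_iff₀ (half_pos hε)] at hk
  set j₀ := N + k with hj
  have h1 : N + k ≤ 2 ^ j₀ := Nat.lt_two_pow_self.le
  refine ⟨j₀, ?_, (hN _ (by omega)).le⟩
  obtain ⟨n, hn⟩ : ∃ n, 2 ^ j₀ = N + n := ⟨2 ^ j₀ - N, by omega⟩
  have h2 := hbound n
  rw [← hn] at h2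
  have h3 : (k : ℝ) ≤ 2 ^ j₀ := by exact_mod_cast (by omega : k ≤ 2 ^ j₀)
  have h4 : (n : ℝ) ≤ 2 ^ j₀ := by exact_mod_cast (by omega : n ≤ 2 ^ j₀)
  nlinarith

/-- If the limit vanishes at `b'`, there is exponential decay at every `b < b'`. -/
theorem exp_decay (hm : SharpFamily m c) {b b' : ℝ} (hb : 0 < b) (hbb : b < b')
    (h0 : Tendsto (m b') atTop (𝓝 0)) (h1 : m b 1 < 1) :
    ∃ r, 0 < r ∧ ∀ n : ℕ, m b n ≤ Real.exp (-(r * n)) := by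
  have hc := hm.rate_pos
  have hb' : 0 < b' := hb.trans hbb
  -- Two thirds of the interval go to the two stages bounding the partial sums, and the last third
  -- to one more use of the integrated inequality.
  set δ := (b' - b) / 3 with hδ
  have hδ0 : 0 < δ := by rw [hδ]; linarith
  set ε := min 1 (3 * (c * δ) ^ 2 / 1024) with hε
  have hε0 : 0 < ε := lt_min one_pos (by positivity)
  obtain ⟨j₀, hA, ha⟩ := exists_dyadic_start hε0 h0
  obtain ⟨S, hS0, hS⟩ := hm.exists_partialSum_bound hδ0 (by rw [hδ]; linarith) hε0
    (min_le_right _ _) (min_le_left _ _) hA ha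
  have hb3 : b ≤ b' - 2 * δ := by rw [hδ]; linarith
  have hb30 : 0 < b' - 2 * δ := hb.trans_le hb3
  obtain ⟨N, hN⟩ := (h0.eventually (gt_mem_nhds (by norm_num : (0 : ℝ) < 1 / 2))).exists_forall_of_atTop
  have hlarge : ∀ n, N ≤ n → m b (2 * n) ≤ Real.exp (-(c * δ / S * n)) := fun n hn => by
    have h2 : m (b' - 2 * δ) n ≤ 1 / 2 :=
      (hm.mono _ _ n hb30 (by linarith)).trans (hN n hn).le
    refine (hm.le_exp_of_partialSum_le hb hb3 h2 (hS n)).trans (le_of_eq ?_)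
    congr 2
    have : b' - 2 * δ - b = δ := by rw [hδ]; ring
    rw [this]
    field_simp
  -- The finitely many small `n` are handled by `m b n ≤ m b 1 < 1`; the maximum with `1 / 2` keeps
  -- the logarithm defined.
  set q := max (m b 1) (1 / 2) with hq
  have hq0 : 0 < q := lt_max_of_lt_right (by norm_num)
  have hq1 : q < 1 := max_lt h1 (by norm_num)
  have hlog : 0 < -Real.log q := neg_pos.2 (Real.log_neg hq0 hq1)
  set r := min (c * δ / S / 4) (-Real.log q / (2 * N + 2)) with hr
  have hr0 : 0 < r := lt_min (by positivity) (by positivity)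
  refine ⟨r, hr0, fun n => ?_⟩
  rcases Nat.eq_zero_or_pos n with rfl | hn
  · rw [hm.at_zero b hb]; simp
  rcases le_or_gt n (2 * N + 1) with h2 | h2
  · have e1 : m b n ≤ q := (hm.anti b hb hn).trans (le_max_left _ _)
    have e2 : q = Real.exp (-(-Real.log q)) := by rw [neg_neg, Real.exp_log hq0]
    rw [e2] at e1
    refine e1.trans (Real.exp_le_exp.2 (neg_le_neg ?_))
    have e3 : r ≤ -Real.log q / (2 * N + 2) := min_le_right _ _
    rw [le_div_iff₀ (by positivity)] at e3
    have e4 : (n : ℝ) ≤ 2 * N + 2 := by exact_mod_cast (by omega : n ≤ 2 * N + 2)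
    nlinarith
  · have e1 := hlarge (n / 2) (by omega)
    have e2 : m b n ≤ m b (2 * (n / 2)) := hm.anti b hb (by omega)
    refine e2.trans (e1.trans (Real.exp_le_exp.2 (neg_le_neg ?_)))
    have e3 : (n : ℝ) ≤ 4 * ((n / 2 : ℕ) : ℝ) := by exact_mod_cast (by omega : n ≤ 4 * (n / 2))
    have e4 : r ≤ c * δ / S / 4 := min_le_left _ _
    have e5 : 0 ≤ c * δ / S := by positivity
    calc r * n ≤ c * δ / S / 4 * (4 * ((n / 2 : ℕ) : ℝ)) := by gcongr
      _ = _ := by ring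

end SharpFamily

theorem magnet_zero (K : Coupling) : magnet K 0 = 1 := by
  have : ∀ A ∈ minusIn (box 0), (fun A : Minus => spin A.1 0) A = 1 := fun A hA => by
    have h1 : (0 : Site) ∉ A.1 := fun h => by
      have := (mem_minusIn.1 hA).1 h
      rw [mem_box] at this
      omega
    simp [spin, h1]
  unfold magnet state
  rw [gibbs_congr _ _ _ this, gibbs_const]

theorem magnet_one_lt (K : Coupling) : magnet K 1 < 1 := by
  unfold magnet state gibbs
  rw [div_lt_one (sum_boltz_pos _ _ _)]
  have h0 : (0 : Site) ∈ box 1 := mem_box.2 (by rw [nrm_zero]; norm_num)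
  refine Finset.sum_lt_sum (fun A _ => mul_le_of_le_one_left (boltz_pos _ _ _).le (spin_le_one _ _))
    ⟨({0}, ∅), mem_minusIn.2 ⟨by simpa using h0, by simp⟩, ?_⟩
  have := boltz_pos K (touch (box 1)) ({0}, ∅)
  simp only [spin, Finset.mem_singleton, if_true]
  linarith

theorem exists_sharpFamily {K : Coupling} (hK : K.Admissible) :
    ∃ c, SharpFamily (fun b => magnet (K.scale b)) c := by
  obtain ⟨κ, hκ0, hκ3, hκ1⟩ := exists_tilt_rate hK
  refine ⟨κ / 16, by positivity, fun b n hb => magnet_nonneg (hK.scale hb).nonneg n,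
    fun b _ => magnet_zero _, fun b hb => magnet_anti (hK.scale hb).nonneg,
    fun b b' n hb hbb => magnet_mono hK.nonneg hb.le hbb n, fun b b' n hb hbb hn => ?_⟩
  exact (magnet_two_mul_le hK hκ0 hκ3 hκ1 hb hbb n hn).trans
    (mul_le_of_le_one_left (Real.exp_pos _).le (magnet_le_one _ _))

/-- Sharpness for the magnetisation of the first layer. -/
theorem magnet_exp_decay {K : Coupling} (hK : K.Admissible) {b b' : ℝ} (hb : 0 < b) (hbb : b < b')
    (h0 : Tendsto (magnet (K.scale b')) atTop (𝓝 0)) :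
    ∃ r, 0 < r ∧ ∀ n : ℕ, magnet (K.scale b) n ≤ Real.exp (-(r * n)) := by
  obtain ⟨c, hc⟩ := exists_sharpFamily hK
  exact hc.exp_decay hb hbb h0 (magnet_one_lt _)

end Sharpness

/-! ### Vanishing magnetisation at small inverse temperature. -/

section HighTemperature

/-- The local weight of an open edge of the first layer. -/
def openRatio (K : Coupling) : ℝ :=
  (locW K true false + locW K true true) / locW K false false

theorem card_incident_le (T : Finset Edge) (x : Site) :
    (Finset.univ.filter fun e : T => subSrc T e = x ∨ subTgt T e = x).card ≤ 4 := by
  classical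
  set S : Finset Edge := {(x, false), (x, true), (x - (1, 0), false), (x - (0, 1), true)} with hS
  have hS4 : S.card ≤ 4 := Finset.card_le_four
  refine le_trans ?_ hS4
  refine Finset.card_le_card_of_injOn (fun e => e.1) (fun e he => ?_)
    (fun e _ e' _ h => Subtype.ext h)
  have he := (Finset.mem_filter.1 he).2
  obtain ⟨⟨v, d⟩, hT⟩ := e
  change v = x ∨ v + dirVec d = x at he
  simp only [hS, Finset.coe_insert, Finset.coe_singleton, Set.mem_insert_iff,
    Set.mem_singleton_iff, Prod.mk.injEq]
  cases d
  · rcases he with rfl | rfl <;> simp [dirVec]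
  · rcases he with rfl | rfl <;> simp [dirVec]

theorem nrm_otherEnd_le {T : Finset Edge} (x : Site) (e : T)
    (he : subSrc T e = x ∨ subTgt T e = x) :
    nrm (otherEnd (subSrc T) (subTgt T) x e) ≤ nrm x + 1 := by
  unfold otherEnd
  split_ifs with h
  · rw [← h]; exact nrm_etgt_le e.1
  · rw [← he.resolve_left h]; exact nrm_esrc_le e.1

/-- Iterate `mean_forcedInd_le_sum`: a site at least `j` steps from the complement of the box allows
`j` iterations, each with at most four edges of cost `openRatio K`. -/
theorem gibbs_spin_le_pow {K : Coupling} (hK : K.Admissible) (n j : ℕ) (x : Site)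
    (hx : nrm x + j ≤ n) :
    gibbs K (touch (box n)) (box n) (fun A => spin A.1 x) ≤ (4 * openRatio K) ^ j := by
  have hw := locW_isLocalWeight hK
  have hq : 0 ≤ openRatio K :=
    div_nonneg (add_nonneg (hw.nonneg _ _) (hw.nonneg _ _)) (hw.nonneg _ _)
  induction j generalizing x with
  | zero =>
    have := gibbs_mono_fun K (touch (box n)) (box n) (f := fun A => spin A.1 x) (g := fun _ => 1)
      (fun A _ => spin_le_one _ _)
    rwa [gibbs_const] at this
  | succ j ih =>
    have hxI : x ∈ box n := mem_box.2 (by omega)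
    rw [gibbs_spin_eq]
    refine (mean_forcedInd_le_sum hw hxI).trans ?_
    rw [pow_succ', mul_assoc, mul_left_comm]
    refine mul_le_mul_of_nonneg_left ?_ hq
    refine (Finset.sum_le_card_nsmul _ _ ((4 * openRatio K) ^ j) fun e he => ?_).trans ?_
    · rw [← gibbs_spin_eq]
      have := nrm_otherEnd_le x e (Finset.mem_filter.1 he).2
      exact ih _ (by omega)
    · rw [nsmul_eq_mul]
      refine mul_le_mul_of_nonneg_right ?_ (by positivity)
      exact_mod_cast card_incident_le _ x

theorem tendsto_openRatio (K : Coupling) :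
    Tendsto (fun b => openRatio (K.scale b)) (𝓝 0) (𝓝 0) := by
  have hc : Continuous fun b => openRatio (K.scale b) := by
    unfold openRatio locW Coupling.scale
    refine Continuous.div (by fun_prop) (by fun_prop) fun b => (Real.exp_pos _).ne'
  have := hc.tendsto 0
  have h0 : openRatio (K.scale 0) = 0 := by simp [openRatio, locW, Coupling.scale]
  rwa [h0] at this

/-- The magnetisation vanishes at small inverse temperature. -/
theorem exists_magnet_tendsto_zero {K : Coupling} (hK : K.Admissible) :
    ∃ b, 0 < b ∧ Tendsto (magnet (K.scale b)) atTop (𝓝 0) := by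
  have h1 : ∀ᶠ b in 𝓝[>] (0 : ℝ), openRatio (K.scale b) < 1 / 8 :=
    ((tendsto_openRatio K).eventually (gt_mem_nhds (by norm_num))).filter_mono nhdsWithin_le_nhds
  obtain ⟨b, hb, hb0⟩ := (h1.and self_mem_nhdsWithin).exists
  have hb0 : 0 < b := hb0
  have hw := locW_isLocalWeight (hK.scale hb0)
  have hq : 0 ≤ openRatio (K.scale b) :=
    div_nonneg (add_nonneg (hw.nonneg _ _) (hw.nonneg _ _)) (hw.nonneg _ _)
  refine ⟨b, hb0, squeeze_zero (magnet_nonneg (hK.scale hb0).nonneg)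
    (fun n => gibbs_spin_le_pow (hK.scale hb0) n n 0 (by rw [nrm_zero]; omega))
    (tendsto_pow_atTop_nhds_zero_of_lt_one (by linarith) (by linarith))⟩

end HighTemperature

/-! ### Connected sets for a symmetric relation: existence, extent and counting. -/

section LinkedSets

variable {α : Type*} [DecidableEq α] (adj : α → α → Prop)

/-- `S` is closed under adjacency in `D`. -/
def ClosedIn (D S : Finset α) : Prop := S ⊆ D ∧ ∀ a ∈ S, ∀ b ∈ D, adj a b → b ∈ S

/-- `S` has no proper nonempty subset closed under adjacency. -/
def Linked (S : Finset α) : Prop := ∀ R, ClosedIn adj S R → R.Nonempty → R = S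

variable {adj}

theorem ClosedIn.trans {D S R : Finset α} (hS : ClosedIn adj D S) (hR : ClosedIn adj S R) :
    ClosedIn adj D R :=
  ⟨hR.1.trans hS.1, fun a ha b hb h => hR.2 a ha b (hS.2 a (hR.1 ha) b hb h) h⟩

theorem ClosedIn.sdiff (hsymm : ∀ a b, adj a b → adj b a) {S R : Finset α}
    (hR : ClosedIn adj S R) : ClosedIn adj S (S \ R) :=
  ⟨Finset.sdiff_subset, fun a ha b hb h => Finset.mem_sdiff.2 ⟨hb, fun hbR =>
    (Finset.mem_sdiff.1 ha).2 (hR.2 b hbR a (Finset.mem_sdiff.1 ha).1 (hsymm a b h))⟩⟩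

/-- A closed set of negative sign contains a linked closed set of negative sign. -/
theorem exists_linked_closedIn (hsymm : ∀ a b, adj a b → adj b a) {D : Finset α}
    (s : Finset α → ℝ) (hs : ∀ S R, R ⊆ S → s S = s R * s (S \ R))
    (hpm : ∀ S, s S = 1 ∨ s S = -1) (hD : s D = -1) :
    ∃ S, ClosedIn adj D S ∧ Linked adj S ∧ s S = -1 := by
  -- A closed set of sign `-1` with fewest elements: were it not linked, it would split into two
  -- closed pieces, and one of them would have sign `-1`.
  obtain ⟨S, ⟨hS, hS1⟩, hmin⟩ : ∃ S, (ClosedIn adj D S ∧ s S = -1) ∧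
      ∀ R, (ClosedIn adj D R ∧ s R = -1) → S.card ≤ R.card := by
    classical
    have hex : ∃ n, ∃ S, (ClosedIn adj D S ∧ s S = -1) ∧ S.card = n :=
      ⟨D.card, D, ⟨⟨subset_rfl, fun _ _ b hb _ => hb⟩, hD⟩, rfl⟩
    obtain ⟨S, hS, hc⟩ := Nat.find_spec hex
    exact ⟨S, hS, fun R hR => hc ▸ Nat.find_min' hex ⟨R, hR, rfl⟩⟩
  refine ⟨S, hS, fun R hR hRn => ?_, hS1⟩
  rcases hpm R with h | h
  · have h1 : s (S \ R) = -1 := by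
      have := hs S R hR.1
      rw [hS1, h, one_mul] at this
      exact this.symm
    have h2 := hmin _ ⟨hS.trans (hR.sdiff hsymm), h1⟩
    have h3 := Finset.card_sdiff_add_card_eq_card hR.1
    have := hRn.card_pos
    omega
  · exact Finset.eq_of_subset_of_card_le hR.1 (hmin _ ⟨hS.trans hR, h⟩)

/-- A linked set meets every value between two values of a function with unit steps. -/
theorem Linked.card_ge {S : Finset α} (hS : Linked adj S)
    {π : α → ℤ} (hπ : ∀ a b, adj a b → |π a - π b| ≤ 1) {a b : α} (ha : a ∈ S) (hb : b ∈ S) {k : ℕ}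
    (hk : π a + k ≤ π b) : k + 1 ≤ S.card := by
  have hsub : Finset.Icc (π a) (π b) ⊆ S.image π := fun t ht => by
    rw [Finset.mem_Icc] at ht
    by_contra hcon
    have hne : ∀ c ∈ S, π c ≠ t := fun c hc h => hcon (Finset.mem_image.2 ⟨c, hc, h⟩)
    -- If no element has value `t`, unit steps cannot cross `t`, so the part below `t` is closed and
    -- must be everything, including `b`.
    have h1 : S.filter (fun c => π c < t) = S := by
      refine hS _ ⟨Finset.filter_subset _ _, fun c hc d hd h => ?_⟩
        ⟨a, Finset.mem_filter.2 ⟨ha, lt_of_le_of_ne ht.1 (hne a ha)⟩⟩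
      have h2 := abs_le.1 (hπ c d h)
      have h3 := (Finset.mem_filter.1 hc).2
      have h4 := hne d hd
      exact Finset.mem_filter.2 ⟨hd, by omega⟩
    rw [← h1] at hb
    have := (Finset.mem_filter.1 hb).2
    omega
  have h1 := (Finset.card_le_card hsub).trans Finset.card_image_le
  rw [Int.card_Icc] at h1
  omega

/-- Counting linked sets through a given point. -/
theorem sum_linked_le {nb : α → Finset α} (hrefl : ∀ a, adj a a)
    (hnb : ∀ a b, adj a b → b ∈ nb a) {M : ℕ} (hM : ∀ a, (nb a).card ≤ M) (T : Finset α) (x : α)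
    (F : Finset (Finset α)) (hF : ∀ S ∈ F, S ⊆ T ∧ Linked adj S ∧ x ∈ S) :
    ∑ S ∈ F, ((1 / 2 : ℝ) ^ M) ^ S.card ≤ 1 := by
  set N : Finset α → Finset α := fun S => S.biUnion nb with hN
  have hSN : ∀ S, S ⊆ N S := fun S a ha =>
    Finset.mem_biUnion.2 ⟨a, ha, hnb a a (hrefl a)⟩
  have hNc : ∀ S, (N S).card ≤ S.card * M := fun S =>
    Finset.card_biUnion_le_card_mul _ _ _ fun a _ => hM a
  -- Site percolation with parameter `1 / 2`: `W S` consists of the subsets of `T` in which `S` is a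
  -- full component. Since `S` contains `x`, these families are disjoint, and each has at least the
  -- fraction `2 ^ (-M |S|)` of all subsets.
  set W : Finset α → Finset (Finset α) := fun S => (T \ N S).powerset.image (S ∪ ·) with hW
  have hWc : ∀ S, (W S).card = 2 ^ (T \ N S).card := fun S => by
    rw [hW]
    simp only
    rw [Finset.card_image_of_injOn, Finset.card_powerset]
    intro R hR R' hR' h
    have hd : ∀ Q ∈ (T \ N S).powerset, Disjoint S Q := fun Q hQ =>
      (Finset.disjoint_sdiff.mono_left (hSN S)).mono_right (Finset.mem_powerset.1 hQ)
    have h' : S ∪ R = S ∪ R' := h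
    rw [← Finset.union_sdiff_cancel_left (hd R (Finset.mem_coe.1 hR)), h',
      Finset.union_sdiff_cancel_left (hd R' (Finset.mem_coe.1 hR'))]
  have hmem : ∀ S Q, Q ∈ W S → S ⊆ Q ∧ ∀ a ∈ Q, a ∈ N S → a ∈ S := fun S Q hQ => by
    obtain ⟨R, hR, rfl⟩ := Finset.mem_image.1 hQ
    refine ⟨Finset.subset_union_left, fun a ha haN => ?_⟩
    refine (Finset.mem_union.1 ha).resolve_right fun h => ?_
    exact (Finset.mem_sdiff.1 (Finset.mem_powerset.1 hR h)).2 haN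
  have hsubset : ∀ S ∈ F, ∀ S' ∈ F, ∀ Q, Q ∈ W S → Q ∈ W S' → S ⊆ S' :=
    fun S hS S' hS' Q hQ hQ' => by
    have h1 : S ∩ S' = S := by
      refine (hF S hS).2.1 _ ⟨Finset.inter_subset_left, fun a ha b hb h => ?_⟩
        ⟨x, Finset.mem_inter.2 ⟨(hF S hS).2.2, (hF S' hS').2.2⟩⟩
      refine Finset.mem_inter.2 ⟨hb, (hmem S' Q hQ').2 b ((hmem S Q hQ).1 hb) ?_⟩
      exact Finset.mem_biUnion.2 ⟨a, (Finset.mem_inter.1 ha).2, hnb a b h⟩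
    exact Finset.inter_eq_left.1 h1
  have hdisj : (F : Set (Finset α)).PairwiseDisjoint W := fun S hS S' hS' hne =>
    Finset.disjoint_left.2 fun Q hQ hQ' => hne (Finset.Subset.antisymm
      (hsubset S hS S' hS' Q hQ hQ') (hsubset S' hS' S hS Q hQ' hQ))
  have hcard : ∑ S ∈ F, 2 ^ (T \ N S).card ≤ 2 ^ T.card := by
    rw [← Finset.card_powerset T, ← Finset.sum_congr rfl fun S _ => hWc S,
      ← Finset.card_biUnion hdisj]
    refine Finset.card_le_card fun Q hQ => ?_
    obtain ⟨S, hS, hQS⟩ := Finset.mem_biUnion.1 hQ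
    obtain ⟨R, hR, rfl⟩ := Finset.mem_image.1 hQS
    exact Finset.mem_powerset.2 (Finset.union_subset (hF S hS).1
      ((Finset.mem_powerset.1 hR).trans Finset.sdiff_subset))
  have hreal : ∑ S ∈ F, (2 : ℝ) ^ (T \ N S).card ≤ 2 ^ T.card := by exact_mod_cast hcard
  have hterm : ∀ S ∈ F, ((1 / 2 : ℝ) ^ M) ^ S.card * 2 ^ T.card ≤ 2 ^ (T \ N S).card :=
    fun S _ => by
    have h1 : T.card ≤ (T \ N S).card + M * S.card := by
      have := Finset.card_le_card_sdiff_add_card (s := T) (t := N S)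
      have := hNc S
      rw [mul_comm] at this
      omega
    rw [← pow_mul]
    calc (1 / 2 : ℝ) ^ (M * S.card) * 2 ^ T.card
        ≤ (1 / 2 : ℝ) ^ (M * S.card) * 2 ^ ((T \ N S).card + M * S.card) := by gcongr; norm_num
      _ = 2 ^ (T \ N S).card * ((1 / 2) * 2) ^ (M * S.card) := by rw [pow_add, mul_pow]; ring
      _ = _ := by norm_num
  have h2 : (0 : ℝ) < 2 ^ T.card := by positivity
  refine le_of_mul_le_mul_right ?_ h2
  rw [Finset.sum_mul, one_mul]
  exact (Finset.sum_le_sum hterm).trans hreal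

/-- Write `p ^ |S|` as `(2 ^ M p) ^ |S|` times the summable weight of `sum_linked_le`; the first
factor gives the decay in the minimal size `m`. -/
theorem sum_linked_pow_le {nb : α → Finset α} (hrefl : ∀ a, adj a a)
    (hnb : ∀ a b, adj a b → b ∈ nb a) {M : ℕ} (hM : ∀ a, (nb a).card ≤ M) (T : Finset α) (x : α)
    (F : Finset (Finset α)) (hF : ∀ S ∈ F, S ⊆ T ∧ Linked adj S ∧ x ∈ S) {p : ℝ} (hp : 0 ≤ p)
    (hp1 : 2 ^ M * p ≤ 1) {m : ℕ} (hm : ∀ S ∈ F, m ≤ S.card) :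
    ∑ S ∈ F, p ^ S.card ≤ (2 ^ M * p) ^ m := by
  have h := sum_linked_le hrefl hnb hM T x F hF
  calc ∑ S ∈ F, p ^ S.card ≤ ∑ S ∈ F, (2 ^ M * p) ^ m * ((1 / 2 : ℝ) ^ M) ^ S.card := by
        refine Finset.sum_le_sum fun S hS => ?_
        have h1 : p ^ S.card = (2 ^ M * p) ^ S.card * ((1 / 2 : ℝ) ^ M) ^ S.card := by
          rw [← mul_pow, mul_right_comm, ← mul_pow]; norm_num
        rw [h1]
        exact mul_le_mul_of_nonneg_right
          (pow_le_pow_of_le_one (by positivity) hp1 (hm S hS)) (by positivity)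
    _ = (2 ^ M * p) ^ m * ∑ S ∈ F, ((1 / 2 : ℝ) ^ M) ^ S.card := by rw [Finset.mul_sum]
    _ ≤ _ := mul_le_of_le_one_right (by positivity) h

end LinkedSets

/-! ### Peierls contours as sets of lattice edges, adjacent when they bound a common face. -/

section Contours

/-- The four edges of the face with lower left corner `f`. -/
def faceEdges (f : Site) : Finset Edge :=
  {(f, false), (f + (0, 1), false), (f, true), (f + (1, 0), true)}

/-- Two edges are adjacent if they lie on a common face. -/
def FaceAdj (e e' : Edge) : Prop := ∃ f, e ∈ faceEdges f ∧ e' ∈ faceEdges f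

/-- The edges of the two faces containing `e`. -/
def faceNbrs (e : Edge) : Finset Edge :=
  faceEdges e.1 ∪ faceEdges (e.1 - dirVec (!e.2))

theorem FaceAdj.symm (e e' : Edge) (h : FaceAdj e e') : FaceAdj e' e :=
  h.imp fun _ h => ⟨h.2, h.1⟩

theorem mem_faceEdges {f : Site} {e : Edge} : e ∈ faceEdges f ↔
    e = (f, false) ∨ e = (f + (0, 1), false) ∨ e = (f, true) ∨ e = (f + (1, 0), true) := by
  simp [faceEdges]

theorem eq_of_mem_faceEdges {f : Site} {e : Edge} (h : e ∈ faceEdges f) :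
    f = e.1 ∨ f = e.1 - dirVec (!e.2) := by
  rcases mem_faceEdges.1 h with rfl | rfl | rfl | rfl <;> simp [dirVec]

theorem FaceAdj.refl (e : Edge) : FaceAdj e e := by
  obtain ⟨v, d⟩ := e
  refine ⟨v, ?_, ?_⟩ <;> cases d <;> simp [faceEdges]

theorem FaceAdj.mem_faceNbrs (e e' : Edge) (h : FaceAdj e e') : e' ∈ faceNbrs e := by
  obtain ⟨f, h1, h2⟩ := h
  rcases eq_of_mem_faceEdges h1 with rfl | rfl
  · exact Finset.mem_union_left _ h2
  · exact Finset.mem_union_right _ h2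

theorem card_faceNbrs_le (e : Edge) : (faceNbrs e).card ≤ 8 :=
  (Finset.card_union_le _ _).trans (Nat.add_le_add Finset.card_le_four Finset.card_le_four)

theorem FaceAdj.abs_le (e e' : Edge) (h : FaceAdj e e') : |e.1.1 - e'.1.1| ≤ 1 := by
  obtain ⟨f, h1, h2⟩ := h
  rw [mem_faceEdges] at h1 h2
  rcases h1 with rfl | rfl | rfl | rfl <;> rcases h2 with rfl | rfl | rfl | rfl <;> simp

theorem spin_eq_or {V : Type*} [DecidableEq V] (A : Finset V) (v : V) :
    spin A v = 1 ∨ spin A v = -1 := by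
  unfold spin; split_ifs <;> simp

theorem spin_eq_neg_one {V : Type*} [DecidableEq V] {A : Finset V} {v : V} :
    spin A v = -1 ↔ v ∈ A := by
  unfold spin; split_ifs with h
  · simp [h]
  · simp only [h, iff_false]; norm_num

theorem spin_of_notMem {V : Type*} [DecidableEq V] {A : Finset V} {v : V} (h : v ∉ A) :
    spin A v = 1 := if_neg h

/-- The product of the signs of `κ` on the horizontal edges between the columns `s` and `t`. -/
def rowSign (κ : Finset Edge) (y s t : ℤ) : ℝ := ∏ x ∈ Finset.Ico s t, spin κ ((x, y), false)

theorem rowSign_succ (κ : Finset Edge) (y : ℤ) {s t : ℤ} (h : s ≤ t) :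
    rowSign κ y s (t + 1) = rowSign κ y s t * spin κ ((t, y), false) := by
  unfold rowSign
  have : Finset.Ico s (t + 1) = insert t (Finset.Ico s t) := by
    ext z; simp only [Finset.mem_Ico, Finset.mem_insert]; omega
  rw [this, Finset.prod_insert (by simp), mul_comm]

theorem rowSign_self (κ : Finset Edge) (y s : ℤ) : rowSign κ y s s = 1 := by simp [rowSign]

theorem rowSign_eq_or (κ : Finset Edge) (y s t : ℤ) :
    rowSign κ y s t = 1 ∨ rowSign κ y s t = -1 := by
  refine mul_self_eq_one_iff.1 ?_
  unfold rowSign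
  rw [← Finset.prod_mul_distrib]
  refine Finset.prod_eq_one fun x _ => ?_
  rcases spin_eq_or κ ((x, y), false) with h | h <;> rw [h] <;> norm_num

theorem rowSign_mul_rowSign (κ : Finset Edge) (y : ℤ) {s t u : ℤ} (h : s ≤ t) (h' : t ≤ u) :
    rowSign κ y s t * rowSign κ y t u = rowSign κ y s u := by
  induction u, h' using Int.leInduction with
  | base => rw [rowSign_self, mul_one]
  | succ u h' ih => rw [rowSign_succ _ _ h', rowSign_succ _ _ (h.trans h'), ← ih, mul_assoc]

theorem rowSign_sdiff {κ η : Finset Edge} (h : η ⊆ κ) (y s t : ℤ) :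
    rowSign κ y s t = rowSign η y s t * rowSign (κ \ η) y s t := by
  unfold rowSign
  rw [← Finset.prod_mul_distrib]
  refine Finset.prod_congr rfl fun x _ => ?_
  set e : Edge := ((x, y), false)
  by_cases h1 : e ∈ η
  · rw [spin_eq_neg_one.2 h1, spin_eq_neg_one.2 (h h1), spin_of_notMem (by simp [h1])]; norm_num
  · by_cases h2 : e ∈ κ
    · rw [spin_of_notMem h1, spin_eq_neg_one.2 h2, spin_eq_neg_one.2 (by simp [h1, h2]), one_mul]
    · rw [spin_of_notMem h1, spin_of_notMem h2, spin_of_notMem (by simp [h2]), one_mul]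

theorem exists_mem_of_rowSign {κ : Finset Edge} {y s t : ℤ} (h : rowSign κ y s t = -1) :
    ∃ x ∈ Finset.Ico s t, ((x, y), false) ∈ κ := by
  by_contra hcon
  push Not at hcon
  have : rowSign κ y s t = 1 := Finset.prod_eq_one fun x hx => spin_of_notMem (hcon x hx)
  rw [this] at h
  norm_num at h

/-- The edges with endpoints of different spin. -/
def walls (I A : Finset Site) : Finset Edge := (touch I).filter fun e => bond A e = -1

theorem bond_eq_or (A : Finset Site) (e : Edge) : bond A e = 1 ∨ bond A e = -1 := by
  unfold bond
  rcases spin_eq_or A (esrc e) with h | h <;> rcases spin_eq_or A (etgt e) with h' | h' <;>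
    rw [h, h'] <;> norm_num

theorem spin_walls {I A : Finset Site} (hA : A ⊆ I) (e : Edge) : spin (walls I A) e = bond A e := by
  by_cases h : e ∈ touch I
  · rcases bond_eq_or A e with h1 | h1
    · rw [h1]; refine spin_of_notMem fun h2 => ?_
      have := (Finset.mem_filter.1 h2).2
      rw [h1] at this; norm_num at this
    · rw [h1]; exact spin_eq_neg_one.2 (Finset.mem_filter.2 ⟨h, h1⟩)
  · rw [bond_eq_one_of_not_touch hA h]
    exact spin_of_notMem fun h2 => h (Finset.mem_filter.1 h2).1

theorem rowSign_walls {I A : Finset Site} (hA : A ⊆ I) (y : ℤ) {s t : ℤ} (h : s ≤ t) :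
    rowSign (walls I A) y s t = spin A (s, y) * spin A (t, y) := by
  induction t, h using Int.leInduction with
  | base => rw [rowSign_self, spin_sq]
  | succ t h ih =>
    rw [rowSign_succ _ _ h, ih, spin_walls hA]
    have : bond A ((t, y), false) = spin A (t, y) * spin A (t + 1, y) := by
      unfold bond esrc etgt dirVec; simp
    rw [this]
    linear_combination spin A (s, y) * spin A (t + 1, y) * spin_sq A (t, y)

/-- The product of the signs around a face. -/
def faceSign (κ : Finset Edge) (x y : ℤ) : ℝ :=
  spin κ ((x, y), false) * spin κ ((x, y + 1), false) * (spin κ ((x, y), true) *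
    spin κ ((x + 1, y), true))

theorem faceSign_walls {I A : Finset Site} (hA : A ⊆ I) (x y : ℤ) :
    faceSign (walls I A) x y = 1 := by
  unfold faceSign
  simp only [spin_walls hA, bond, esrc, etgt, dirVec, if_true, Bool.false_eq_true, if_false,
    Prod.mk_add_mk, add_zero]
  have h1 := spin_sq A (x, y)
  have h2 := spin_sq A (x + 1, y)
  have h3 := spin_sq A (x, y + 1)
  have h4 := spin_sq A (x + 1, y + 1)
  calc _ = (spin A (x, y) * spin A (x, y)) * (spin A (x + 1, y) * spin A (x + 1, y)) *
      ((spin A (x, y + 1) * spin A (x, y + 1)) *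
        (spin A (x + 1, y + 1) * spin A (x + 1, y + 1))) := by ring
    _ = 1 := by rw [h1, h2, h3, h4]; norm_num

/-- A closed set containing one edge of `D` on a face contains all edges of `D` on that face, so its
face sign is that of `D` or that of the empty set. -/
theorem faceSign_closedIn {D κ : Finset Edge} (hκ : ClosedIn FaceAdj D κ) {x y : ℤ}
    (hD : faceSign D x y = 1) : faceSign κ x y = 1 := by
  have hmem : ∀ e, e ∈ faceEdges (x, y) ↔ e = ((x, y), false) ∨ e = ((x, y + 1), false) ∨
      e = ((x, y), true) ∨ e = ((x + 1, y), true) := fun e => by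
    rw [mem_faceEdges]; simp
  by_cases h : ∃ a ∈ κ, a ∈ faceEdges (x, y)
  · obtain ⟨a, ha, haf⟩ := h
    have hs : ∀ e ∈ faceEdges (x, y), spin κ e = spin D e := fun e he => by
      unfold spin
      have : e ∈ κ ↔ e ∈ D := ⟨fun h => hκ.1 h, fun h => hκ.2 a ha e h ⟨_, haf, he⟩⟩
      simp only [this]
    unfold faceSign at hD ⊢
    rw [hs _ ((hmem _).2 (by simp)), hs _ ((hmem _).2 (by simp)), hs _ ((hmem _).2 (by simp)),
      hs _ ((hmem _).2 (by simp)), hD]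
  · push Not at h
    unfold faceSign
    rw [spin_of_notMem fun h1 => h _ h1 ((hmem _).2 (by simp)),
      spin_of_notMem fun h1 => h _ h1 ((hmem _).2 (by simp)),
      spin_of_notMem fun h1 => h _ h1 ((hmem _).2 (by simp)),
      spin_of_notMem fun h1 => h _ h1 ((hmem _).2 (by simp))]
    norm_num

/-- A set of edges of trivial face signs near a box is the set of walls of a set of sites. -/
theorem exists_bond_eq {n : ℕ} {κ : Finset Edge} (hκ : κ ⊆ touch (box n))
    (hf : ∀ x y, faceSign κ x y = 1) :
    ∃ B ⊆ box n, (∀ e, bond B e = spin κ e) ∧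
      ∀ v : Site, v ∉ box n → -(n : ℤ) ≤ v.1 → rowSign κ v.2 (-n) v.1 = 1 := by
  have hout : ∀ x y : ℤ, ∀ d, (x, y) ∉ box n → (x, y) + dirVec d ∉ box n →
      spin κ ((x, y), d) = 1 := fun x y d h1 h2 => by
    refine spin_of_notMem fun h => ?_
    rcases mem_touch.1 (hκ h) with h3 | h3
    · exact h1 h3
    · exact h2 h3
  -- The trivial face signs of the strip between two neighbouring rows telescope from the left side,
  -- where no edge of `κ` is present.
  have hvert : ∀ y x : ℤ, -(n : ℤ) ≤ x →
      rowSign κ y (-n) x * rowSign κ (y + 1) (-n) x = spin κ ((x, y), true) := fun y x hx => by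
    induction x, hx using Int.leInduction with
    | base =>
      rw [rowSign_self, rowSign_self, hout]
      · norm_num
      · rw [mem_box]; simp [nrm]
      · rw [mem_box]; simp [nrm, dirVec]
    | succ x hx ih =>
      rw [rowSign_succ _ _ hx, rowSign_succ _ _ hx]
      have h1 := hf x y
      unfold faceSign at h1
      have h2 := spin_eq_or κ ((x + 1, y), true)
      have h3 : spin κ ((x + 1, y), true) * spin κ ((x + 1, y), true) = 1 := by
        rcases h2 with h | h <;> rw [h] <;> norm_num
      calc _ = rowSign κ y (-n) x * rowSign κ (y + 1) (-n) x *
            (spin κ ((x, y), false) * spin κ ((x, y + 1), false)) := by ring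
        _ = spin κ ((x, y), false) * spin κ ((x, y + 1), false) * spin κ ((x, y), true) *
            (spin κ ((x + 1, y), true) * spin κ ((x + 1, y), true)) := by rw [ih, h3]; ring
        _ = _ := by linear_combination spin κ ((x + 1, y), true) * h1
  have hone : ∀ v : Site, v ∉ box n → -(n : ℤ) ≤ v.1 → rowSign κ v.2 (-n) v.1 = 1 := by
    have hrow : ∀ x y : ℤ, n ≤ y.natAbs → rowSign κ y (-n) x = 1 := fun x y hy => by
      refine Finset.prod_eq_one fun z _ => hout z y false ?_ ?_
      · rw [mem_box]; simp only [nrm]; omega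
      · rw [mem_box]; simp only [nrm, dirVec, Bool.false_eq_true, if_false, Prod.mk_add_mk]; omega
    rintro ⟨x, y⟩ hv hx
    simp only at hx ⊢
    rw [mem_box] at hv
    simp only [nrm] at hv
    by_cases hy : n ≤ y.natAbs
    · exact hrow x y hy
    by_cases hx' : x = -n
    · rw [hx', rowSign_self]
    have hxn : (n : ℤ) ≤ x := by omega
    -- To the right of the box no vertical edge lies in `κ`, so the row sign is constant up the
    -- column, and it is trivial in the rows above the box.
    have hup : ∀ z : ℤ, y ≤ z → rowSign κ y (-n) x = rowSign κ z (-n) x := fun z hz => by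
      induction z, hz using Int.leInduction with
      | base => rfl
      | succ z hz ih =>
        have h1 := hvert z x hx
        rw [hout x z true, ← ih] at h1
        · rcases rowSign_eq_or κ y (-n) x with h2 | h2 <;> rw [h2] at h1 ⊢ <;> linarith
        · rw [mem_box]; simp only [nrm]; omega
        · rw [mem_box]; simp only [nrm, dirVec, if_true, Prod.mk_add_mk]; omega
    rw [hup n (by omega), hrow]
    simp
  refine ⟨(box n).filter fun v => rowSign κ v.2 (-n) v.1 = -1, Finset.filter_subset _ _, ?_, hone⟩
  set B := (box n).filter fun v : Site => rowSign κ v.2 (-n) v.1 = -1 with hB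
  have hspin : ∀ v : Site, -(n : ℤ) ≤ v.1 → spin B v = rowSign κ v.2 (-n) v.1 := fun v hv => by
    rcases rowSign_eq_or κ v.2 (-n) v.1 with h | h
    · rw [h]
      refine spin_of_notMem fun h1 => ?_
      have := (Finset.mem_filter.1 h1).2
      rw [h] at this
      norm_num at this
    · rw [h, spin_eq_neg_one, hB, Finset.mem_filter]
      refine ⟨?_, h⟩
      by_contra h1
      rw [hone v h1 hv] at h
      norm_num at h
  have hfar : ∀ v : Site, v.1 ≤ -(n : ℤ) → v ∉ box n := fun v hv => by
    rw [mem_box]; simp only [nrm]; omega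
  rintro ⟨⟨x, y⟩, d⟩
  by_cases hx : -(n : ℤ) ≤ x
  · cases d
    · unfold bond esrc etgt dirVec
      simp only [Bool.false_eq_true, if_false, Prod.mk_add_mk, add_zero]
      rw [hspin _ hx, hspin _ (by simp only; omega)]
      simp only
      rw [rowSign_succ _ _ hx]
      rcases rowSign_eq_or κ y (-n) x with h | h <;> rw [h] <;> ring
    · unfold bond esrc etgt dirVec
      simp only [if_true, Prod.mk_add_mk, add_zero]
      rw [hspin _ hx, hspin _ (by simpa using hx)]
      exact hvert y x hx
  · have h1 := hfar (x, y) (by simp only; omega)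
    have h2 : (x, y) + dirVec d ∉ box n := hfar _ (by
      cases d <;> simp [dirVec] <;> omega)
    rw [hout x y d h1 h2]
    unfold bond esrc etgt
    rw [spin_of_notMem fun h => h1 (Finset.mem_filter.1 h).1,
      spin_of_notMem fun h => h2 (Finset.mem_filter.1 h).1, one_mul]

/-- A minus spin at the origin is surrounded by a contour. -/
theorem exists_contour {n : ℕ} {A : Finset Site} (hA : A ⊆ box n) (h0 : 0 ∈ A) :
    ∃ κ, ClosedIn FaceAdj (walls (box n) A) κ ∧ Linked FaceAdj κ ∧
      ∃ k ∈ Finset.Icc 1 n, ((-(k : ℤ), 0), false) ∈ κ ∧ k + 1 ≤ κ.card := by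
  have hb : ((-(n : ℤ), 0) : Site) ∉ box n := by rw [mem_box]; simp [nrm]
  have h1 : rowSign (walls (box n) A) 0 (-n) 0 = -1 := by
    rw [rowSign_walls hA 0 (by omega), spin_of_notMem fun h => hb (hA h), one_mul]
    exact spin_eq_neg_one.2 h0
  obtain ⟨κ, hκ, hL, hs⟩ := exists_linked_closedIn FaceAdj.symm
    (fun κ => rowSign κ 0 (-n) 0) (fun S R h => rowSign_sdiff h 0 _ _)
    (fun S => rowSign_eq_or S 0 _ _) h1
  refine ⟨κ, hκ, hL, ?_⟩
  -- The sign of the whole row is trivial while the part left of the origin has sign `-1`, so the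
  -- contour also crosses the row on the right. Being linked, it has an edge in every column
  -- between, hence at least `k + 1` edges.
  obtain ⟨B, -, -, hone⟩ := exists_bond_eq (n := n)
    (hκ.1.trans (Finset.filter_subset _ _))
    (fun x y => faceSign_closedIn hκ (faceSign_walls hA x y))
  have h2 := hone (n, 0) (by rw [mem_box]; simp [nrm]) (by simp only; omega)
  simp only at h2
  rw [← rowSign_mul_rowSign κ 0 (show -(n : ℤ) ≤ 0 by omega) (show (0 : ℤ) ≤ n by omega)] at h2
  rw [hs] at h2
  obtain ⟨x, hx, hxκ⟩ := exists_mem_of_rowSign hs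
  obtain ⟨z, hz, hzκ⟩ := exists_mem_of_rowSign (κ := κ) (y := 0) (s := 0) (t := n) (by linarith)
  rw [Finset.mem_Ico] at hx hz
  obtain ⟨k, hk⟩ : ∃ k : ℕ, x = -(k : ℤ) := ⟨x.natAbs, by omega⟩
  subst hk
  refine ⟨k, Finset.mem_Icc.2 (by omega), hxκ, ?_⟩
  exact hL.card_ge (π := fun e : Edge => e.1.1) FaceAdj.abs_le hxκ hzκ (by simp only; omega)

theorem bond_symmDiff (A B : Finset Site) (e : Edge) :
    bond (symmDiff A B) e = bond A e * bond B e := by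
  unfold bond
  rw [spin_symmDiff, spin_symmDiff]; ring

open scoped Classical in
/-- The cost of a contour. -/
theorem sum_closedIn_le {a : ℝ} {n : ℕ} {κ : Finset Edge} :
    ∑ A ∈ (minusIn (box n)).filter (fun A => ClosedIn FaceAdj (walls (box n) A.1) κ),
      boltz ⟨a, 0, 0⟩ (touch (box n)) A ≤
      Real.exp (-2 * a) ^ κ.card * ∑ A ∈ minusIn (box n), boltz ⟨a, 0, 0⟩ (touch (box n)) A := by
  by_cases hex : ∃ A ∈ minusIn (box n), ClosedIn FaceAdj (walls (box n) A.1) κ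
  swap
  · push Not at hex
    rw [Finset.filter_false_of_mem hex, Finset.sum_empty]
    exact mul_nonneg (by positivity) (sum_boltz_pos _ _ _).le
  obtain ⟨A₀, hA₀, hκ₀⟩ := hex
  have hκT : κ ⊆ touch (box n) := hκ₀.1.trans (Finset.filter_subset _ _)
  obtain ⟨B, hB, hbond, -⟩ := exists_bond_eq hκT
    (fun x y => faceSign_closedIn hκ₀ (faceSign_walls (mem_minusIn.1 hA₀).1 x y))
  have hBm : ((B, ∅) : Minus) ∈ minusIn (box n) := mem_minusIn.2 ⟨hB, by simp⟩
  -- Flipping the first layer on `B`, the set whose walls are `κ`, is a bijection that removes `κ`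
  -- from the walls and multiplies the weight by `exp (2 a |κ|)`.
  rw [← sum_symmDiff_right (minusIn_symmDiff (box n)) (boltz ⟨a, 0, 0⟩ (touch (box n))) hBm,
    Finset.mul_sum]
  refine (Finset.sum_le_sum fun A hA => ?_).trans (Finset.sum_le_sum_of_subset_of_nonneg
    (Finset.filter_subset _ _) fun A _ _ => mul_nonneg (by positivity) (boltz_pos _ _ _).le)
  have hcl := (Finset.mem_filter.1 hA).2
  refine le_of_eq ?_
  unfold boltz
  rw [← Real.exp_nat_mul, ← Real.exp_add]
  congr 1
  have hcount : (κ.card : ℝ) = ∑ e ∈ touch (box n), if e ∈ κ then 1 else 0 := by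
    rw [Finset.sum_ite_mem, Finset.inter_eq_right.2 hκT]; simp
  rw [hcount, Finset.sum_mul, ← Finset.sum_add_distrib]
  refine Finset.sum_congr rfl fun e _ => ?_
  have h1 : (symmDiff A ((B, ∅) : Minus)).1 = symmDiff A.1 B := rfl
  unfold energy
  simp only [zero_mul, add_zero, h1]
  rw [bond_symmDiff, hbond]
  split_ifs with h
  · rw [spin_eq_neg_one.2 h, (Finset.mem_filter.1 (hcl.1 h)).2]; ring
  · rw [spin_of_notMem h]; ring

end Contours

/-! ### The Peierls bound and positive magnetisation at large inverse temperature. -/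

section LowTemperature

theorem sum_biUnion_le_sum {ι α : Type*} [DecidableEq α] (P : Finset ι) (F : ι → Finset α)
    {W : α → ℝ} (hW : ∀ a, 0 ≤ W a) : ∑ a ∈ P.biUnion F, W a ≤ ∑ p ∈ P, ∑ a ∈ F p, W a := by
  classical
  induction P using Finset.induction_on with
  | empty => simp
  | insert p P hp ih =>
    rw [Finset.biUnion_insert, Finset.sum_insert hp]
    have := Finset.sum_union_inter (s₁ := F p) (s₂ := P.biUnion F) (f := W)
    have h2 := Finset.sum_nonneg (s := F p ∩ P.biUnion F) fun a _ => hW a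
    linarith

-- Peierls' argument: a contour crossing the left half-axis at distance `k` has at least `k + 1`
-- edges, each of cost `exp (-2 a)`. The exponent eight is the bound on the number of `faceNbrs` in
-- the count of linked sets.
open scoped Classical in
theorem sum_minus_le {a : ℝ} (ha : 2 ^ 8 * Real.exp (-2 * a) ≤ 1 / 8) (n : ℕ) :
    ∑ A ∈ (minusIn (box n)).filter (fun A => (0 : Site) ∈ A.1),
      boltz ⟨a, 0, 0⟩ (touch (box n)) A ≤
      1 / 4 * ∑ A ∈ minusIn (box n), boltz ⟨a, 0, 0⟩ (touch (box n)) A := by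
  set T := touch (box n) with hT
  set W : Minus → ℝ := boltz ⟨a, 0, 0⟩ T with hW
  set Z := ∑ A ∈ minusIn (box n), W A with hZ
  have hZ0 : 0 < Z := sum_boltz_pos _ _ _
  have hW0 : ∀ A, 0 < W A := fun A => boltz_pos _ _ _
  set q := 2 ^ 8 * Real.exp (-2 * a) with hq
  have hq0 : 0 ≤ q := by positivity
  set F : ℕ → Finset (Finset Edge) := fun k => T.powerset.filter fun κ =>
    Linked FaceAdj κ ∧ (((-(k : ℤ), 0), false) : Edge) ∈ κ ∧ k + 1 ≤ κ.card with hF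
  have hFsum : ∀ k, ∑ κ ∈ F k, Real.exp (-2 * a) ^ κ.card ≤ q ^ (k + 1) := fun k => by
    refine sum_linked_pow_le FaceAdj.refl FaceAdj.mem_faceNbrs card_faceNbrs_le T
      (((-(k : ℤ), 0), false) : Edge) (F k) (fun κ hκ => ?_) (Real.exp_pos _).le (by linarith)
      fun κ hκ => (Finset.mem_filter.1 hκ).2.2.2
    have := Finset.mem_filter.1 hκ
    exact ⟨Finset.mem_powerset.1 this.1, this.2.1, this.2.2.1⟩
  set P := (Finset.Icc 1 n).sigma F with hP
  have hcover : (minusIn (box n)).filter (fun A => (0 : Site) ∈ A.1) ⊆ P.biUnion fun p =>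
      (minusIn (box n)).filter fun A => ClosedIn FaceAdj (walls (box n) A.1) p.2 := fun A hA => by
    obtain ⟨hA, h0⟩ := Finset.mem_filter.1 hA
    obtain ⟨κ, hκ, hL, k, hk, hkκ, hc⟩ := exists_contour (mem_minusIn.1 hA).1 h0
    refine Finset.mem_biUnion.2 ⟨⟨k, κ⟩, Finset.mem_sigma.2 ⟨hk, Finset.mem_filter.2
      ⟨Finset.mem_powerset.2 (hκ.1.trans (Finset.filter_subset _ _)), hL, hkκ, hc⟩⟩,
      Finset.mem_filter.2 ⟨hA, hκ⟩⟩
  have hgeom : ∑ k ∈ Finset.Icc 1 n, q ^ (k + 1) ≤ 1 / 4 := by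
    have h1 : ∀ m : ℕ, ∑ k ∈ Finset.Icc 1 m, q ^ (k + 1) ≤ 1 / 4 * (1 - (1 / 8) ^ m) := fun m => by
      induction m with
      | zero => simp
      | succ m ih =>
        rw [Finset.sum_Icc_succ_top (by omega)]
        have h2 : q ^ (m + 1 + 1) ≤ (1 / 8) ^ (m + 1 + 1) := pow_le_pow_left₀ hq0 ha _
        have h3 : (0 : ℝ) < (1 / 8) ^ m := by positivity
        rw [pow_succ, pow_succ (1 / 8 : ℝ) (m + 1)] at h2
        rw [pow_succ (1 / 8 : ℝ) m] at h2 ⊢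
        rw [pow_succ]
        linarith
    have h3 : (0 : ℝ) < (1 / 8) ^ n := by positivity
    linarith [h1 n]
  calc _ ≤ ∑ A ∈ P.biUnion fun p =>
          (minusIn (box n)).filter fun A => ClosedIn FaceAdj (walls (box n) A.1) p.2, W A :=
        Finset.sum_le_sum_of_subset_of_nonneg hcover fun A _ _ => (hW0 A).le
    _ ≤ ∑ p ∈ P, ∑ A ∈ (minusIn (box n)).filter fun A =>
          ClosedIn FaceAdj (walls (box n) A.1) p.2, W A := by
        exact sum_biUnion_le_sum P _ fun A => (hW0 A).le
    _ ≤ ∑ p ∈ P, Real.exp (-2 * a) ^ p.2.card * Z := Finset.sum_le_sum fun p _ => by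
        exact sum_closedIn_le
    _ = (∑ k ∈ Finset.Icc 1 n, ∑ κ ∈ F k, Real.exp (-2 * a) ^ κ.card) * Z := by
        rw [← Finset.sum_mul, hP, Finset.sum_sigma]
    _ ≤ (∑ k ∈ Finset.Icc 1 n, q ^ (k + 1)) * Z :=
        mul_le_mul_of_nonneg_right (Finset.sum_le_sum fun k _ => hFsum k) hZ0.le
    _ ≤ _ := mul_le_mul_of_nonneg_right hgeom hZ0.le

/-- The magnetisation is bounded below at large inverse temperature. -/
theorem exists_half_le_magnet {K : Coupling} (hK : K.Nonneg) (h1 : 0 < K.k₁) :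
    ∃ b, 0 < b ∧ ∀ n, 1 / 2 ≤ magnet (K.scale b) n := by
  have hlim : Tendsto (fun a : ℝ => 2 ^ 8 * Real.exp (-2 * a)) atTop (𝓝 (2 ^ 8 * 0)) :=
    (Real.tendsto_exp_atBot.comp ((tendsto_id (α := ℝ)).const_mul_atTop_of_neg
      (by norm_num : (-2 : ℝ) < 0))).const_mul _
  rw [mul_zero] at hlim
  obtain ⟨a, ha, ha0⟩ := ((hlim.eventually (ge_mem_nhds (by norm_num : (0 : ℝ) < 1 / 8))).and
    (eventually_gt_atTop 0)).exists
  have hb : 0 < a / K.k₁ := div_pos ha0 h1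
  refine ⟨a / K.k₁, hb, fun n => ?_⟩
  -- By Griffiths, dropping the second layer and the interaction lowers the magnetisation, which
  -- leaves the Ising model with coupling `a`.
  have hmono : gibbs ⟨a, 0, 0⟩ (touch (box n)) (box n) (fun A => spin A.1 0) ≤
      magnet (K.scale (a / K.k₁)) n := by
    refine gibbs_mono_coupling (K' := K.scale (a / K.k₁)) ⟨ha0.le, le_rfl, le_rfl⟩ ?_
      (mul_nonneg hb.le hK.2.1) (mul_nonneg hb.le hK.2.2) _ _ (isChar_spin_fst 0).posFun
    change a ≤ a / K.k₁ * K.k₁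
    rw [div_mul_cancel₀ _ h1.ne']
  refine le_trans ?_ hmono
  classical
  have hZ := sum_boltz_pos ⟨a, 0, 0⟩ (touch (box n)) (box n)
  unfold gibbs
  rw [le_div_iff₀ hZ]
  have hsum := sum_minus_le ha n
  have h2 : ∑ A ∈ minusIn (box n), spin A.1 0 * boltz ⟨a, 0, 0⟩ (touch (box n)) A =
      ∑ A ∈ minusIn (box n), boltz ⟨a, 0, 0⟩ (touch (box n)) A -
        2 * ∑ A ∈ (minusIn (box n)).filter (fun A => (0 : Site) ∈ A.1),
          boltz ⟨a, 0, 0⟩ (touch (box n)) A := by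
    rw [Finset.mul_sum, Finset.sum_filter, ← Finset.sum_sub_distrib]
    refine Finset.sum_congr rfl fun A _ => ?_
    unfold spin
    split_ifs <;> ring
  rw [h2]
  linarith

end LowTemperature

/-! ### Finite-volume plus measures as Gibbs sums over minus sets. -/

section FiniteVolume

/-- The configuration with given minus sets. -/
def config (A : Minus) : Config Site := (fun v => decide (v ∉ A.1), fun v => decide (v ∉ A.2))

theorem tau_config (A : Minus) (v : Site) : tau (config A) v = spin A.1 v := by
  unfold tau config sgn spin
  by_cases h : v ∈ A.1 <;> simp [h]

theorem tau'_config (A : Minus) (v : Site) : tau' (config A) v = spin A.2 v := by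
  unfold tau' config sgn spin
  by_cases h : v ∈ A.2 <;> simp [h]

/-- The restriction of `config A` to a finite set. -/
def restrictConfig (Ω : Finset Site) (A : Minus) : Config Ω :=
  (fun v => decide (v.1 ∉ A.1), fun v => decide (v.1 ∉ A.2))

theorem tau_restrictConfig {Ω : Finset Site} (A : Minus) (v : Ω) :
    tau (restrictConfig Ω A) v = spin A.1 v := tau_config A v

theorem tau'_restrictConfig {Ω : Finset Site} (A : Minus) (v : Ω) :
    tau' (restrictConfig Ω A) v = spin A.2 v := tau'_config A v

open scoped Classical in
/-- The sites all of whose neighbours lie in `Ω`. -/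
def inner (Ω : Finset Site) : Finset Site :=
  Ω.filter fun v => ∀ w, squareLattice.Adj v w → w ∈ Ω

theorem mem_inner {Ω : Finset Site} {v : Site} :
    v ∈ inner Ω ↔ v ∈ Ω ∧ ∀ w, squareLattice.Adj v w → w ∈ Ω := by
  classical
  unfold inner
  rw [Finset.mem_filter]

theorem inner_subset (Ω : Finset Site) : inner Ω ⊆ Ω := fun _ hv => (mem_inner.1 hv).1

theorem inner_mono {Ω Ω' : Finset Site} (h : Ω ⊆ Ω') : inner Ω ⊆ inner Ω' := fun v hv => by
  rw [mem_inner] at *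
  exact ⟨h hv.1, fun w hw => h (hv.2 w hw)⟩

theorem adj_iff {u v : Site} : squareLattice.Adj u v ↔ |u.1 - v.1| + |u.2 - v.2| = 1 := Iff.rfl

theorem adj_esrc_etgt (e : Edge) : squareLattice.Adj (esrc e) (etgt e) := by
  obtain ⟨v, d⟩ := e
  rw [adj_iff]
  cases d <;> simp [esrc, etgt, dirVec]

theorem exists_edge_of_adj {u v : Site} (h : squareLattice.Adj u v) :
    ∃ e : Edge, (esrc e = u ∧ etgt e = v) ∨ (esrc e = v ∧ etgt e = u) := by
  obtain ⟨a, b⟩ := u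
  obtain ⟨c, d⟩ := v
  rw [adj_iff] at h
  simp only at h
  have h4 : (c = a + 1 ∧ d = b) ∨ (a = c + 1 ∧ d = b) ∨ (c = a ∧ d = b + 1) ∨
      (c = a ∧ b = d + 1) := by
    rcases abs_cases (a - c) with h1 | h1 <;> rcases abs_cases (b - d) with h2 | h2 <;> omega
  rcases h4 with ⟨rfl, rfl⟩ | ⟨rfl, rfl⟩ | ⟨rfl, rfl⟩ | ⟨rfl, rfl⟩
  · exact ⟨((a, d), false), Or.inl (by simp [esrc, etgt, dirVec])⟩
  · exact ⟨((c, d), false), Or.inr (by simp [esrc, etgt, dirVec])⟩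
  · exact ⟨((c, b), true), Or.inl (by simp [esrc, etgt, dirVec])⟩
  · exact ⟨((c, d), true), Or.inr (by simp [esrc, etgt, dirVec])⟩

theorem edge_eq_of_endpoints {e e' : Edge} (h : (esrc e = esrc e' ∧ etgt e = etgt e') ∨
    (esrc e = etgt e' ∧ etgt e = esrc e')) : e = e' := by
  obtain ⟨⟨a, b⟩, d⟩ := e
  obtain ⟨⟨a', b'⟩, d'⟩ := e'
  cases d <;> cases d' <;> simp [esrc, etgt, dirVec] at h ⊢ <;> omega

/-- The edges with both endpoints in `Ω`. -/
def edgesIn (Ω : Finset Site) : Finset Edge := (Ω ×ˢ Finset.univ).filter fun e => etgt e ∈ Ω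

theorem mem_edgesIn {Ω : Finset Site} {e : Edge} : e ∈ edgesIn Ω ↔ esrc e ∈ Ω ∧ etgt e ∈ Ω := by
  simp [edgesIn, esrc]

theorem touch_inner_subset (Ω : Finset Site) : touch (inner Ω) ⊆ edgesIn Ω := fun e he => by
  rw [mem_edgesIn]
  rcases mem_touch.1 he with h | h
  · exact ⟨inner_subset Ω h, (mem_inner.1 h).2 _ (adj_esrc_etgt e)⟩
  · exact ⟨(mem_inner.1 h).2 _ (adj_esrc_etgt e).symm, inner_subset Ω h⟩

/-- Each unordered edge of the induced graph has exactly one representation as a lower-left endpoint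
and a direction. -/
theorem weight_restrictConfig (J U : ℝ) (Ω : Finset Site) (A : Minus) :
    weight (inducedGraph Ω) J U (restrictConfig Ω A) = boltz ⟨J, J, U⟩ (edgesIn Ω) A := by
  classical
  unfold weight boltz
  congr 1
  symm
  refine Finset.sum_bij (fun e he => s((⟨esrc e, (mem_edgesIn.1 he).1⟩ : Ω),
    ⟨etgt e, (mem_edgesIn.1 he).2⟩)) (fun e he => ?_) (fun e he e' he' h => ?_) (fun s hs => ?_)
    (fun e he => ?_)
  · rw [SimpleGraph.mem_edgeFinset, SimpleGraph.mem_edgeSet]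
    exact adj_esrc_etgt e
  · rw [Sym2.eq_iff] at h
    simp only [Subtype.mk.injEq] at h
    exact edge_eq_of_endpoints h
  · rw [SimpleGraph.mem_edgeFinset] at hs
    induction s using Sym2.inductionOn with
    | hf u v =>
      rw [SimpleGraph.mem_edgeSet] at hs
      obtain ⟨e, h | h⟩ := exists_edge_of_adj (u := u) (v := v) hs
      · refine ⟨e, mem_edgesIn.2 ⟨by rw [h.1]; exact u.2, by rw [h.2]; exact v.2⟩, ?_⟩
        rw [Sym2.eq_iff]
        exact Or.inl ⟨Subtype.ext h.1, Subtype.ext h.2⟩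
      · refine ⟨e, mem_edgesIn.2 ⟨by rw [h.1]; exact v.2, by rw [h.2]; exact u.2⟩, ?_⟩
        rw [Sym2.eq_iff]
        exact Or.inr ⟨Subtype.ext h.1, Subtype.ext h.2⟩
  · simp only [edgeTerm, Sym2.lift_mk, tau_restrictConfig, tau'_restrictConfig, energy, bond]
    ring

theorem extendPlus_restrictConfig {Ω : Finset Site} {A : Minus} (hA : A.1 ⊆ Ω ∧ A.2 ⊆ Ω) :
    extendPlus Ω (restrictConfig Ω A) = config A := by
  classical
  unfold extendPlus restrictConfig config
  refine Prod.ext (funext fun v => ?_) (funext fun v => ?_)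
  · by_cases h : v ∈ Ω
    · simp [h]
    · simpa [h] using fun h1 => h (hA.1 h1)
  · by_cases h : v ∈ Ω
    · simp [h]
    · simpa [h] using fun h1 => h (hA.2 h1)

open scoped Classical in
/-- Sums over configurations with plus boundary are sums over pairs of minus sets. -/
theorem sum_plusOnBoundary (Ω : Finset Site) (g : Config Ω → ℝ) :
    ∑ σ ∈ Finset.univ.filter (· ∈ plusOnBoundary Ω), g σ =
      ∑ A ∈ minusIn (inner Ω), g (restrictConfig Ω A) := by
  symm
  have hsgn : ∀ b : Bool, sgn b = 1 ↔ b = true := fun b => by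
    cases b <;> simp [sgn]; norm_num
  refine Finset.sum_bij (fun A _ => restrictConfig Ω A) (fun A hA => ?_) (fun A hA A' hA' h => ?_)
    (fun σ hσ => ?_) (fun A _ => rfl)
  · rw [mem_minusIn] at hA
    refine Finset.mem_filter.2 ⟨Finset.mem_univ _, fun v hv => ?_⟩
    obtain ⟨w, hw, hvw⟩ := hv
    have hv' : v.1 ∉ inner Ω := fun h => hw ((mem_inner.1 h).2 w hvw)
    rw [tau_restrictConfig, tau'_restrictConfig]
    exact ⟨spin_of_notMem fun h => hv' (hA.1 h), spin_of_notMem fun h => hv' (hA.2 h)⟩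
  · rw [mem_minusIn] at hA hA'
    have h1 : config A = config A' := by
      rw [← extendPlus_restrictConfig (Ω := Ω)
        ⟨hA.1.trans (inner_subset Ω), hA.2.trans (inner_subset Ω)⟩,
        ← extendPlus_restrictConfig (Ω := Ω)
        ⟨hA'.1.trans (inner_subset Ω), hA'.2.trans (inner_subset Ω)⟩, h]
    refine Prod.ext (Finset.ext fun v => ?_) (Finset.ext fun v => ?_)
    · simpa [config, not_iff_not] using congrFun (congrArg Prod.fst h1) v
    · simpa [config, not_iff_not] using congrFun (congrArg Prod.snd h1) v
  · have hσ := (Finset.mem_filter.1 hσ).2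
    have hin : ∀ v : Ω, v.1 ∉ inner Ω → σ.1 v = true ∧ σ.2 v = true := fun v hv => by
      rw [mem_inner, not_and] at hv
      have h1 := hv v.2
      push Not at h1
      obtain ⟨w, hw, hwΩ⟩ := h1
      have := hσ v ⟨w, hwΩ, hw⟩
      exact ⟨(hsgn _).1 this.1, (hsgn _).1 this.2⟩
    refine ⟨((inner Ω).filter fun v => ∃ h : v ∈ Ω, σ.1 ⟨v, h⟩ = false,
      (inner Ω).filter fun v => ∃ h : v ∈ Ω, σ.2 ⟨v, h⟩ = false),
      mem_minusIn.2 ⟨Finset.filter_subset _ _, Finset.filter_subset _ _⟩, ?_⟩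
    unfold restrictConfig
    refine Prod.ext (funext fun v => ?_) (funext fun v => ?_)
    · by_cases h : v.1 ∈ inner Ω
      · cases h2 : σ.1 v <;> simp [h, h2]
      · simp [h, (hin v h).1]
    · by_cases h : v.1 ∈ inner Ω
      · cases h2 : σ.2 v <;> simp [h, h2]
      · simp [h, (hin v h).2]

theorem finiteMeasure_real_singleton {V : Type*} [Fintype V] (G : SimpleGraph V) (J U : ℝ)
    (σ : Config V) :
    (finiteMeasure G J U).real {σ} = weight G J U σ / partitionFunction G J U := by
  classical
  unfold finiteMeasure
  rw [Measure.real, Measure.finsetSum_apply, Finset.sum_eq_single σ]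
  · rw [Measure.smul_apply, Measure.dirac_apply_of_mem (Set.mem_singleton σ), smul_eq_mul, mul_one,
      ENNReal.toReal_ofReal (div_nonneg (weight_pos _ _ _ _).le (partitionFunction_pos _ _ _).le)]
  · intro σ' _ hne
    rw [Measure.smul_apply, Measure.dirac_apply' _ (measurableSet_singleton σ)]
    simp [hne]
  · intro h
    exact absurd (by convert Finset.mem_univ σ) h

open scoped Classical in
theorem integral_plusMeasure (Ω : Finset Site) (J U : ℝ) (g : Config Ω → ℝ) :
    ∫ σ, g σ ∂(plusMeasure Ω J U) =
      (∑ σ ∈ Finset.univ.filter (· ∈ plusOnBoundary Ω), g σ * weight (inducedGraph Ω) J U σ) /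
        ∑ σ ∈ Finset.univ.filter (· ∈ plusOnBoundary Ω), weight (inducedGraph Ω) J U σ := by
  set Z := partitionFunction (inducedGraph Ω) J U with hZ
  have hZ0 : Z ≠ 0 := (partitionFunction_pos _ _ _).ne'
  set μ := finiteMeasure (inducedGraph Ω) J U with hμ
  have hB : μ.real (plusOnBoundary Ω) =
      (∑ σ ∈ Finset.univ.filter (· ∈ plusOnBoundary Ω), weight (inducedGraph Ω) J U σ) / Z := by
    have h1 : plusOnBoundary Ω = ((Finset.univ.filter (· ∈ plusOnBoundary Ω) :
        Finset (Config Ω)) : Set (Config Ω)) := by ext; simp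
    rw [h1, ← sum_measureReal_singleton, Finset.sum_div]
    refine Finset.sum_congr (by simp) fun σ _ => finiteMeasure_real_singleton _ _ _ _
  have hs : ∀ σ, (plusMeasure Ω J U).real {σ} = if σ ∈ plusOnBoundary Ω then
      (μ.real (plusOnBoundary Ω))⁻¹ * (weight (inducedGraph Ω) J U σ / Z) else 0 := fun σ => by
    unfold plusMeasure
    rw [Measure.real, cond_apply (Set.toFinite _).measurableSet, ENNReal.toReal_mul,
      ENNReal.toReal_inv]
    change (μ.real (plusOnBoundary Ω))⁻¹ * μ.real (plusOnBoundary Ω ∩ {σ}) = _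
    split_ifs with h
    · rw [Set.inter_eq_right.2 (Set.singleton_subset_iff.2 h), finiteMeasure_real_singleton]
    · rw [Set.inter_singleton_eq_empty.2 h]; simp
  rw [integral_fintype (Integrable.of_finite), Finset.sum_filter, Finset.sum_div]
  refine Finset.sum_congr (by ext; simp) fun σ _ => ?_
  rw [hs, hB]
  split_ifs with h
  · rw [smul_eq_mul, inv_div]
    field_simp
  · simp

/-- Finite-volume expectations as sums over pairs of minus sets. -/
theorem integral_plusMeasureOnLattice (Ω : Finset Site) (J U : ℝ) {F : Config Site → ℝ}
    (hF : Measurable F) :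
    ∫ σ, F σ ∂(plusMeasureOnLattice Ω J U : Measure (Config Site)) =
      state ⟨J, J, U⟩ (inner Ω) fun A => F (config A) := by
  classical
  unfold plusMeasureOnLattice
  rw [ProbabilityMeasure.coe_mk, integral_map (measurable_extendPlus Ω).aemeasurable
    hF.aestronglyMeasurable, integral_plusMeasure, sum_plusOnBoundary, sum_plusOnBoundary,
    ← gibbs_eq_state _ (touch_inner_subset Ω)]
  unfold gibbs
  simp only [weight_restrictConfig]
  congr 1
  refine Finset.sum_congr rfl fun A hA => ?_
  rw [mem_minusIn] at hA
  rw [extendPlus_restrictConfig ⟨hA.1.trans (inner_subset Ω), hA.2.trans (inner_subset Ω)⟩]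

end FiniteVolume

/-! ### Existence and uniqueness of the infinite-volume plus measure. -/

section WeakLimit

/-- Continuous functions which are nonnegative combinations of characters of the minus sets. -/
structure PosObs (F : Config Site → ℝ) : Prop where
  continuous : Continuous F
  posFun : PosFun fun A => F (config A)

theorem PosObs.add {F G : Config Site → ℝ} (hF : PosObs F) (hG : PosObs G) :
    PosObs fun σ => F σ + G σ := ⟨hF.1.add hG.1, PosFun.add _ _ hF.2 hG.2⟩

theorem PosObs.mul {F G : Config Site → ℝ} (hF : PosObs F) (hG : PosObs G) :
    PosObs fun σ => F σ * G σ := ⟨hF.1.mul hG.1, hF.2.mul hG.2⟩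

theorem PosObs.const {c : ℝ} (hc : 0 ≤ c) : PosObs fun _ => c := ⟨continuous_const, PosFun.const hc⟩

theorem posObs_tau (v : Site) : PosObs fun σ => tau σ v where
  continuous := (continuous_of_discreteTopology (f := sgn)).comp
    ((continuous_apply v).comp continuous_fst)
  posFun := by
    simp only [tau_config]
    exact (isChar_spin_fst v).posFun

theorem posObs_tau' (v : Site) : PosObs fun σ => tau' σ v where
  continuous := (continuous_of_discreteTopology (f := sgn)).comp
    ((continuous_apply v).comp continuous_snd)
  posFun := by
    simp only [tau'_config]
    exact (isChar_spin_snd v).posFun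

theorem PosObs.measurable {F : Config Site → ℝ} (hF : PosObs F) : Measurable F :=
  hF.continuous.measurable

theorem PosObs.integrable {F : Config Site → ℝ} (hF : PosObs F)
    (μ : ProbabilityMeasure (Config Site)) : Integrable F (μ : Measure (Config Site)) :=
  (BoundedContinuousFunction.mkOfCompact ⟨F, hF.continuous⟩).integrable _

/-- The neighbours of the sites of `I`, together with `I`. -/
def thicken (I : Finset Site) : Finset Site := I ∪ (touch I).image esrc ∪ (touch I).image etgt

theorem subset_inner_thicken (I : Finset Site) : I ⊆ inner (thicken I) := fun v hv => by
  rw [mem_inner]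
  refine ⟨by simp [thicken, hv], fun w hw => ?_⟩
  obtain ⟨e, ⟨h1, h2⟩ | ⟨h1, h2⟩⟩ := exists_edge_of_adj hw
  · exact Finset.mem_union_right _ (Finset.mem_image.2 ⟨e, mem_touch.2 (Or.inl (h1 ▸ hv)), h2⟩)
  · exact Finset.mem_union_left _ (Finset.mem_union_right _
      (Finset.mem_image.2 ⟨e, mem_touch.2 (Or.inr (h2 ▸ hv)), h1⟩))

variable {J U : ℝ}

/-- Griffiths makes the net of expectations decreasing in the volume and bounded below by zero. -/
theorem tendsto_state (hJ : 0 ≤ J) (hU : 0 ≤ U) {F : Config Site → ℝ} (hF : PosObs F) :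
    ∃ L, Tendsto (fun Ω => ∫ σ, F σ ∂(plusMeasureOnLattice Ω J U : Measure (Config Site)))
      atTop (𝓝 L) := by
  have hK : (⟨J, J, U⟩ : Coupling).Nonneg := ⟨hJ, hJ, hU⟩
  simp only [integral_plusMeasureOnLattice _ _ _ hF.measurable]
  refine ⟨_, tendsto_atTop_ciInf (fun Ω Ω' h => state_anti hK (inner_mono h) hF.posFun) ⟨0, ?_⟩⟩
  rintro _ ⟨Ω, rfl⟩
  exact gibbs_nonneg hK _ _ hF.posFun

theorem continuous_integral_of_continuous {F : Config Site → ℝ} (hF : Continuous F) :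
    Continuous fun μ : ProbabilityMeasure (Config Site) => ∫ σ, F σ ∂(μ : Measure (Config Site)) :=
  continuous_iff_continuousAt.2 fun _ =>
    ProbabilityMeasure.tendsto_iff_forall_integral_tendsto.1 tendsto_id
      (BoundedContinuousFunction.mkOfCompact ⟨F, hF⟩)

theorem integral_eq_of_clusterPt {F : Config Site → ℝ} (hF : PosObs F) {L : ℝ}
    (hL : Tendsto (fun Ω => ∫ σ, F σ ∂(plusMeasureOnLattice Ω J U : Measure (Config Site)))
      atTop (𝓝 L)) {μ : ProbabilityMeasure (Config Site)}
    (hμ : ClusterPt μ (map (fun Ω => plusMeasureOnLattice Ω J U) atTop)) :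
    ∫ σ, F σ ∂(μ : Measure (Config Site)) = L := by
  have h1 := hμ.map (continuous_integral_of_continuous hF.continuous).continuousAt tendsto_map
  rw [Filter.map_map] at h1
  have h2 : ClusterPt (∫ σ, F σ ∂(μ : Measure (Config Site))) (𝓝 L) := h1.mono hL
  exact @eq_of_nhds_neBot _ _ _ _ _ h2

/-- The algebra of differences of positive observables. -/
def obsAlgebra : StarSubalgebra ℝ (BoundedContinuousFunction (Config Site) ℝ) where
  carrier := {f | ∃ F G, PosObs F ∧ PosObs G ∧ ∀ σ, f σ = F σ - G σ}
  mul_mem' := by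
    rintro f f' ⟨F, G, hF, hG, h⟩ ⟨F', G', hF', hG', h'⟩
    refine ⟨_, _, (hF.mul hF').add (hG.mul hG'), (hF.mul hG').add (hG.mul hF'), fun σ => ?_⟩
    rw [BoundedContinuousFunction.mul_apply, h, h']
    ring
  add_mem' := by
    rintro f f' ⟨F, G, hF, hG, h⟩ ⟨F', G', hF', hG', h'⟩
    refine ⟨_, _, hF.add hF', hG.add hG', fun σ => ?_⟩
    rw [BoundedContinuousFunction.add_apply, h, h']
    ring
  algebraMap_mem' := fun r => by
    refine ⟨_, _, PosObs.const (le_max_right r 0), PosObs.const (le_max_right (-r) 0), fun σ => ?_⟩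
    have : (algebraMap ℝ (BoundedContinuousFunction (Config Site) ℝ) r) σ = r := by
      simp
    rw [this]
    rcases le_total 0 r with h | h
    · rw [max_eq_left h, max_eq_right (by linarith), sub_zero]
    · rw [max_eq_right h, max_eq_left (by linarith)]; ring
  star_mem' := by
    rintro f ⟨F, G, hF, hG, h⟩
    exact ⟨F, G, hF, hG, fun σ => by rw [BoundedContinuousFunction.star_apply, star_trivial, h]⟩

theorem obsAlgebra_separatesPoints :
    (obsAlgebra.map (BoundedContinuousFunction.toContinuousMapStarₐ ℝ)).SeparatesPoints := by
  intro σ σ' hne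
  have hsgn : ∀ a b : Bool, a ≠ b → sgn a ≠ sgn b := fun a b h => by
    cases a <;> cases b <;> simp [sgn] at h ⊢ <;> norm_num
  have key : ∀ F : Config Site → ℝ, PosObs F → F σ ≠ F σ' →
      ∃ f ∈ (fun f : C(Config Site, ℝ) => (f : Config Site → ℝ)) ''
        (obsAlgebra.map (BoundedContinuousFunction.toContinuousMapStarₐ ℝ) : Set _), f σ ≠ f σ' :=
    fun F hF h => by
    refine ⟨F, ⟨⟨F, hF.continuous⟩, ?_, rfl⟩, h⟩
    refine ⟨BoundedContinuousFunction.mkOfCompact ⟨F, hF.continuous⟩,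
      ⟨F, _, hF, PosObs.const le_rfl, fun σ => by simp⟩, ?_⟩
    ext; rfl
  by_contra hcon
  have h1 : ∀ F : Config Site → ℝ, PosObs F → F σ = F σ' := fun F hF => by
    by_contra h
    exact hcon (key F hF h)
  refine hne (Prod.ext (funext fun v => ?_) (funext fun v => ?_)) <;> by_contra h
  · exact hsgn _ _ h (h1 _ (posObs_tau v))
  · exact hsgn _ _ h (h1 _ (posObs_tau' v))

instance : PolishSpace (Config Site) := by
  let _ : MetricSpace (Config Site) := TopologicalSpace.metrizableSpaceMetric _
  infer_instance

/-- The differences of positive observables form an algebra containing all single spins, hence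
separating points, and such an algebra determines a probability measure. -/
theorem eq_of_posObs {μ ν : ProbabilityMeasure (Config Site)}
    (h : ∀ F, PosObs F → ∫ σ, F σ ∂(μ : Measure (Config Site)) =
      ∫ σ, F σ ∂(ν : Measure (Config Site))) : μ = ν := by
  refine Subtype.ext (ext_of_forall_mem_subalgebra_integral_eq_of_polish
    (P := (μ : Measure (Config Site))) (P' := (ν : Measure (Config Site)))
    obsAlgebra_separatesPoints ?_)
  rintro f ⟨F, G, hF, hG, hf⟩
  simp only [hf]
  rw [integral_sub (hF.integrable μ) (hG.integrable μ),
    integral_sub (hF.integrable ν) (hG.integrable ν)]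
  exact congrArg₂ _ (h F hF) (h G hG)

/-- The infinite-volume plus measure exists. -/
theorem exists_isPlusLimit (hJ : 0 ≤ J) (hU : 0 ≤ U) : ∃ μ, IsPlusLimit J U μ := by
  obtain ⟨μ, hμ⟩ := exists_clusterPt_of_compactSpace
    (map (fun Ω => plusMeasureOnLattice Ω J U) atTop)
  -- By compactness it is enough that all cluster points agree, and positive observables have
  -- convergent expectations.
  refine ⟨μ, le_nhds_of_unique_clusterPt fun ν hν => eq_of_posObs fun F hF => ?_⟩
  obtain ⟨L, hL⟩ := tendsto_state hJ hU hF
  rw [integral_eq_of_clusterPt hF hL hμ, integral_eq_of_clusterPt hF hL hν]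

theorem existsUnique_isPlusLimit (hJ : 0 ≤ J) (hU : 0 ≤ U) : ∃! μ, IsPlusLimit J U μ := by
  obtain ⟨μ, hμ⟩ := exists_isPlusLimit hJ hU
  exact ⟨μ, hμ, fun ν hν => tendsto_nhds_unique hν hμ⟩

variable {μ : ProbabilityMeasure (Config Site)}

theorem IsPlusLimit.tendsto_state (hμ : IsPlusLimit J U μ) {F : Config Site → ℝ} (hF : PosObs F) :
    Tendsto (fun Ω => state ⟨J, J, U⟩ (inner Ω) fun A => F (config A)) atTop
      (𝓝 (∫ σ, F σ ∂(μ : Measure (Config Site)))) := by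
  have := ((continuous_integral_of_continuous hF.continuous).tendsto μ).comp hμ
  refine this.congr fun Ω => ?_
  exact integral_plusMeasureOnLattice Ω J U hF.measurable

/-- The limit is a decreasing one, so every finite volume gives an upper bound; this is what permits
choosing a volume adapted to `x`. -/
theorem IsPlusLimit.integral_le (hJ : 0 ≤ J) (hU : 0 ≤ U) (hμ : IsPlusLimit J U μ)
    {F : Config Site → ℝ} (hF : PosObs F) (I : Finset Site) :
    ∫ σ, F σ ∂(μ : Measure (Config Site)) ≤ state ⟨J, J, U⟩ I fun A => F (config A) := by
  refine le_of_tendsto (hμ.tendsto_state hF) ?_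
  filter_upwards [eventually_ge_atTop (thicken I)] with Ω hΩ
  exact state_anti ⟨hJ, hJ, hU⟩ ((subset_inner_thicken I).trans (inner_mono hΩ)) hF.posFun

theorem IsPlusLimit.le_integral (hμ : IsPlusLimit J U μ) {F : Config Site → ℝ} (hF : PosObs F)
    {C : ℝ} (hC : ∀ I, C ≤ state ⟨J, J, U⟩ I fun A => F (config A)) :
    C ≤ ∫ σ, F σ ∂(μ : Measure (Config Site)) :=
  ge_of_tendsto' (hμ.tendsto_state hF) fun _ => hC _

end WeakLimit

/-! ### Changes of spin variables and finite-volume bounds for the correlations. -/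

section Symmetries

/-- Change of variables in finite volume. -/
theorem state_reindex {K K' : Coupling} (φ : Minus → Minus) (hφ : ∀ A, φ (φ A) = A)
    (hmem : ∀ I, ∀ A ∈ minusIn I, φ A ∈ minusIn I) (he : ∀ A e, energy K (φ A) e = energy K' A e)
    (I : Finset Site) (f : Minus → ℝ) : state K I f = state K' I fun A => f (φ A) := by
  have hsum : ∀ g : Minus → ℝ, ∑ A ∈ minusIn I, g A = ∑ A ∈ minusIn I, g (φ A) := fun g =>
    (Finset.sum_nbij' φ φ (hmem I) (hmem I) (fun A _ => hφ A) (fun A _ => hφ A)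
      (fun _ _ => rfl)).symm
  have hb : ∀ A, boltz K (touch I) (φ A) = boltz K' (touch I) A := fun A => by
    unfold boltz; simp only [he]
  unfold state gibbs
  rw [hsum, hsum (boltz K (touch I))]
  simp only [hb]

theorem bond_sq (A : Finset Site) (e : Edge) : bond A e * bond A e = 1 := by
  rcases bond_eq_or A e with h | h <;> rw [h] <;> norm_num

/-- The new second layer is the product of the two spins. The product of the new layers is then the
old second layer, so `k₂` and `k₃` change places. -/
theorem state_symmDiff_snd (a b c : ℝ) (I : Finset Site) (f : Minus → ℝ) :
    state ⟨a, b, c⟩ I f = state ⟨a, c, b⟩ I fun A => f (A.1, symmDiff A.1 A.2) := by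
  refine state_reindex (fun A => (A.1, symmDiff A.1 A.2)) (fun A => ?_) (fun I A hA => ?_)
    (fun A e => ?_) I f
  · simp
  · rw [mem_minusIn] at *
    exact ⟨hA.1, symmDiff_subset' hA.1 hA.2⟩
  · simp only [energy, bond_symmDiff]
    linear_combination c * bond A.2 e * bond_sq A.1 e

theorem state_symmDiff_fst (a b c : ℝ) (I : Finset Site) (f : Minus → ℝ) :
    state ⟨a, b, c⟩ I f = state ⟨c, b, a⟩ I fun A => f (symmDiff A.1 A.2, A.2) := by
  refine state_reindex (fun A => (symmDiff A.1 A.2, A.2)) (fun A => ?_) (fun I A hA => ?_)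
    (fun A e => ?_) I f
  · simp
  · rw [mem_minusIn] at *
    exact ⟨symmDiff_subset' hA.1 hA.2, hA.2⟩
  · simp only [energy, bond_symmDiff]
    linear_combination c * bond A.1 e * bond_sq A.2 e

theorem state_swap (a c : ℝ) (I : Finset Site) (f : Minus → ℝ) :
    state ⟨a, a, c⟩ I f = state ⟨a, a, c⟩ I fun A => f (A.2, A.1) := by
  refine state_reindex (fun A => (A.2, A.1)) (fun A => rfl) (fun I A hA => ?_)
    (fun A e => ?_) I f
  · rw [mem_minusIn] at *
    exact hA.symm
  · simp only [energy]
    ring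

theorem subset_ballAt (I : Finset Site) (x : Site) : ∃ n, I ⊆ ballAt x n :=
  ⟨I.sup (fun v => nrm (v - x)) + 1, fun _ hv => mem_ballAt.2 (Nat.lt_succ_of_le
    (Finset.le_sup (f := fun v => nrm (v - x)) hv))⟩

theorem le_state_spin {K : Coupling} (hK : K.Nonneg) {C : ℝ} (hC : ∀ n, C ≤ magnet K n)
    (I : Finset Site) (x : Site) : C ≤ state K I fun A => spin A.1 x := by
  obtain ⟨n, hn⟩ := subset_ballAt I x
  refine (hC n).trans ?_
  rw [← state_ballAt K x n]
  exact state_anti hK hn (isChar_spin_fst x).posFun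

theorem le_state_spin_mul {K : Coupling} (hK : K.Nonneg) {C : ℝ} (hC0 : 0 < C)
    (hC : ∀ n, C ≤ magnet K n) (I : Finset Site) (x : Site) :
    C * C ≤ state K I fun A => spin A.1 0 * spin A.1 x := by
  refine le_trans ?_ (gibbs_mul_le hK _ I (isChar_spin_fst 0).posFun (isChar_spin_fst x).posFun)
  exact mul_le_mul (le_state_spin hK hC I 0) (le_state_spin hK hC I x) hC0.le
    (hC0.le.trans (le_state_spin hK hC I 0))

theorem spin_self_of_mem {x : Site} {A : Finset Site} (hA : A ⊆ box (nrm x)) : spin A x = 1 :=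
  spin_of_notMem fun h => by
    have := mem_box.1 (hA h)
    omega

/-- The box is open, so `x` is just outside it and its spin is plus. -/
theorem state_spin_mul_eq (K : Coupling) (x : Site) :
    state K (box (nrm x)) (fun A => spin A.1 0 * spin A.1 x) = magnet K (nrm x) :=
  gibbs_congr _ _ _ fun A hA => by rw [spin_self_of_mem (mem_minusIn.1 hA).1, mul_one]

/-- In this box both spins at `x` are plus, and what remains is the mean of the product at the
origin, which the random-cluster representation bounds by that of the first layer. -/
theorem state_spin_quad_le {K : Coupling} (hK : K.Admissible) (x : Site) :
    state K (box (nrm x)) (fun A => spin A.1 0 * spin A.2 0 * spin A.1 x * spin A.2 x) ≤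
      magnet K (nrm x) := by
  refine le_trans (le_of_eq ?_) (gibbs_spin_mul_spin_le hK (box (nrm x)) 0)
  refine gibbs_congr _ _ _ fun A hA => ?_
  rw [spin_self_of_mem (mem_minusIn.1 hA).1, spin_self_of_mem (mem_minusIn.1 hA).2]
  ring

/-- Griffiths separates the two layers, which have the same law by symmetry, and then the two sites;
hence the fourth power. -/
theorem le_state_spin_quad {a c : ℝ} (hK : (⟨a, a, c⟩ : Coupling).Nonneg) {C : ℝ} (hC0 : 0 < C)
    (hC : ∀ n, C ≤ magnet ⟨a, a, c⟩ n) (I : Finset Site) (x : Site) :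
    C * C * (C * C) ≤
      state ⟨a, a, c⟩ I fun A => spin A.1 0 * spin A.2 0 * spin A.1 x * spin A.2 x := by
  have h1 := le_state_spin_mul hK hC0 hC I x
  have h2 : C * C ≤ state ⟨a, a, c⟩ I fun A => spin A.2 0 * spin A.2 x := by
    rw [state_swap]; exact h1
  have h3 := gibbs_mul_le hK (touch I) I
    ((isChar_spin_fst 0).posFun.mul (isChar_spin_fst x).posFun)
    ((isChar_spin_snd 0).posFun.mul (isChar_spin_snd x).posFun)
  refine (mul_le_mul h1 h2 (mul_pos hC0 hC0).le ((mul_pos hC0 hC0).le.trans h1)).trans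
    (h3.trans_eq ?_)
  exact gibbs_congr _ _ _ fun A _ => by ring

end Symmetries

/-! ### The critical points and the two transitions. -/

section Transition

/-- The magnetisation has a sharp transition at a positive inverse temperature. -/
theorem exists_critical {K : Coupling} (hK : K.Admissible) :
    ∃ bc, 0 < bc ∧ ∀ b, 0 < b →
      (b < bc → ∃ r, 0 < r ∧ ∀ n : ℕ, magnet (K.scale b) n ≤ Real.exp (-(r * n))) ∧
      (bc < b → ∃ C, 0 < C ∧ ∀ n, C ≤ magnet (K.scale b) n) := by
  set S := {b : ℝ | 0 < b ∧ Tendsto (magnet (K.scale b)) atTop (𝓝 0)} with hS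
  obtain ⟨b₀, hb₀, h₀⟩ := exists_magnet_tendsto_zero hK
  obtain ⟨b₁, hb₁, h₁⟩ := exists_half_le_magnet hK.nonneg (hK.1.trans_le hK.2.1)
  have hbdd : BddAbove S := ⟨b₁, fun b hb => by
    by_contra hlt
    have h2 : ∀ n, 1 / 2 ≤ magnet (K.scale b) n := fun n =>
      (h₁ n).trans (magnet_mono hK.nonneg hb₁.le (not_le.1 hlt).le n)
    have := ge_of_tendsto' hb.2 h2
    norm_num at this⟩
  -- The critical point is the supremum of the inverse temperatures with vanishing magnetisation.
  -- Below it some `b' > b` lies in `S`, and sharpness applies; above it the decreasing sequence has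
  -- a nonzero limit, which bounds it below.
  refine ⟨sSup S, hb₀.trans_le (le_csSup hbdd ⟨hb₀, h₀⟩), fun b hb => ⟨fun hlt => ?_, fun hlt => ?_⟩⟩
  · obtain ⟨b', hb', hbb⟩ := exists_lt_of_lt_csSup (s := S) ⟨b₀, hb₀, h₀⟩ hlt
    exact magnet_exp_decay hK hb hbb hb'.2
  · have hA := magnet_anti (hK.scale hb).nonneg
    have h0 := magnet_nonneg (hK.scale hb).nonneg
    have hlim := tendsto_atTop_ciInf hA ⟨0, by rintro _ ⟨n, rfl⟩; exact h0 n⟩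
    set L := ⨅ n, magnet (K.scale b) n with hL
    have hLn : ∀ n, L ≤ magnet (K.scale b) n := fun n => hA.le_of_tendsto hlim n
    have hL0 : 0 ≤ L := ge_of_tendsto' hlim h0
    refine ⟨L, lt_of_le_of_ne hL0 fun h => ?_, hLn⟩
    rw [← h] at hlim
    exact absurd (le_csSup hbdd ⟨hb, hlim⟩) (not_le.2 hlt)

theorem norm_eq_nrm (x : Site) : ‖x‖ = (nrm x : ℝ) := by
  rw [Prod.norm_def, nrm, Int.norm_eq_abs, Int.norm_eq_abs, Nat.cast_max, Nat.cast_natAbs,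
    Nat.cast_natAbs, Int.cast_abs, Int.cast_abs]

/-- A correlation controlled by a magnetisation has a sharp transition. -/
theorem exists_critical_of_le {J U : ℝ} {K : Coupling} (hK : K.Admissible)
    {corr : ProbabilityMeasure (Config Site) → Site → ℝ}
    (hle : ∀ b, 0 < b → ∀ μ, IsPlusLimit (b * J) (b * U) μ → ∀ x,
      corr μ x ≤ magnet (K.scale b) (nrm x))
    (hge : ∀ b, 0 < b → ∀ μ, IsPlusLimit (b * J) (b * U) μ → ∀ C, 0 < C →
      (∀ n, C ≤ magnet (K.scale b) n) → ∃ C', 0 < C' ∧ ∀ x, C' ≤ corr μ x) :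
    ∃ βc : ℝ, 0 < βc ∧ ∀ (β : ℝ) (μ : ProbabilityMeasure (Config Site)), 0 < β →
      IsPlusLimit (β * J) (β * U) μ →
      (β < βc → ∃ c : ℝ, 0 < c ∧ ∀ x : Site, corr μ x ≤ Real.exp (-(c * ‖x‖))) ∧
      (βc < β → ∃ C : ℝ, 0 < C ∧ ∀ x : Site, C ≤ corr μ x) := by
  obtain ⟨βc, h0, h⟩ := exists_critical hK
  refine ⟨βc, h0, fun β μ hβ hμ => ⟨fun hlt => ?_, fun hlt => ?_⟩⟩
  · obtain ⟨r, hr, hdec⟩ := (h β hβ).1 hlt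
    refine ⟨r, hr, fun x => (hle β hβ μ hμ x).trans ?_⟩
    rw [norm_eq_nrm]
    exact hdec _
  · obtain ⟨C, hC, hCn⟩ := (h β hβ).2 hlt
    exact hge β hβ μ hμ C hC hCn

theorem posObs_corrTau (x : Site) : PosObs fun σ => tau σ 0 * tau σ x :=
  (posObs_tau 0).mul (posObs_tau x)

theorem posObs_corrProd (x : Site) : PosObs fun σ => tau σ 0 * tau' σ 0 * tau σ x * tau' σ x :=
  (((posObs_tau 0).mul (posObs_tau' 0)).mul (posObs_tau x)).mul (posObs_tau' x)

variable {J U : ℝ}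

/-- The transition of `τ`, in the random-cluster variables `K` in which `τ` is the first layer. -/
theorem exists_critical_corrTau_of (hJ : 0 < J) (hU : 0 < U) {K : Coupling} (hK : K.Admissible)
    (hstate : ∀ b I x, state ⟨b * J, b * J, b * U⟩ I (fun A => spin A.1 0 * spin A.1 x) =
      state (K.scale b) I (fun A => spin A.1 0 * spin A.1 x)) :
    ∃ βc : ℝ, 0 < βc ∧ ∀ (β : ℝ) (μ : ProbabilityMeasure (Config Site)), 0 < β →
      IsPlusLimit (β * J) (β * U) μ →
      (β < βc → ∃ c : ℝ, 0 < c ∧ ∀ x : Site, corrTau μ x ≤ Real.exp (-(c * ‖x‖))) ∧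
      (βc < β → ∃ C : ℝ, 0 < C ∧ ∀ x : Site, C ≤ corrTau μ x) := by
  refine exists_critical_of_le hK (fun b hb μ hμ x => ?_) fun b hb μ hμ C hC hCn =>
    ⟨C * C, mul_pos hC hC, fun x => hμ.le_integral (posObs_corrTau x) fun I => ?_⟩
  · refine (hμ.integral_le (by positivity) (by positivity) (posObs_corrTau x)
      (box (nrm x))).trans_eq ?_
    simp only [tau_config]
    rw [hstate, state_spin_mul_eq]
  · simp only [tau_config]
    rw [hstate]
    exact le_state_spin_mul (hK.scale hb).nonneg hC hCn I x

/-- For `U ≤ J` the original layers are admissible; for `U ≥ J` the second layer becomes `ττ'`,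
which leaves `τ` first and the smaller coupling `J` as the interaction. -/
theorem exists_critical_corrTau (hJ : 0 < J) (hU : 0 < U) :
    ∃ βc : ℝ, 0 < βc ∧ ∀ (β : ℝ) (μ : ProbabilityMeasure (Config Site)), 0 < β →
      IsPlusLimit (β * J) (β * U) μ →
      (β < βc → ∃ c : ℝ, 0 < c ∧ ∀ x : Site, corrTau μ x ≤ Real.exp (-(c * ‖x‖))) ∧
      (βc < β → ∃ C : ℝ, 0 < C ∧ ∀ x : Site, C ≤ corrTau μ x) := by
  rcases le_total U J with h | h
  · exact exists_critical_corrTau_of hJ hU (K := ⟨J, J, U⟩) ⟨hU, h, h⟩ fun _ _ _ => rfl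
  · exact exists_critical_corrTau_of hJ hU (K := ⟨J, U, J⟩) ⟨hJ, le_rfl, h⟩ fun _ _ _ =>
      state_symmDiff_snd _ _ _ _ _

/-- For `U ≤ J` the product is squeezed by the magnetisation of `τ` and has the same critical point.
For `U ≥ J` it is itself the first layer, in the variables `(ττ', τ')` with couplings `(U, J, J)`.
-/
theorem exists_critical_corrProd (hJ : 0 < J) (hU : 0 < U) :
    ∃ βc : ℝ, 0 < βc ∧ ∀ (β : ℝ) (μ : ProbabilityMeasure (Config Site)), 0 < β →
      IsPlusLimit (β * J) (β * U) μ →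
      (β < βc → ∃ c : ℝ, 0 < c ∧ ∀ x : Site, corrProd μ x ≤ Real.exp (-(c * ‖x‖))) ∧
      (βc < β → ∃ C : ℝ, 0 < C ∧ ∀ x : Site, C ≤ corrProd μ x) := by
  rcases le_total U J with h | h
  · have hK : (⟨J, J, U⟩ : Coupling).Admissible := ⟨hU, h, h⟩
    refine exists_critical_of_le hK (fun b hb μ hμ x => ?_) fun b hb μ hμ C hC hCn =>
      ⟨C * C * (C * C), by positivity, fun x => hμ.le_integral (posObs_corrProd x) fun I => ?_⟩
    · refine (hμ.integral_le (by positivity) (by positivity) (posObs_corrProd x)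
        (box (nrm x))).trans ?_
      simp only [tau_config, tau'_config]
      exact state_spin_quad_le (hK.scale hb) x
    · simp only [tau_config, tau'_config]
      exact le_state_spin_quad (hK.scale hb).nonneg hC hCn I x
  · have hK : (⟨U, J, J⟩ : Coupling).Admissible := ⟨hJ, h, le_rfl⟩
    have hstate : ∀ b I x, state ⟨b * J, b * J, b * U⟩ I
        (fun A => spin A.1 0 * spin A.2 0 * spin A.1 x * spin A.2 x) =
        state (Coupling.scale b ⟨U, J, J⟩) I (fun A => spin A.1 0 * spin A.1 x) := fun b I x => by
      rw [state_symmDiff_fst]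
      refine gibbs_congr _ _ _ fun A _ => ?_
      simp only [spin_symmDiff]
      linear_combination spin A.1 0 * spin A.1 x * (spin A.2 x * spin A.2 x) * spin_sq A.2 0 +
        spin A.1 0 * spin A.1 x * spin_sq A.2 x
    refine exists_critical_of_le hK (fun b hb μ hμ x => ?_) fun b hb μ hμ C hC hCn =>
      ⟨C * C, mul_pos hC hC, fun x => hμ.le_integral (posObs_corrProd x) fun I => ?_⟩
    · refine (hμ.integral_le (by positivity) (by positivity) (posObs_corrProd x)
        (box (nrm x))).trans_eq ?_
      simp only [tau_config, tau'_config]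
      rw [hstate, state_spin_mul_eq]
    · simp only [tau_config, tau'_config]
      rw [hstate]
      exact le_state_spin_mul (hK.scale hb).nonneg hC hCn I x

end Transition

end AshkinTeller
end

/-- Sharpness of both transitions of the Ashkin–Teller model on `ℤ²` with plus boundary
conditions. The norm on `Site = ℤ × ℤ` is the supremum norm. -/
theorem mainTheorem5 (J U : ℝ) (hJ : 0 < J) (hU : 0 < U) :
    (∀ β : ℝ, 0 < β → ∃! μ : ProbabilityMeasure (AshkinTeller.Config AshkinTeller.Site),
      AshkinTeller.IsPlusLimit (β * J) (β * U) μ) ∧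
    (∃ βc : ℝ, 0 < βc ∧
      ∀ (β : ℝ) (μ : ProbabilityMeasure (AshkinTeller.Config AshkinTeller.Site)), 0 < β →
        AshkinTeller.IsPlusLimit (β * J) (β * U) μ →
        (β < βc → ∃ c : ℝ, 0 < c ∧
          ∀ x : AshkinTeller.Site, AshkinTeller.corrTau μ x ≤ Real.exp (-(c * ‖x‖))) ∧
        (βc < β → ∃ C : ℝ, 0 < C ∧
          ∀ x : AshkinTeller.Site, C ≤ AshkinTeller.corrTau μ x)) ∧
    (∃ βc' : ℝ, 0 < βc' ∧
      ∀ (β : ℝ) (μ : ProbabilityMeasure (AshkinTeller.Config AshkinTeller.Site)), 0 < β →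
        AshkinTeller.IsPlusLimit (β * J) (β * U) μ →
        (β < βc' → ∃ c : ℝ, 0 < c ∧
          ∀ x : AshkinTeller.Site, AshkinTeller.corrProd μ x ≤ Real.exp (-(c * ‖x‖))) ∧
        (βc' < β → ∃ C : ℝ, 0 < C ∧
          ∀ x : AshkinTeller.Site, C ≤ AshkinTeller.corrProd μ x)) :=
  ⟨fun β hβ => AshkinTeller.existsUnique_isPlusLimit (by positivity) (by positivity),
    AshkinTeller.exists_critical_corrTau hJ hU, AshkinTeller.exists_critical_corrProd hJ hU⟩
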